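/- **Setting.** Let $\varepsilon,z\in\mathbb R$, $0<\delta<1$, $\nu_0>0$, let $B$ be a standard Brownian motion on $\mathbb R$ started at $0$ (with expectation $\mathbb E$), and let $\theta(x,\xi)=\hat T|_{t=0}(x,\xi)$ be a complex-valued initial datum which for each $\xi$ is bounded and continuous in $x$. For a continuous velocity field $v=v(x)$ (steady case) put $$\hat T(x,\xi,t;v)=\mathbb E\Big[e^{-\frac{\nu_0}{2}\xi^2t}\,e^{-i\xi\int_0^t v(x+\sqrt{\nu_0}B_s)\,ds}\,\theta(x+\sqrt{\nu_0}B_t,\xi)\Big],$$ and for a continuous $v=v(x,t)$ (unsteady case) replace $v(x+\sqrt{\nu_0}B_s)$ by $v(x+\sqrt{\nu_0}B_s,t-s)$. For $0\le l\le-\log\delta$ let $v_>=v_>^{(l)}$ be a centered real Gaussian random field, independent of $B$, with continuous samples and spectrum $$\langle|\hat v_>(k)|^2\rangle=\sqrt{2\pi}\,1_{e^{-l}<|k|\le1}|k|^{1-\varepsilon}\quad\text{(steady)},\qquad \langle|\hat v_>(k,\omega)|^2\rangle=\sqrt{2\pi}\,1_{e^{-l}\le|k|\le1}|k|^{1-\varepsilon}\frac{|k|^z}{|k|^{2z}+\omega^2}\quad\text{(unsteady)},$$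 i.e. with stationary covariance equal to $\frac1{\sqrt{2\pi}}$ times the integral of the spectrum against $e^{ik(x-y)}$, respectively $e^{ik(x-y)+i\omega(t-r)}$. Let $$\bar T_l(x,\xi,t;v_<)=\langle\hat T(x,\xi,t;v_<+v_>)\rangle_{v_>}$$ be the average over $v_>$ at fixed $v_<$, a functional of the continuous field $v_<$, and let $$C_l(y)=\int_{e^{-l}}^1e^{iyk}|k|^{1-\varepsilon}dk\quad\text{(steady)},\qquad C_l(y,\tau)=\int_{-\infty}^\infty\int_{e^{-l}}^1e^{iyk+i\tau\omega}|k|^{1-\varepsilon}\frac{|k|^z}{|k|^{2z}+\omega^2}\,dk\,d\omega\quad\text{(unsteady)}.$$ Functional derivatives are kernels: $\delta F/\delta v$ at $v$ is the locally integrable function with $\frac{d}{da}\big|_{a=0}F(v+a\varphi)=\int\frac{\delta F}{\delta v(x')}\varphi(x')dx'$ for all smooth compactly supported $\varphi$. Likewise $\delta^2F/\delta v\,\delta v$ is the locally integrable kernel on pairs of points that represents the derivative of $b\mapsto\int\frac{\delta F}{\delta v(x')}\big|_{v+b\psi}\varphi(x')dx'$ at $b=0$, for all such $\varphi,\psi$.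 **Proposition (Polchinski equation).** For all $x,\xi\in\mathbb R$ and $t\ge0$ the averages and expectations above are absolutely convergent. In the steady case, for every $l\in[0,-\log\delta]$ and every continuous $v_<$, $C_l$ is differentiable in $l$, the second functional derivative of $\bar T_l$ exists, the integral below converges absolutely, and $$\frac{\partial\bar T_l(x,\xi,t;v_<)}{\partial l}=\iint\frac{\partial C_l}{\partial l}(x'-y')\,\frac{\delta^2\bar T_l(x,\xi,t;v_<)}{\delta v_<(x')\,\delta v_<(y')}\,dx'dy'$$ (one-sided derivatives of $\bar T_l$ at the end points of $[0,-\log\delta]$). The initial condition at $l=0$ is $\bar T_0(x,\xi,t;v)=\hat T(x,\xi,t;v)$ for every continuous $v$. In the unsteady case the same holds with $$\frac{\partial\bar T_l(x,\xi,t;v_<)}{\partial l}=\iiiint\frac{\partial C_l}{\partial l}(x'-y',t'-r')\,\frac{\delta^2\bar T_l(x,\xi,t;v_<)}{\delta v_<(x',t')\,\delta v_<(y',r')}\,dx'dy'dt'dr'.$$ Moreover, in both cases and for every continuous $v$, $\hat T$ is the Feynman–Kac representation of the passive scalar: every bounded solution $u$ of $\partial_tu+iv\xi u=-\frac12\nu_0\xi^2u+\frac12\nu_0\partial_x^2u$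 on $\mathbb R\times[0,\infty)$ with $u|_{t=0}=\theta(\cdot,\xi)$, continuous up to $t=0$ and with $\partial_t u,\partial_xu,\partial_x^2u$ continuous for $t>0$, satisfies $u(x,t)=\hat T(x,\xi,t;v)$. -/

import Mathlib

open MeasureTheory ProbabilityTheory Set
open scoped NNReal

noncomputable section

namespace ShearFlow

/-! ## The Gaussian velocity field and its spectrum -/

/-- `X` is a centered real Gaussian random field on `E` with almost surely continuous samples
and stationary covariance `⟨X x, X y⟩ = R (x - y)`. The covariance function `R` is complex valued
because it is computed from the spectrum; the equation forces its values to be real. -/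
structure IsGaussianField {E Ω : Type*} [AddCommGroup E] [TopologicalSpace E]
    [MeasurableSpace Ω] (P : Measure Ω) (X : E → Ω → ℝ) (R : E → ℂ) : Prop where
  gaussian : IsGaussianProcess X P
  mean_zero : ∀ x, ∫ ω, X x ω ∂P = 0
  covariance_eq : ∀ x y, ((cov[X x, X y; P] : ℝ) : ℂ) = R (x - y)
  continuous_samples : ∀ᵐ ω ∂P, Continuous (fun x ↦ X x ω)

/-- Spectrum `√(2π) 1_{e^{-l} < |k| ≤ 1} |k|^{1-ε}` of the steady high modes. -/
def steadyHighSpectrum (ε l k : ℝ) : ℝ :=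
  √(2 * Real.pi) *
    indicator {q : ℝ | Real.exp (-l) < |q| ∧ |q| ≤ 1} (fun q ↦ |q| ^ (1 - ε)) k

/-- Spectrum `√(2π) 1_{e^{-l} ≤ |k| ≤ 1} |k|^{1-ε} |k|^ζ / (|k|^{2ζ} + ω²)` of the unsteady
high modes; `ζ` is the exponent of temporal decorrelation. -/
def unsteadyHighSpectrum (ε ζ l k ω : ℝ) : ℝ :=
  √(2 * Real.pi) *
    indicator {q : ℝ | Real.exp (-l) ≤ |q| ∧ |q| ≤ 1}
      (fun q ↦ |q| ^ (1 - ε) * (|q| ^ ζ / (|q| ^ (2 * ζ) + ω ^ 2))) k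

/-- Covariance function of the stationary field with spectrum `S`: inverse Fourier transform in
the normalization with prefactor `1/√(2π)`. -/
def covarianceOfSpectrum (S : ℝ → ℝ) (z : ℝ) : ℂ :=
  ((√(2 * Real.pi))⁻¹ : ℝ) * ∫ k : ℝ, Complex.exp (Complex.I * z * k) * S k

/-- Space-time covariance function of the stationary field with spectrum `S k ω`, with the same
prefactor. -/
def covarianceOfSpectrum₂ (S : ℝ → ℝ → ℝ) (p : ℝ × ℝ) : ℂ :=
  ((√(2 * Real.pi))⁻¹ : ℝ) *
    ∫ ω : ℝ, ∫ k : ℝ, Complex.exp (Complex.I * p.1 * k + Complex.I * p.2 * ω) * S k ω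

/-- `C_l(z) = ∫_{e^{-l}}^1 e^{izk} |k|^{1-ε} dk`. -/
def steadyC (ε l z : ℝ) : ℂ :=
  ∫ k in (Real.exp (-l))..1, Complex.exp (Complex.I * z * k) * ((|k| ^ (1 - ε) : ℝ) : ℂ)

/-- `C_l(z, τ) = ∫_ℝ ∫_{e^{-l}}^1 e^{izk+iτω} |k|^{1-ε} |k|^ζ / (|k|^{2ζ} + ω²) dk dω`, where
`p = (z, τ)`. -/
def unsteadyC (ε ζ l : ℝ) (p : ℝ × ℝ) : ℂ :=
  ∫ ω : ℝ, ∫ k in (Real.exp (-l))..1,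
    Complex.exp (Complex.I * p.1 * k + Complex.I * p.2 * ω) *
      ((|k| ^ (1 - ε) * (|k| ^ ζ / (|k| ^ (2 * ζ) + ω ^ 2)) : ℝ) : ℂ)

/-! ## The passive scalar -/

/-- The Feynman--Kac weight along the Brownian path `b`, steady velocity field `v`. -/
def steadyWeight (ν : ℝ) (θ : ℝ → ℝ → ℂ) (x ξ t : ℝ) (v : ℝ → ℝ) (b : ℝ≥0 → ℝ) : ℂ :=
  Complex.exp (-(ν / 2) * ξ ^ 2 * t) *
    Complex.exp (-Complex.I * ξ * (∫ s in (0 : ℝ)..t, v (x + √ν * b s.toNNReal) : ℝ)) *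
    θ (x + √ν * b t.toNNReal) ξ

/-- The Feynman--Kac weight along the Brownian path `b`, unsteady velocity field `v`
(a function of the pair (space, time)). -/
def unsteadyWeight (ν : ℝ) (θ : ℝ → ℝ → ℂ) (x ξ t : ℝ) (v : ℝ × ℝ → ℝ) (b : ℝ≥0 → ℝ) : ℂ :=
  Complex.exp (-(ν / 2) * ξ ^ 2 * t) *
    Complex.exp (-Complex.I * ξ * (∫ s in (0 : ℝ)..t, v (x + √ν * b s.toNNReal, t - s) : ℝ)) *
    θ (x + √ν * b t.toNNReal) ξ

/-- `T̂(x, ξ, t)` as a functional of the steady velocity field `v`, in its Feynman--Kac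
representation; `θ` is the initial datum `T̂|_{t=0}`, `ν` the bare diffusivity. -/
def steadyT {Ω' : Type*} [MeasurableSpace Ω'] (P' : Measure Ω') (B : ℝ≥0 → Ω' → ℝ)
    (ν : ℝ) (θ : ℝ → ℝ → ℂ) (x ξ t : ℝ) (v : ℝ → ℝ) : ℂ :=
  ∫ ω, steadyWeight ν θ x ξ t v (fun s ↦ B s ω) ∂P'

/-- `T̂(x, ξ, t)` as a functional of the unsteady velocity field `v`. -/
def unsteadyT {Ω' : Type*} [MeasurableSpace Ω'] (P' : Measure Ω') (B : ℝ≥0 → Ω' → ℝ)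
    (ν : ℝ) (θ : ℝ → ℝ → ℂ) (x ξ t : ℝ) (v : ℝ × ℝ → ℝ) : ℂ :=
  ∫ ω, unsteadyWeight ν θ x ξ t v (fun s ↦ B s ω) ∂P'

/-- `u(x, t)` is a bounded classical solution, on `ℝ × [0, ∞)`, of the equation of the passive
scalar after Fourier transform in the direction of the shear,
`∂_t u + i v(x, t) ξ u = -½ ν ξ² u + ½ ν ∂_x² u`, with initial datum `u(x, 0) = g(x)`. -/
structure IsBoundedClassicalSolution (ν ξ : ℝ) (v : ℝ → ℝ → ℝ) (g : ℝ → ℂ)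
    (u : ℝ → ℝ → ℂ) : Prop where
  bounded : ∃ M : ℝ, ∀ x t, 0 ≤ t → ‖u x t‖ ≤ M
  continuous : ContinuousOn (fun p : ℝ × ℝ ↦ u p.1 p.2) {p | 0 ≤ p.2}
  initial : ∀ x, u x 0 = g x
  equation : ∃ ut ux uxx : ℝ → ℝ → ℂ,
    ContinuousOn (fun p : ℝ × ℝ ↦ ut p.1 p.2) {p | 0 < p.2} ∧
    ContinuousOn (fun p : ℝ × ℝ ↦ ux p.1 p.2) {p | 0 < p.2} ∧
    ContinuousOn (fun p : ℝ × ℝ ↦ uxx p.1 p.2) {p | 0 < p.2} ∧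
    ∀ x t, 0 < t →
      HasDerivAt (fun t' ↦ u x t') (ut x t) t ∧
      HasDerivAt (fun x' ↦ u x' t) (ux x t) x ∧
      HasDerivAt (fun x' ↦ ux x' t) (uxx x t) x ∧
      ut x t + Complex.I * v x t * ξ * u x t
        = -(1 / 2) * ν * ξ ^ 2 * u x t + (1 / 2) * ν * uxx x t

/-- The average of the functional `F` over the high modes `X`, with the low modes `w` fixed. -/
def partialAverage {E Ω : Type*} [MeasurableSpace Ω] (P : Measure Ω) (F : (E → ℝ) → ℂ)
    (X : E → Ω → ℝ) (w : E → ℝ) : ℂ :=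
  ∫ ω, F (fun p ↦ w p + X p ω) ∂P

/-! ## Functional derivatives and the equation -/

section FunctionalDerivative

variable {E : Type*} [NormedAddCommGroup E] [NormedSpace ℝ E] [MeasureSpace E]

/-- Smooth compactly supported directions of variation. -/
def IsTestFunction (φ : E → ℝ) : Prop := ContDiff ℝ (⊤ : ℕ∞) φ ∧ HasCompactSupport φ

/-- `k = δF/δv` at `v = w`. -/
def HasFunctionalDeriv (F : (E → ℝ) → ℂ) (w : E → ℝ) (k : E → ℂ) : Prop :=
  LocallyIntegrable k ∧
    ∀ φ : E → ℝ, IsTestFunction φ →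
      HasDerivAt (fun a : ℝ ↦ F (w + a • φ)) (∫ x', k x' * φ x') 0

/-- `K = δ²F/δv(x')δv(y')` at `v = w`: the functional derivative of the functional derivative.
The kernel `K` is determined almost everywhere. -/
def HasFunctionalDeriv₂ (F : (E → ℝ) → ℂ) (w : E → ℝ) (K : E × E → ℂ) : Prop :=
  LocallyIntegrable K ∧
    ∃ D : (E → ℝ) → E → ℂ,
      (∀ w' : E → ℝ, Continuous w' → HasFunctionalDeriv F w' (D w')) ∧
      ∀ φ ψ : E → ℝ, IsTestFunction φ → IsTestFunction ψ →
        HasDerivAt (fun b : ℝ ↦ ∫ x', D (w + b • ψ) x' * φ x')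
          (∫ p : E × E, K p * φ p.1 * ψ p.2) 0

/-- The functionals `Tbar l` satisfy, for `l ∈ [0, L]` and at every continuous field `w`,
`∂_l Tbar = ∫∫ ∂_l C_l(x' - y') δ²Tbar/δv(x')δv(y') dx' dy'`
(with one-sided derivatives in `l` at the two ends). -/
def SatisfiesPolchinski (C : ℝ → E → ℂ) (L : ℝ) (Tbar : ℝ → (E → ℝ) → ℂ) : Prop :=
  ∀ l ∈ Icc 0 L,
    (∀ z : E, DifferentiableAt ℝ (fun l' ↦ C l' z) l) ∧
    ∀ w : E → ℝ, Continuous w →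
      ∃ K : E × E → ℂ, HasFunctionalDeriv₂ (Tbar l) w K ∧
        Integrable (fun p : E × E ↦ deriv (fun l' ↦ C l' (p.1 - p.2)) l * K p) ∧
        HasDerivWithinAt (fun l' ↦ Tbar l' w)
          (∫ p : E × E, deriv (fun l' ↦ C l' (p.1 - p.2)) l * K p) (Icc 0 L) l

end FunctionalDerivative

end ShearFlow

end

set_option linter.unusedSectionVars false

namespace ShearFlow

open Filter Topology

/-! Write the scalar as `phaseMean`: the expectation of `exp(-iξ ∫ v(γ_s) ds)` times a bounded
weight `g`, where `γ` is the Brownian path (steady case) or the space-time path `(x + √ν B_s, t -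
s)` (unsteady case). The field enters only through a linear functional in the phase. For a frozen
path, averaging over a centered Gaussian field multiplies the phase by `exp(-ξ²/2 ∬ R(γ_s - γ_r))`.
Since `R(z) = C_l(z) + C_l(-z)`, symmetry in `s, r` turns this into `exp(-ξ² ∬ C_l(γ_s - γ_r))`
(`average_phaseMean`). Hence `∂_l` brings down `-ξ² ∬ ∂_l C_l(γ_s - γ_r)`.

Two functional derivatives in the directions `φ, ψ` bring down `(-iξ)² ∬ φ(γ_s) ψ(γ_r)`, so
`δ²/δvδv` is the weighted law of `(γ_s, γ_r)` under probability times `ds dr`. For Brownian motion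
this law is absolutely continuous, because the pair of positions is nondegenerate off the null set
`s = r`. Its Radon-Nikodym density is an integrable kernel (`exists_density`,
`exists_kernel₂_phaseMean`), which may be tested against any bounded measurable function. Testing it
against `∂_l C_l(x' - y')` gives exactly the `l`-derivative (`satisfiesPolchinski_of_curve`). The
substitution `k = e^{-s}` shows that both covariances are integrals over `(0, l)` of a bounded
continuous rate.

The Feynman-Kac formula is obtained without stochastic calculus. A Taylor expansion and the equation
show that one short step of heat flow times the exponential weight reproduces the solution up to
`o(h)`, locally uniformly (`norm_productFormula_step_le`). The Markov property telescopes these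
errors along a grid, paths being killed outside `[-n, n]` because the estimate is only local
(`norm_gridProduct_expectation_sub_le`). As `n → ∞` the killing disappears and the product of
weights becomes the exponential of a time integral. -/

/-- A process with almost surely continuous paths agrees almost surely with a jointly continuous
and measurable one. -/
lemma exists_continuous_modification {T Ω : Type*} [TopologicalSpace T] [Nonempty T]
    [TopologicalSpace.SeparableSpace T] [FrechetUrysohnSpace T] [MeasurableSpace Ω]
    {P : Measure Ω} {X : T → Ω → ℝ} (hm : ∀ p, AEMeasurable (X p) P)
    (hc : ∀ᵐ ω ∂P, Continuous (fun p ↦ X p ω)) :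
    ∃ Y : T → Ω → ℝ, (∀ ω, Continuous (fun p ↦ Y p ω)) ∧ (∀ p, Measurable (Y p)) ∧
      ∀ᵐ ω ∂P, ∀ p, X p ω = Y p ω := by
  -- A continuous path is determined by its values on a countable dense set, where one null set
  -- suffices to replace the process by measurable versions.
  let d := TopologicalSpace.denseSeq T
  have hd : ∀ᵐ ω ∂P, Continuous (fun p ↦ X p ω) ∧ ∀ n, X (d n) ω = (hm (d n)).mk _ ω :=
    hc.and (ae_all_iff.2 fun n ↦ (hm (d n)).ae_eq_mk)
  obtain ⟨G, hGm, hGs, hG⟩ := hd.exists_measurable_mem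
  refine ⟨fun p ↦ G.indicator (X p), fun ω ↦ ?_, fun p ↦ ?_, ?_⟩
  · by_cases h : ω ∈ G
    · simpa [h] using (hG ω h).1
    · simp [h, continuous_const]
  -- On `G` the value at `p` is a limit of the measurable versions along dense points tending to
  -- `p`; off `G` everything is zero.
  · have hp : p ∈ closure (range d) := (TopologicalSpace.denseRange_denseSeq T) p
    obtain ⟨q, hq, hqp⟩ := mem_closure_iff_seq_limit.1 hp
    choose n hn using hq
    refine measurable_of_tendsto_metrizable (f := fun k ↦ G.indicator ((hm (d (n k))).mk _))
      (fun k ↦ ((hm (d (n k))).measurable_mk).indicator hGs) ?_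
    rw [tendsto_pi_nhds]
    intro ω
    by_cases h : ω ∈ G
    · simp only [h, indicator_of_mem]
      have h1 := ((hG ω h).1.tendsto p).comp hqp
      refine h1.congr fun k ↦ ?_
      simp only [Function.comp]
      rw [← hn k, (hG ω h).2]
    · simp [h]
  · filter_upwards [hGm] with ω hω p
    simp [hω]

/-! ### Densities of image measures -/

/-- The image of a finite measure with bounded density, under a map whose law is absolutely
continuous, has an integrable density: nonnegative real case. -/
lemma exists_density_of_nonneg {S F : Type*} [MeasurableSpace S] [MeasurableSpace F]
    {m : Measure S} [IsFiniteMeasure m] {μ : Measure F} [SigmaFinite μ] {Φ : S → F}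
    (hΦ : Measurable Φ) (hac : m.map Φ ≪ μ) {G : S → ℝ≥0} (hG : Measurable G) {M : ℝ≥0}
    (hGM : ∀ s, G s ≤ M) :
    ∃ K : F → ℝ, Integrable K μ ∧ ∀ f : F → ℂ, Measurable f →
      ∫ y, f y * K y ∂μ = ∫ s, f (Φ s) * ((G s : ℝ) : ℂ) ∂m := by
  -- The weight `G` is absorbed into the measure, so that the wanted density is the Radon-Nikodym
  -- derivative of the image of `m'`.
  set m' : Measure S := m.withDensity (fun s ↦ (G s : ENNReal)) with hm'
  have hfin : IsFiniteMeasure m' := by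
    refine isFiniteMeasure_withDensity ?_
    refine ((lintegral_mono (g := fun _ ↦ (M : ENNReal)) fun s ↦ by
      dsimp only; exact_mod_cast hGM s).trans_lt
      ?_).ne
    rw [lintegral_const]
    exact ENNReal.mul_lt_top ENNReal.coe_lt_top (measure_lt_top _ _)
  have hac' : m'.map Φ ≪ μ :=
    ((withDensity_absolutelyContinuous m _).map hΦ).trans hac
  refine ⟨fun y ↦ ((m'.map Φ).rnDeriv μ y).toReal, Measure.integrable_toReal_rnDeriv,
    fun f hf ↦ ?_⟩
  have h1 := integral_rnDeriv_smul (f := f) hac'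
  rw [integral_map hΦ.aemeasurable hf.aestronglyMeasurable, hm',
    integral_withDensity_eq_integral_smul hG] at h1
  convert h1 using 3 with y y
  · rw [Complex.real_smul, mul_comm]
  · rw [mul_comm]; rfl

/-- The image of a finite measure with bounded complex density, under a map whose law is absolutely
continuous, has an integrable density. -/
lemma exists_density {S F : Type*} [MeasurableSpace S] [MeasurableSpace F]
    {m : Measure S} [IsFiniteMeasure m] {μ : Measure F} [SigmaFinite μ] {Φ : S → F}
    (hΦ : Measurable Φ) (hac : m.map Φ ≪ μ) {G : S → ℂ} (hG : Measurable G) {M : ℝ}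
    (hGM : ∀ s, ‖G s‖ ≤ M) :
    ∃ K : F → ℂ, Integrable K μ ∧ ∀ f : F → ℂ, Measurable f → (∃ c, ∀ y, ‖f y‖ ≤ c) →
      ∫ y, f y * K y ∂μ = ∫ s, f (Φ s) * G s ∂m := by
  have hre : Measurable fun s ↦ (G s).re := Complex.measurable_re.comp hG
  have him : Measurable fun s ↦ (G s).im := Complex.measurable_im.comp hG
  have hb (g : S → ℝ) (hg : ∀ s, |g s| ≤ ‖G s‖) (s : S) : (g s).toNNReal ≤ M.toNNReal :=
    Real.toNNReal_le_toNNReal ((le_abs_self _).trans ((hg s).trans (hGM s)))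
  -- The positive and negative parts of the real and imaginary parts of `G` are treated separately
  -- and recombined linearly.
  obtain ⟨K₁, hK₁, h₁⟩ := exists_density_of_nonneg hΦ hac hre.real_toNNReal
    (hb (fun s ↦ (G s).re) fun s ↦ Complex.abs_re_le_norm _)
  obtain ⟨K₂, hK₂, h₂⟩ := exists_density_of_nonneg hΦ hac hre.neg.real_toNNReal
    (hb (fun s ↦ -(G s).re) fun s ↦ by rw [abs_neg]; exact Complex.abs_re_le_norm _)
  obtain ⟨K₃, hK₃, h₃⟩ := exists_density_of_nonneg hΦ hac him.real_toNNReal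
    (hb (fun s ↦ (G s).im) fun s ↦ Complex.abs_im_le_norm _)
  obtain ⟨K₄, hK₄, h₄⟩ := exists_density_of_nonneg hΦ hac him.neg.real_toNNReal
    (hb (fun s ↦ -(G s).im) fun s ↦ by rw [abs_neg]; exact Complex.abs_im_le_norm _)
  refine ⟨fun y ↦ ((K₁ y : ℂ) - K₂ y) + Complex.I * ((K₃ y : ℂ) - K₄ y),
    (hK₁.ofReal.sub hK₂.ofReal).add ((hK₃.ofReal.sub hK₄.ofReal).const_mul _), ?_⟩
  rintro f hf ⟨c, hc⟩
  have hi (K : F → ℝ) (hK : Integrable K μ) : Integrable (fun y ↦ f y * (K y : ℂ)) μ :=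
    hK.ofReal.bdd_mul hf.aestronglyMeasurable (Eventually.of_forall hc)
  have hj (g : S → ℝ) (hgm : Measurable g) (hg : ∀ s, |g s| ≤ ‖G s‖) :
      Integrable (fun s ↦ f (Φ s) * (((g s).toNNReal : ℝ) : ℂ)) m := by
    refine Integrable.of_bound (C := c * M)
      ((hf.comp hΦ).mul (Complex.measurable_ofReal.comp
        hgm.real_toNNReal.coe_nnreal_real)).aestronglyMeasurable (Eventually.of_forall fun s ↦ ?_)
    rw [norm_mul]
    refine mul_le_mul (hc _) ?_ (norm_nonneg _) ((norm_nonneg _).trans (hc (Φ s)))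
    rw [Complex.norm_real, Real.norm_eq_abs, NNReal.abs_eq, Real.coe_toNNReal']
    exact max_le ((le_abs_self _).trans ((hg s).trans (hGM s))) ((norm_nonneg _).trans (hGM s))
  have e1 : ∀ y, f y * (((K₁ y : ℂ) - K₂ y) + Complex.I * ((K₃ y : ℂ) - K₄ y)) =
      (f y * K₁ y - f y * K₂ y) + Complex.I * (f y * K₃ y - f y * K₄ y) := fun y ↦ by ring
  have e2 : ∀ s, f (Φ s) * G s =
      (f (Φ s) * ((((G s).re).toNNReal : ℝ) : ℂ) - f (Φ s) * (((-(G s).re).toNNReal : ℝ) : ℂ)) +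
      Complex.I * (f (Φ s) * ((((G s).im).toNNReal : ℝ) : ℂ)
        - f (Φ s) * (((-(G s).im).toNNReal : ℝ) : ℂ)) := fun s ↦ by
    have hx (a : ℝ) : ((a.toNNReal : ℝ) : ℂ) - (((-a).toNNReal : ℝ) : ℂ) = a := by
      rw [← Complex.ofReal_sub, Real.coe_toNNReal', Real.coe_toNNReal', max_zero_sub_eq_self]
    rw [← mul_sub, ← mul_sub, hx, hx]
    conv_lhs => rw [← Complex.re_add_im (G s)]
    ring
  have j₁ := hj (fun s ↦ (G s).re) hre fun s ↦ Complex.abs_re_le_norm _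
  have j₂ := hj (fun s ↦ -(G s).re) hre.neg fun s ↦ by
    rw [abs_neg]; exact Complex.abs_re_le_norm _
  have j₃ := hj (fun s ↦ (G s).im) him fun s ↦ Complex.abs_im_le_norm _
  have j₄ := hj (fun s ↦ -(G s).im) him.neg fun s ↦ by
    rw [abs_neg]; exact Complex.abs_im_le_norm _
  have a₁ : Integrable (fun y ↦ f y * (K₁ y : ℂ) - f y * K₂ y) μ := (hi _ hK₁).sub (hi _ hK₂)
  have a₂ : Integrable (fun y ↦ Complex.I * (f y * (K₃ y : ℂ) - f y * K₄ y)) μ :=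
    ((hi _ hK₃).sub (hi _ hK₄)).const_mul _
  have b₁ : Integrable (fun s ↦ f (Φ s) * ((((G s).re).toNNReal : ℝ) : ℂ)
      - f (Φ s) * (((-(G s).re).toNNReal : ℝ) : ℂ)) m := j₁.sub j₂
  have b₂ : Integrable (fun s ↦ Complex.I * (f (Φ s) * ((((G s).im).toNNReal : ℝ) : ℂ)
      - f (Φ s) * (((-(G s).im).toNNReal : ℝ) : ℂ))) m := (j₃.sub j₄).const_mul _
  simp_rw [e1, e2]
  rw [integral_add a₁ a₂, integral_sub (hi _ hK₁) (hi _ hK₂), integral_const_mul,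
    integral_sub (hi _ hK₃) (hi _ hK₄), integral_add b₁ b₂, integral_sub j₁ j₂, integral_const_mul,
    integral_sub j₃ j₄, h₁ f hf, h₂ f hf, h₃ f hf, h₄ f hf]
  simp

/-! ### Riemann sums of continuous functions -/

section Riemann

variable {V : Type*} [NormedAddCommGroup V] [NormedSpace ℝ V] [CompleteSpace V]

/-- Error bound for left Riemann sums in terms of the modulus of continuity. -/
lemma norm_riemannSum_sub_integral_le {f : ℝ → V} {T c : ℝ} (hT : 0 ≤ T) (hf : Continuous f)
    {N : ℕ} (hN : 0 < N)
    (hc : ∀ s ∈ Icc 0 T, ∀ s' ∈ Icc 0 T, |s - s'| ≤ T / N → ‖f s - f s'‖ ≤ c) :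
    ‖(∑ i ∈ Finset.range N, (T / N) • f (i * (T / N))) - ∫ s in (0 : ℝ)..T, f s‖ ≤ c * T := by
  have hN' : (0 : ℝ) < N := by exact_mod_cast hN
  have hh : 0 ≤ T / N := by positivity
  have hNh : (N : ℝ) * (T / N) = T := by field_simp
  have h1 := intervalIntegral.sum_integral_adjacent_intervals (μ := volume) (f := f)
    (a := fun i : ℕ ↦ i * (T / N)) (n := N) fun k _ ↦ hf.intervalIntegrable _ _
  simp only [Nat.cast_zero, zero_mul, hNh] at h1
  rw [← h1, ← Finset.sum_sub_distrib]
  have h2 : ∀ i ∈ Finset.range N, ‖(T / N) • f (i * (T / N)) -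
      ∫ s in (i * (T / N) : ℝ)..((i + 1 : ℕ) * (T / N)), f s‖ ≤ c * (T / N) := by
    intro i hi
    have hle : (i : ℝ) * (T / N) ≤ ((i + 1 : ℕ) : ℝ) * (T / N) := by
      push_cast; nlinarith
    have hle2 : ((i + 1 : ℕ) : ℝ) * (T / N) ≤ T := by
      conv_rhs => rw [← hNh]
      exact mul_le_mul_of_nonneg_right (by exact_mod_cast Finset.mem_range.1 hi) hh
    have hd : ((i + 1 : ℕ) : ℝ) * (T / N) - i * (T / N) = T / N := by push_cast; ring
    have e : (T / N) • f (i * (T / N)) =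
        ∫ s in (i * (T / N) : ℝ)..((i + 1 : ℕ) * (T / N)), f (i * (T / N)) := by
      rw [intervalIntegral.integral_const, hd]
    rw [e, ← intervalIntegral.integral_sub (by simp) (hf.intervalIntegrable _ _)]
    refine (intervalIntegral.norm_integral_le_of_norm_le_const (C := c) fun s hs ↦ ?_).trans ?_
    · rw [uIoc_of_le hle] at hs
      have h0 : 0 ≤ (i : ℝ) * (T / N) := by positivity
      refine hc _ ⟨h0, hle.trans hle2⟩ _ ⟨h0.trans hs.1.le, hs.2.trans hle2⟩ ?_
      rw [abs_sub_comm, abs_of_nonneg (by linarith [hs.1])]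
      linarith [hs.2]
    · rw [hd, abs_of_nonneg hh]
  refine (norm_sum_le_of_le _ h2).trans ?_
  rw [Finset.sum_const, Finset.card_range, nsmul_eq_mul]
  exact le_of_eq (by rw [mul_left_comm, hNh])

lemma tendsto_riemannSum {f : ℝ → V} {T : ℝ} (hT : 0 ≤ T) (hf : Continuous f) :
    Tendsto (fun N : ℕ ↦ ∑ i ∈ Finset.range N, (T / N) • f (i * (T / N))) atTop
      (𝓝 (∫ s in (0 : ℝ)..T, f s)) := by
  rw [Metric.tendsto_atTop]
  intro ε hε
  have hu := isCompact_Icc.uniformContinuousOn_of_continuous (hf.continuousOn (s := Icc 0 T))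
  have hε' : 0 < ε / (T + 1) := by positivity
  obtain ⟨η, hη, h⟩ := Metric.uniformContinuousOn_iff_le.1 hu _ hε'
  obtain ⟨N₀, hN₀⟩ := exists_nat_gt (T / η)
  refine ⟨N₀ + 1, fun N hN ↦ ?_⟩
  have hNp : 0 < N := by omega
  have hN' : (0 : ℝ) < N := by exact_mod_cast hNp
  have hTN : T / N ≤ η := by
    rw [div_le_comm₀ hN' hη]
    exact hN₀.le.trans (by exact_mod_cast (by omega : N₀ ≤ N))
  rw [dist_eq_norm]
  refine (norm_riemannSum_sub_integral_le (c := ε / (T + 1)) hT hf hNp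
    fun s hs s' hs' hss ↦ ?_).trans_lt ?_
  · rw [← dist_eq_norm]
    exact h s hs s' hs' (by rw [Real.dist_eq]; exact hss.trans hTN)
  · rw [div_mul_eq_mul_div, div_lt_iff₀ (by positivity)]
    nlinarith

lemma tendsto_riemannSum₂ {f : ℝ → ℝ → V} {T : ℝ} (hT : 0 ≤ T)
    (hf : Continuous (Function.uncurry f)) :
    Tendsto (fun N : ℕ ↦ ∑ i ∈ Finset.range N, ∑ j ∈ Finset.range N,
        (T / N) • (T / N) • f (i * (T / N)) (j * (T / N))) atTop
      (𝓝 (∫ s in (0 : ℝ)..T, ∫ r in (0 : ℝ)..T, f s r)) := by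
  rw [Metric.tendsto_atTop]
  intro ε hε
  have hu := (isCompact_Icc.prod isCompact_Icc).uniformContinuousOn_of_continuous
    (hf.continuousOn (s := Icc 0 T ×ˢ Icc 0 T))
  -- Discretizing the outer and the inner integral costs at most `c * T ^ 2` each, and `2 * c * T ^
  -- 2 < ε`.
  set c := ε / (2 * (T + 1) * (T + 1)) with hc
  have hc0 : 0 < c := by positivity
  obtain ⟨η, hη, h⟩ := Metric.uniformContinuousOn_iff_le.1 hu c hc0
  obtain ⟨N₀, hN₀⟩ := exists_nat_gt (T / η)
  refine ⟨N₀ + 1, fun N hN ↦ ?_⟩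
  have hNp : 0 < N := by omega
  have hN' : (0 : ℝ) < N := by exact_mod_cast hNp
  have hTN : T / N ≤ η := by
    rw [div_le_comm₀ hN' hη]
    exact hN₀.le.trans (by exact_mod_cast (by omega : N₀ ≤ N))
  have hNh : (N : ℝ) * (T / N) = T := by field_simp
  have hh : 0 ≤ T / N := by positivity
  have hg : Continuous fun s ↦ ∫ r in (0 : ℝ)..T, f s r :=
    intervalIntegral.continuous_parametric_intervalIntegral_of_continuous' hf _ _
  have h1 := norm_riemannSum_sub_integral_le (c := c * T) hT hg hNp fun s hs s' hs' hss ↦ by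
    rw [← intervalIntegral.integral_sub ((by fun_prop : Continuous (f s)).intervalIntegrable _ _)
      ((by fun_prop : Continuous (f s')).intervalIntegrable _ _)]
    refine (intervalIntegral.norm_integral_le_of_norm_le_const (C := c) fun r hr ↦ ?_).trans
      (by rw [sub_zero, abs_of_nonneg hT])
    rw [uIoc_of_le hT] at hr
    rw [← dist_eq_norm]
    refine h (s, r) ⟨hs, hr.1.le, hr.2⟩ (s', r) ⟨hs', hr.1.le, hr.2⟩ ?_
    rw [Prod.dist_eq]
    simpa [Real.dist_eq, hη.le] using hss.trans hTN
  have h2 : ‖(∑ i ∈ Finset.range N, ∑ j ∈ Finset.range N,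
        (T / N) • (T / N) • f (i * (T / N)) (j * (T / N))) -
      ∑ i ∈ Finset.range N, (T / N) • ∫ r in (0 : ℝ)..T, f (i * (T / N)) r‖ ≤ T * (c * T) := by
    rw [← Finset.sum_sub_distrib]
    have h3 : ∀ i ∈ Finset.range N, ‖(∑ j ∈ Finset.range N,
        (T / N) • (T / N) • f (i * (T / N)) (j * (T / N))) -
        (T / N) • ∫ r in (0 : ℝ)..T, f (i * (T / N)) r‖ ≤ (T / N) * (c * T) := by
      intro i hi
      rw [← Finset.smul_sum, ← smul_sub, norm_smul, Real.norm_of_nonneg hh]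
      refine mul_le_mul_of_nonneg_left ?_ hh
      have hle : (i : ℝ) * (T / N) ≤ T := by
        conv_rhs => rw [← hNh]
        exact mul_le_mul_of_nonneg_right (by exact_mod_cast (Finset.mem_range.1 hi).le) hh
      refine norm_riemannSum_sub_integral_le (f := f (i * (T / N))) hT (by fun_prop) hNp
        fun s hs s' hs' hss ↦ ?_
      rw [← dist_eq_norm]
      refine h (_, s) ⟨⟨by positivity, hle⟩, hs⟩ (_, s') ⟨⟨by positivity, hle⟩, hs'⟩ ?_
      rw [Prod.dist_eq]
      simpa [Real.dist_eq, hη.le] using hss.trans hTN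
    refine (norm_sum_le_of_le _ h3).trans ?_
    rw [Finset.sum_const, Finset.card_range, nsmul_eq_mul, ← mul_assoc, hNh]
  rw [dist_eq_norm]
  refine (norm_sub_le_norm_sub_add_norm_sub _ _ _).trans_lt ((add_le_add h2 h1).trans_lt ?_)
  have : c * (2 * (T + 1) * (T + 1)) = ε := by rw [hc]; field_simp
  nlinarith

end Riemann

/-! ### Gaussian fields integrated along a curve -/

/-- Characteristic function of the integral of a Gaussian field along a curve. -/
lemma integral_exp_integral_gaussianField {E Ω : Type*} [AddCommGroup E] [TopologicalSpace E]
    [ContinuousSub E] [MeasurableSpace Ω] {P : Measure Ω} {X : E → Ω → ℝ} {R : E → ℂ}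
    (hX : IsGaussianField P X R) (hR : Continuous R) {q : ℝ → E} (hq : Continuous q)
    {t : ℝ} (ht : 0 ≤ t) (ξ : ℝ) :
    ∫ ω, Complex.exp (-Complex.I * ξ * (∫ s in (0 : ℝ)..t, X (q s) ω : ℝ)) ∂P =
      Complex.exp (-(ξ ^ 2 / 2) * ∫ s in (0 : ℝ)..t, ∫ r in (0 : ℝ)..t, R (q s - q r)) := by
  have hP := hX.gaussian.isProbabilityMeasure
  set p : ℕ → ℕ → E := fun N i ↦ q (i * (t / N)) with hp
  -- The Riemann sums are finite linear combinations of a Gaussian process, hence Gaussian with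
  -- explicit variance. Their characteristic functions pass to the limit because the phases have
  -- modulus one.
  set S : ℕ → Ω → ℝ := fun N ω ↦ ∑ i ∈ Finset.range N, (t / N) • X (p N i) ω with hS
  have hSg (N : ℕ) : HasGaussianLaw (S N) P :=
    ((hX.gaussian.comp_right (p N)).smul fun _ ↦ t / N).hasGaussianLaw_fun_sum
  have hmem (z : E) : MemLp (X z) 2 P := (hX.gaussian.hasGaussianLaw_eval z).memLp_two
  have hint (z : E) : Integrable (X z) P := (hX.gaussian.hasGaussianLaw_eval z).integrable
  have hmean (N : ℕ) : ∫ ω, S N ω ∂P = 0 := by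
    simp only [hS]
    have hi (i : ℕ) : Integrable (fun ω ↦ (t / N) • X (p N i) ω) P :=
      (hint (p N i)).smul (t / (N : ℝ))
    rw [integral_finsetSum _ fun i _ ↦ hi i]
    simp [integral_const_mul, hX.mean_zero]
  have hvar (N : ℕ) : ((Var[S N; P] : ℝ) : ℂ) =
      ∑ i ∈ Finset.range N, ∑ j ∈ Finset.range N,
        (t / N) • (t / N) • R (q (i * (t / N)) - q (j * (t / N))) := by
    have : S N = fun ω ↦ ∑ i ∈ Finset.range N, ((t / N) • X (p N i)) ω := by
      ext ω; simp [hS]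
    rw [this, variance_fun_sum' fun i _ ↦ (hmem _).const_smul _]
    push_cast
    refine Finset.sum_congr rfl fun i _ ↦ Finset.sum_congr rfl fun j _ ↦ ?_
    rw [covariance_smul_left, covariance_smul_right]
    push_cast
    rw [hX.covariance_eq]
    simp [hp]
  have hchar (N : ℕ) : ∫ ω, Complex.exp (-Complex.I * ξ * (S N ω : ℝ)) ∂P =
      Complex.exp (-(ξ ^ 2 / 2) * (Var[S N; P] : ℝ)) := by
    have h := (hSg N).charFun_map_eq (-ξ)
    rw [charFun_apply, integral_map (hSg N).aemeasurable
      (by fun_prop)] at h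
    simp only [RCLike.inner_apply, conj_trivial] at h
    rw [integral_mul_const, hmean, variance_mul_const] at h
    convert h using 2
    · ext ω; congr 1; push_cast; ring
    · push_cast; ring
  have hlim : Tendsto (fun N ↦ ∫ ω, Complex.exp (-Complex.I * ξ * (S N ω : ℝ)) ∂P) atTop
      (𝓝 (∫ ω, Complex.exp (-Complex.I * ξ * (∫ s in (0 : ℝ)..t, X (q s) ω : ℝ)) ∂P)) := by
    refine tendsto_integral_of_dominated_convergence (fun _ ↦ 1) (fun N ↦ ?_)
      (integrable_const _) (fun N ↦ Eventually.of_forall fun ω ↦ ?_) ?_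
    · have := (hSg N).aemeasurable
      have h2 : Continuous fun x : ℝ ↦ Complex.exp (-Complex.I * ξ * (x : ℂ)) := by fun_prop
      exact (h2.measurable.comp_aemeasurable this).aestronglyMeasurable
    · rw [Complex.norm_exp]
      simp
    · filter_upwards [hX.continuous_samples] with ω hω
      have h2 : Continuous fun x : ℝ ↦ Complex.exp (-Complex.I * ξ * (x : ℂ)) := by fun_prop
      exact (h2.tendsto _).comp (tendsto_riemannSum ht (hω.comp hq))
  have hlim2 : Tendsto (fun N ↦ Complex.exp (-(ξ ^ 2 / 2) * (Var[S N; P] : ℝ))) atTop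
      (𝓝 (Complex.exp (-(ξ ^ 2 / 2) *
        ∫ s in (0 : ℝ)..t, ∫ r in (0 : ℝ)..t, R (q s - q r)))) := by
    simp_rw [hvar]
    have h2 : Continuous fun x : ℂ ↦ Complex.exp (-(ξ ^ 2 / 2) * x) := by fun_prop
    exact (h2.tendsto _).comp (tendsto_riemannSum₂ (f := fun s r ↦ R (q s - q r)) ht (by fun_prop))
  exact tendsto_nhds_unique hlim (by simpa only [hchar] using hlim2)


/-! ### Functional derivatives of phases along a random curve -/

section Curve

variable {E Ω Ω' : Type*} [NormedAddCommGroup E] [NormedSpace ℝ E] [MeasureSpace E]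
  [BorelSpace E] [SecondCountableTopology E] [MeasurableSpace Ω] [MeasurableSpace Ω']

/-- A random curve with continuous paths. -/
structure IsRandomCurve (γ : ℝ → Ω' → E) : Prop where
  continuous : ∀ ω, Continuous (fun s ↦ γ s ω)
  measurable : ∀ s, Measurable (γ s)

/-- Lebesgue measure on the time interval `(0, t]`. -/
noncomputable def timeMeasure (t : ℝ) : Measure ℝ := volume.restrict (Ioc 0 t)

instance (t : ℝ) : IsFiniteMeasure (timeMeasure t) := by
  unfold timeMeasure; infer_instance

/-- Integral of the field `v` along the curve `γ`. -/
noncomputable def curveIntegral (γ : ℝ → Ω' → E) (t : ℝ) (v : E → ℝ) (ω : Ω') : ℝ :=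
  ∫ s, v (γ s ω) ∂(timeMeasure t)

/-- Expectation of the phase picked up from the field `v` along `γ`, with weight `H`. -/
noncomputable def phaseMean (P' : Measure Ω') (γ : ℝ → Ω' → E) (t ξ : ℝ) (H : Ω' → ℂ)
    (v : E → ℝ) : ℂ :=
  ∫ ω, Complex.exp (-Complex.I * ξ * curveIntegral γ t v ω) * H ω ∂P'

lemma norm_exp_phase (ξ a : ℝ) : ‖Complex.exp (-Complex.I * ξ * a)‖ = 1 := by
  rw [Complex.norm_exp]; simp

variable {γ : ℝ → Ω' → E}

lemma integrable_of_continuous_timeMeasure {F : Type*} [NormedAddCommGroup F] {f : ℝ → F} (t : ℝ)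
    (hf : Continuous f) : Integrable f (timeMeasure t) :=
  (hf.integrableOn_Icc (a := 0) (b := t)).mono_set Ioc_subset_Icc_self

lemma IsRandomCurve.measurable_uncurry (hγ : IsRandomCurve γ) :
    Measurable (fun p : Ω' × ℝ ↦ γ p.2 p.1) :=
  (measurable_uncurry_of_continuous_of_measurable hγ.continuous hγ.measurable).comp measurable_swap

lemma measurable_curveIntegral (hγ : IsRandomCurve γ) (t : ℝ) {v : E → ℝ} (hv : Continuous v) :
    Measurable (curveIntegral γ t v) := by
  have : StronglyMeasurable fun p : Ω' × ℝ ↦ v (γ p.2 p.1) :=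
    (hv.measurable.comp hγ.measurable_uncurry).stronglyMeasurable
  exact this.integral_prod_right'.measurable

lemma curveIntegral_add (hγ : IsRandomCurve γ) (t : ℝ) {v w : E → ℝ} (hv : Continuous v)
    (hw : Continuous w) (ω : Ω') :
    curveIntegral γ t (fun p ↦ v p + w p) ω = curveIntegral γ t v ω + curveIntegral γ t w ω :=
  integral_add (integrable_of_continuous_timeMeasure t (hv.comp (hγ.continuous ω)))
    (integrable_of_continuous_timeMeasure t (hw.comp (hγ.continuous ω)))

lemma curveIntegral_add_smul (hγ : IsRandomCurve γ) (t a : ℝ) {v w : E → ℝ} (hv : Continuous v)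
    (hw : Continuous w) (ω : Ω') :
    curveIntegral γ t (v + a • w) ω = curveIntegral γ t v ω + a * curveIntegral γ t w ω := by
  have h := curveIntegral_add hγ t hv (hw.const_smul a) ω
  rw [show v + a • w = fun p ↦ v p + (a • w) p from rfl, h]
  congr 1
  exact integral_const_mul a _

lemma abs_curveIntegral_le {t c : ℝ} {φ : E → ℝ} (hφ : ∀ y, |φ y| ≤ c) (ω : Ω') :
    |curveIntegral γ t φ ω| ≤ c * (timeMeasure t).real univ := by
  rw [← Real.norm_eq_abs, curveIntegral]
  exact norm_integral_le_of_norm_le_const (Eventually.of_forall fun _ ↦ hφ _)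

lemma measurable_phase (hγ : IsRandomCurve γ) (t ξ : ℝ) {v : E → ℝ} (hv : Continuous v) :
    Measurable fun ω ↦ Complex.exp (-Complex.I * ξ * curveIntegral γ t v ω) := by
  have := measurable_curveIntegral hγ t hv
  fun_prop

/-- The phase has modulus one and the integral of a bounded direction is bounded, so a constant
dominates the derivative. Since `H` is an arbitrary bounded weight, the factor brought down can be
absorbed into it and the lemma used again for the second derivative. -/
lemma hasDerivAt_phaseMean {P' : Measure Ω'} [IsFiniteMeasure P'] (hγ : IsRandomCurve γ)
    (t ξ : ℝ) {H : Ω' → ℂ} (hH : Measurable H) {M c : ℝ} (hHM : ∀ ω, ‖H ω‖ ≤ M) {w φ : E → ℝ}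
    (hw : Continuous w) (hφ : Continuous φ) (hφc : ∀ y, |φ y| ≤ c) :
    HasDerivAt (fun a : ℝ ↦ phaseMean P' γ t ξ H (w + a • φ))
      (phaseMean P' γ t ξ (fun ω ↦ -Complex.I * ξ * curveIntegral γ t φ ω * H ω) w) 0 := by
  have hA := measurable_curveIntegral hγ t hφ
  have key := hasDerivAt_integral_of_dominated_loc_of_deriv_le (μ := P') (x₀ := (0 : ℝ))
    (s := univ) (bound := fun _ ↦ |ξ| * (c * (timeMeasure t).real univ) * M)
    (F := fun a ω ↦ Complex.exp (-Complex.I * ξ * curveIntegral γ t (w + a • φ) ω) * H ω)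
    (F' := fun a ω ↦ Complex.exp (-Complex.I * ξ * curveIntegral γ t (w + a • φ) ω) *
      (-Complex.I * ξ * curveIntegral γ t φ ω * H ω))
    univ_mem ?_ ?_ ?_ ?_ (integrable_const _) ?_
  · have h := key.2
    simp only [zero_smul, add_zero] at h
    exact h
  · exact Eventually.of_forall fun a ↦
      ((measurable_phase hγ t ξ (hw.add (hφ.const_smul a))).mul hH).aestronglyMeasurable
  · refine Integrable.of_bound (C := M)
      ((measurable_phase hγ t ξ (hw.add (hφ.const_smul 0))).mul hH).aestronglyMeasurable
      (Eventually.of_forall fun ω ↦ ?_)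
    rw [norm_mul, norm_exp_phase, one_mul]
    exact hHM ω
  · have := measurable_phase hγ t ξ (hw.add (hφ.const_smul (0 : ℝ)))
    exact (this.mul (by fun_prop)).aestronglyMeasurable
  · refine Eventually.of_forall fun ω a _ ↦ ?_
    rw [norm_mul, norm_exp_phase, one_mul, norm_mul, norm_mul, norm_mul, norm_neg, Complex.norm_I,
      one_mul, Complex.norm_real, Complex.norm_real, Real.norm_eq_abs, Real.norm_eq_abs]
    have := abs_curveIntegral_le (γ := γ) (t := t) hφc ω
    have h0 := hHM ω
    gcongr
    exact mul_nonneg (abs_nonneg _) ((abs_nonneg _).trans this)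
  · refine Eventually.of_forall fun ω a _ ↦ ?_
    simp_rw [curveIntegral_add_smul hγ t _ hw hφ]
    have h1 : HasDerivAt (fun a : ℝ ↦ -Complex.I * ξ *
        ((curveIntegral γ t w ω + a * curveIntegral γ t φ ω : ℝ) : ℂ))
        (-Complex.I * ξ * ((1 * curveIntegral γ t φ ω : ℝ) : ℂ)) a :=
      ((((hasDerivAt_id a).mul_const _).const_add _).ofReal_comp).const_mul _
    refine (h1.cexp.mul_const (H ω)).congr_deriv ?_
    push_cast
    ring

/-- The first functional derivative of a mean phase is represented by an integrable kernel. -/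
lemma exists_kernel_phaseMean [SigmaFinite (volume : Measure E)] {P' : Measure Ω'}
    [IsFiniteMeasure P'] (hγ : IsRandomCurve γ) {t : ℝ} (ξ : ℝ)
    (hac : (P'.prod (timeMeasure t)).map (fun p ↦ γ p.2 p.1) ≪ volume)
    {H : Ω' → ℂ} (hH : Measurable H) {M : ℝ} (hHM : ∀ ω, ‖H ω‖ ≤ M) {w : E → ℝ}
    (hw : Continuous w) :
    ∃ k : E → ℂ, Integrable k ∧ ∀ φ : E → ℝ, Continuous φ → (∃ c, ∀ y, |φ y| ≤ c) →
      ∫ y, k y * φ y =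
        phaseMean P' γ t ξ (fun ω ↦ -Complex.I * ξ * curveIntegral γ t φ ω * H ω) w := by
  have hph := measurable_phase hγ t ξ hw
  -- The kernel is the density of the occupation measure of the curve, weighted by the phase and
  -- `-iξ H`.
  obtain ⟨k, hk, h⟩ := exists_density (m := P'.prod (timeMeasure t)) hγ.measurable_uncurry hac
    (G := fun p ↦ Complex.exp (-Complex.I * ξ * curveIntegral γ t w p.1) *
      (-Complex.I * ξ * H p.1)) (M := |ξ| * M)
    ((hph.comp measurable_fst).mul ((hH.comp measurable_fst).const_mul _)) fun p ↦ by
      rw [norm_mul, norm_exp_phase, one_mul, norm_mul, norm_mul, norm_neg, Complex.norm_I,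
        one_mul, Complex.norm_real, Real.norm_eq_abs]
      exact mul_le_mul_of_nonneg_left (hHM _) (abs_nonneg _)
  refine ⟨k, hk, ?_⟩
  rintro φ hφ ⟨c, hc⟩
  have h1 := h (fun y ↦ (φ y : ℂ)) (Complex.measurable_ofReal.comp hφ.measurable)
    ⟨c, fun y ↦ by rw [Complex.norm_real]; exact hc y⟩
  simp_rw [mul_comm (k _)]
  rw [h1, integral_prod]
  · refine integral_congr_ae (Eventually.of_forall fun ω ↦ ?_)
    dsimp only
    rw [integral_mul_const, integral_complex_ofReal]
    simp only [curveIntegral]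
    ring
  · refine Integrable.of_bound (C := c * (|ξ| * M)) ?_ (Eventually.of_forall fun p ↦ ?_)
    · exact ((Complex.measurable_ofReal.comp (hφ.measurable.comp hγ.measurable_uncurry)).mul
        ((hph.comp measurable_fst).mul ((hH.comp measurable_fst).const_mul _))).aestronglyMeasurable
    · rw [norm_mul, norm_mul, norm_exp_phase, one_mul, norm_mul, norm_mul, norm_neg,
        Complex.norm_I, one_mul, Complex.norm_real, Complex.norm_real, Real.norm_eq_abs,
        Real.norm_eq_abs]
      have h2 := hHM p.1
      have h3 := hc (γ p.2 p.1)
      gcongr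
      exact (abs_nonneg _).trans h3

/-- Kernel of the second functional derivative of a mean phase. -/
lemma exists_kernel₂_phaseMean [SigmaFinite (volume : Measure E)] {P' : Measure Ω'}
    [IsFiniteMeasure P'] (hγ : IsRandomCurve γ) {t : ℝ} (ξ : ℝ)
    (hac : (P'.prod ((timeMeasure t).prod (timeMeasure t))).map
      (fun p ↦ (γ p.2.1 p.1, γ p.2.2 p.1)) ≪ volume)
    {H : Ω' → ℂ} (hH : Measurable H) {M : ℝ} (hHM : ∀ ω, ‖H ω‖ ≤ M) {w : E → ℝ}
    (hw : Continuous w) :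
    ∃ K : E × E → ℂ, Integrable K ∧ ∀ f : E × E → ℂ, Measurable f → (∃ c, ∀ y, ‖f y‖ ≤ c) →
      ∫ y, f y * K y = phaseMean P' γ t ξ (fun ω ↦
        (∫ p, f (γ p.1 ω, γ p.2 ω) ∂((timeMeasure t).prod (timeMeasure t))) *
          (-(ξ : ℂ) ^ 2 * H ω)) w := by
  have hph := measurable_phase hγ t ξ hw
  have hΦ : Measurable fun p : Ω' × (ℝ × ℝ) ↦ (γ p.2.1 p.1, γ p.2.2 p.1) :=
    (hγ.measurable_uncurry.comp (measurable_fst.prodMk (measurable_fst.comp measurable_snd))).prodMk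
      (hγ.measurable_uncurry.comp (measurable_fst.prodMk (measurable_snd.comp measurable_snd)))
  have hG : Measurable fun p : Ω' × (ℝ × ℝ) ↦
      Complex.exp (-Complex.I * ξ * curveIntegral γ t w p.1) * (-(ξ : ℂ) ^ 2 * H p.1) :=
    (hph.comp measurable_fst).mul ((hH.comp measurable_fst).const_mul _)
  have hGb (p : Ω' × (ℝ × ℝ)) : ‖Complex.exp (-Complex.I * ξ * curveIntegral γ t w p.1) *
      (-(ξ : ℂ) ^ 2 * H p.1)‖ ≤ |ξ| ^ 2 * M := by
    rw [norm_mul, norm_exp_phase, one_mul, norm_mul, norm_neg, norm_pow, Complex.norm_real,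
      Real.norm_eq_abs]
    exact mul_le_mul_of_nonneg_left (hHM _) (by positivity)
  -- The density represents all bounded measurable `f`, beyond the products of test functions in the
  -- definition of the second derivative. This is needed for `f(x', y') = ∂_l C_l(x' - y')`, which
  -- is not such a product.
  obtain ⟨K, hK, h⟩ := exists_density hΦ hac hG hGb
  refine ⟨K, hK, ?_⟩
  rintro f hf ⟨c, hc⟩
  rw [h f hf ⟨c, hc⟩, integral_prod]
  · refine integral_congr_ae (Eventually.of_forall fun ω ↦ ?_)
    dsimp only
    rw [integral_mul_const]
    ring
  · refine Integrable.of_bound (C := c * (|ξ| ^ 2 * M))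
      ((hf.comp hΦ).mul hG).aestronglyMeasurable (Eventually.of_forall fun p ↦ ?_)
    rw [norm_mul]
    exact mul_le_mul (hc _) (hGb p) (norm_nonneg _) ((norm_nonneg _).trans (hc 0))

lemma IsTestFunction.continuous {φ : E → ℝ} (hφ : IsTestFunction φ) : Continuous φ :=
  hφ.1.continuous

lemma IsTestFunction.exists_bound {φ : E → ℝ} (hφ : IsTestFunction φ) : ∃ c, ∀ y, |φ y| ≤ c :=
  hφ.2.exists_bound_of_continuous hφ.continuous

/-- Second functional derivative of a functional that is a mean phase. -/
theorem exists_hasFunctionalDeriv₂ [SigmaFinite (volume : Measure E)] {P' : Measure Ω'}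
    [IsFiniteMeasure P'] (hγ : IsRandomCurve γ) {t : ℝ} (ξ : ℝ)
    (hac : (P'.prod (timeMeasure t)).map (fun p ↦ γ p.2 p.1) ≪ volume)
    (hac₂ : (P'.prod ((timeMeasure t).prod (timeMeasure t))).map
      (fun p ↦ (γ p.2.1 p.1, γ p.2.2 p.1)) ≪ volume)
    {H : Ω' → ℂ} (hH : Measurable H) {M : ℝ} (hHM : ∀ ω, ‖H ω‖ ≤ M) {F : (E → ℝ) → ℂ}
    (hF : ∀ w, Continuous w → F w = phaseMean P' γ t ξ H w) {w : E → ℝ} (hw : Continuous w) :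
    ∃ K : E × E → ℂ, HasFunctionalDeriv₂ F w K ∧ Integrable K ∧
      ∀ f : E × E → ℂ, Measurable f → (∃ c, ∀ y, ‖f y‖ ≤ c) →
        ∫ y, f y * K y = phaseMean P' γ t ξ (fun ω ↦
          (∫ p, f (γ p.1 ω, γ p.2 ω) ∂((timeMeasure t).prod (timeMeasure t))) *
            (-(ξ : ℂ) ^ 2 * H ω)) w := by
  obtain ⟨K, hK, hKf⟩ := exists_kernel₂_phaseMean hγ ξ hac₂ hH hHM hw
  refine ⟨K, ⟨hK.locallyIntegrable, ?_⟩, hK, hKf⟩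
  have hex : ∀ w' : E → ℝ, Continuous w' → ∃ k : E → ℂ, Integrable k ∧ ∀ φ : E → ℝ,
      Continuous φ → (∃ c, ∀ y, |φ y| ≤ c) → ∫ y, k y * φ y =
        phaseMean P' γ t ξ (fun ω ↦ -Complex.I * ξ * curveIntegral γ t φ ω * H ω) w' :=
    fun w' hw' ↦ exists_kernel_phaseMean hγ ξ hac hH hHM hw'
  -- A kernel is chosen at every continuous field. Only its pairings with test functions matter
  -- below, so no regularity of the choice in the field is needed.
  choose! D hD using hex
  refine ⟨D, fun w' hw' ↦ ⟨(hD w' hw').1.locallyIntegrable, fun φ hφ ↦ ?_⟩, fun φ ψ hφ hψ ↦ ?_⟩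
  · obtain ⟨c, hc⟩ := hφ.exists_bound
    rw [(hD w' hw').2 φ hφ.continuous ⟨c, hc⟩]
    refine (hasDerivAt_phaseMean hγ t ξ hH hHM hw' hφ.continuous hc).congr_of_eventuallyEq
      (Eventually.of_forall fun a ↦ ?_)
    exact hF _ (hw'.add (hφ.continuous.const_smul a))
  · obtain ⟨c, hc⟩ := hφ.exists_bound
    obtain ⟨c', hc'⟩ := hψ.exists_bound
    have hA := measurable_curveIntegral hγ t hφ.continuous
    -- The first derivative in the direction `φ` is again a mean phase, with the factor `-iξ ∫
    -- φ(γ_s) ds` in the weight.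
    have hd := hasDerivAt_phaseMean (P' := P') hγ t ξ
      (H := fun ω ↦ -Complex.I * ξ * curveIntegral γ t φ ω * H ω)
      (M := |ξ| * (c * (timeMeasure t).real univ) * M) (by fun_prop) (fun ω ↦ by
        rw [norm_mul, norm_mul, norm_mul, norm_neg, Complex.norm_I, one_mul, Complex.norm_real,
          Complex.norm_real, Real.norm_eq_abs, Real.norm_eq_abs]
        have := abs_curveIntegral_le (γ := γ) (t := t) hc ω
        have h0 := hHM ω
        gcongr
        exact mul_nonneg (abs_nonneg _) ((abs_nonneg _).trans this)) hw hψ.continuous hc'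
    convert hd using 1
    · ext b
      exact (hD _ (hw.add (hψ.continuous.const_smul b))).2 φ hφ.continuous ⟨c, hc⟩
    · have h1 := hKf (fun p ↦ (φ p.1 : ℂ) * ψ p.2)
        ((Complex.measurable_ofReal.comp (hφ.continuous.measurable.comp measurable_fst)).mul
          (Complex.measurable_ofReal.comp (hψ.continuous.measurable.comp measurable_snd)))
        ⟨c * c', fun p ↦ by
          rw [norm_mul, Complex.norm_real, Complex.norm_real]
          exact mul_le_mul (hc _) (hc' _) (norm_nonneg _) ((abs_nonneg _).trans (hc 0))⟩
      have e : ∀ p : E × E, K p * φ p.1 * ψ p.2 = (φ p.1 : ℂ) * ψ p.2 * K p := fun p ↦ by ring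
      simp_rw [e]
      rw [h1]
      congr 1
      ext ω
      dsimp only
      rw [integral_prod_mul (μ := timeMeasure t) (ν := timeMeasure t)
        (fun s ↦ ((φ (γ s ω) : ℝ) : ℂ)) (fun s ↦ ((ψ (γ s ω) : ℝ) : ℂ)),
        integral_complex_ofReal, integral_complex_ofReal]
      simp only [curveIntegral]
      -- The two factors `-iξ` combine to `-ξ²`, and the product of the two curve integrals is the
      -- double integral of `φ ⊗ ψ`.
      linear_combination (-(ξ : ℂ) ^ 2 * H ω * ((∫ s, φ (γ s ω) ∂timeMeasure t : ℝ) : ℂ) *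
        ((∫ s, ψ (γ s ω) ∂timeMeasure t : ℝ) : ℂ)) * Complex.I_sq

end Curve


/-! ### Gaussian averages of phases and the abstract Polchinski equation -/

section CurveAverage

variable {E Ω Ω' : Type*} [NormedAddCommGroup E] [NormedSpace ℝ E] [MeasureSpace E]
  [BorelSpace E] [SecondCountableTopology E] [MeasurableSpace Ω] [MeasurableSpace Ω']
  {γ : ℝ → Ω' → E}

/-- Integral of `C` over the differences of pairs of points of the curve. -/
noncomputable def pairIntegral (γ : ℝ → Ω' → E) (t : ℝ) (C : E → ℂ) (ω : Ω') : ℂ :=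
  ∫ p, C (γ p.1 ω - γ p.2 ω) ∂((timeMeasure t).prod (timeMeasure t))

lemma measurable_pairIntegral (hγ : IsRandomCurve γ) (t : ℝ) {C : E → ℂ} (hC : Continuous C) :
    Measurable (pairIntegral γ t C) := by
  have : StronglyMeasurable fun p : Ω' × (ℝ × ℝ) ↦ C (γ p.2.1 p.1 - γ p.2.2 p.1) :=
    (hC.measurable.comp ((hγ.measurable_uncurry.comp
      (measurable_fst.prodMk (measurable_fst.comp measurable_snd))).sub
      (hγ.measurable_uncurry.comp
        (measurable_fst.prodMk (measurable_snd.comp measurable_snd))))).stronglyMeasurable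
  exact this.integral_prod_right'.measurable

lemma continuous_pair (hγ : IsRandomCurve γ) {C : E → ℂ} (hC : Continuous C) (ω : Ω') :
    Continuous fun p : ℝ × ℝ ↦ C (γ p.1 ω - γ p.2 ω) :=
  hC.comp (((hγ.continuous ω).comp continuous_fst).sub ((hγ.continuous ω).comp continuous_snd))

lemma norm_pairIntegral_le {t c : ℝ} {C : E → ℂ} (hC : ∀ z, ‖C z‖ ≤ c) (ω : Ω') :
    ‖pairIntegral γ t C ω‖ ≤ c * ((timeMeasure t).prod (timeMeasure t)).real univ :=
  norm_integral_le_of_norm_le_const (Eventually.of_forall fun _ ↦ hC _)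

/-- Exchanging `s` and `r` maps the `C (-z)` contribution to the `C z` contribution. The resulting
factor 2 cancels the Gaussian 1/2, which is why the equation carries no 1/2. -/
lemma integral_integral_covariance (hγ : IsRandomCurve γ) {t : ℝ} (ht : 0 ≤ t) {C R : E → ℂ}
    (hC : Continuous C) {c : ℝ} (hCb : ∀ z, ‖C z‖ ≤ c) (hR : ∀ z, R z = C z + C (-z)) (ω : Ω') :
    ∫ s in (0 : ℝ)..t, ∫ r in (0 : ℝ)..t, R (γ s ω - γ r ω) = 2 * pairIntegral γ t C ω := by
  simp only [intervalIntegral.integral_of_le ht]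
  have hRc : Continuous R := by
    rw [show R = fun z ↦ C z + C (-z) from funext hR]; fun_prop
  have hi (D : E → ℂ) (hD : Continuous D) (d : ℝ) (hd : ∀ z, ‖D z‖ ≤ d) :
      Integrable (fun p : ℝ × ℝ ↦ D (γ p.1 ω - γ p.2 ω)) ((timeMeasure t).prod (timeMeasure t)) :=
    Integrable.of_bound (C := d) (continuous_pair hγ hD ω).aestronglyMeasurable
      (Eventually.of_forall fun p ↦ hd _)
  have h1 := integral_prod _ (hi R hRc (c + c) fun z ↦ by
    rw [hR]; exact (norm_add_le _ _).trans (add_le_add (hCb _) (hCb _)))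
  rw [timeMeasure] at h1
  rw [← h1, ← timeMeasure]
  simp only [hR, neg_sub]
  have hsw : Integrable (fun p : ℝ × ℝ ↦ C (γ p.2 ω - γ p.1 ω))
    ((timeMeasure t).prod (timeMeasure t)) := (hi _ hC c hCb).swap
  rw [integral_add (hi C hC c hCb) hsw]
  have h2 := integral_prod_swap (μ := timeMeasure t) (ν := timeMeasure t)
    (fun p : ℝ × ℝ ↦ C (γ p.1 ω - γ p.2 ω))
  simp only [Prod.fst_swap, Prod.snd_swap] at h2
  rw [h2, two_mul]
  rfl

/-- Averaging a mean phase over a Gaussian field. -/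
theorem average_phaseMean {P : Measure Ω} {P' : Measure Ω'} [IsFiniteMeasure P']
    (hγ : IsRandomCurve γ) {t : ℝ} (ht : 0 ≤ t) (ξ : ℝ) {g : Ω' → ℂ} (hg : Measurable g) {M : ℝ}
    (hgM : ∀ ω, ‖g ω‖ ≤ M) {X : E → Ω → ℝ} {C R : E → ℂ} (hX : IsGaussianField P X R)
    (hC : Continuous C) {c : ℝ} (hCb : ∀ z, ‖C z‖ ≤ c) (hR : ∀ z, R z = C z + C (-z))
    {w : E → ℝ} (hw : Continuous w) :
    Integrable (fun ω ↦ phaseMean P' γ t ξ g (fun p ↦ w p + X p ω)) P ∧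
      ∫ ω, phaseMean P' γ t ξ g (fun p ↦ w p + X p ω) ∂P = phaseMean P' γ t ξ
        (fun ω' ↦ g ω' * Complex.exp (-(ξ : ℂ) ^ 2 * pairIntegral γ t C ω')) w := by
  have hP := hX.gaussian.isProbabilityMeasure
  -- A version continuous for every sample is jointly measurable in point and sample, as Fubini
  -- requires.
  obtain ⟨Y, hYc, hYm, hXY⟩ := exists_continuous_modification hX.gaussian.aemeasurable
    hX.continuous_samples
  have hYu : Measurable fun q : E × Ω ↦ Y q.1 q.2 :=
    measurable_uncurry_of_continuous_of_measurable hYc hYm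
  set J : Ω → Ω' → ℂ := fun ω ω' ↦ Complex.exp (-Complex.I * ξ *
    curveIntegral γ t (fun p ↦ w p + Y p ω) ω') * g ω' with hJ
  have hJm : Measurable (Function.uncurry J) := by
    have h1 : StronglyMeasurable fun q : (Ω × Ω') × ℝ ↦
        w (γ q.2 q.1.2) + Y (γ q.2 q.1.2) q.1.1 := by
      have h2 : Measurable fun q : (Ω × Ω') × ℝ ↦ γ q.2 q.1.2 :=
        hγ.measurable_uncurry.comp
          ((measurable_snd.comp measurable_fst).prodMk measurable_snd)
      exact ((hw.measurable.comp h2).add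
        (hYu.comp (h2.prodMk (measurable_fst.comp measurable_fst)))).stronglyMeasurable
    have h3 : Measurable fun q : Ω × Ω' ↦ curveIntegral γ t (fun p ↦ w p + Y p q.1) q.2 :=
      h1.integral_prod_right'.measurable
    have h4 : Measurable fun q : Ω × Ω' ↦ g q.2 := hg.comp measurable_snd
    have : Function.uncurry J = fun q : Ω × Ω' ↦ Complex.exp (-Complex.I * ξ *
      curveIntegral γ t (fun p ↦ w p + Y p q.1) q.2) * g q.2 := by
      ext q; simp [hJ, Function.uncurry]
    rw [this]
    fun_prop
  have hJi : Integrable (Function.uncurry J) (P.prod P') :=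
    Integrable.of_bound (C := M) hJm.aestronglyMeasurable (Eventually.of_forall fun q ↦ by
      simp only [Function.uncurry, hJ]
      rw [norm_mul, norm_exp_phase, one_mul]
      exact hgM _)
  have hae : (fun ω ↦ phaseMean P' γ t ξ g (fun p ↦ w p + X p ω)) =ᵐ[P]
      fun ω ↦ ∫ ω', J ω ω' ∂P' := by
    filter_upwards [hXY] with ω hω
    simp only [phaseMean, hω, hJ]
  refine ⟨hJi.integral_prod_left.congr hae.symm, ?_⟩
  rw [integral_congr_ae hae, integral_integral_swap hJi]
  refine integral_congr_ae (Eventually.of_forall fun ω' ↦ ?_)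
  simp only [hJ]
  have hRc : Continuous R := by
    rw [show R = fun z ↦ C z + C (-z) from funext hR]; fun_prop
  -- After Fubini the curve is frozen, so the characteristic function for a deterministic curve
  -- applies.
  have hchar := integral_exp_integral_gaussianField hX hRc (hγ.continuous ω') ht ξ
  rw [integral_integral_covariance hγ ht hC hCb hR] at hchar
  have e : ∀ᵐ ω ∂P, Complex.exp (-Complex.I * ξ *
      curveIntegral γ t (fun p ↦ w p + Y p ω) ω') * g ω' =
      Complex.exp (-Complex.I * ξ * curveIntegral γ t w ω') * g ω' *
        Complex.exp (-Complex.I * ξ * (∫ s in (0 : ℝ)..t, X (γ s ω') ω : ℝ)) := by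
    filter_upwards [hXY] with ω hω
    rw [curveIntegral_add hγ t hw (hYc ω), Complex.ofReal_add, mul_add, Complex.exp_add,
      intervalIntegral.integral_of_le ht]
    simp only [hω]
    simp only [curveIntegral, timeMeasure]
    ring
  rw [integral_congr_ae e, integral_const_mul, hchar, mul_assoc]
  congr 3
  ring

lemma hasDerivAt_pairIntegral (hγ : IsRandomCurve γ) (t : ℝ) {C dC : ℝ → E → ℂ}
    (hC : ∀ l z, HasDerivAt (fun l' ↦ C l' z) (dC l z) l) (hCc : ∀ l, Continuous (C l))
    (hdCc : ∀ l, Continuous (dC l))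
    (hb : ∀ l, ∃ c, ∀ l' ∈ Metric.ball l 1, ∀ z, ‖C l' z‖ ≤ c ∧ ‖dC l' z‖ ≤ c) (l : ℝ) (ω : Ω') :
    HasDerivAt (fun l' ↦ pairIntegral γ t (C l') ω) (pairIntegral γ t (dC l) ω) l := by
  obtain ⟨c, hc⟩ := hb l
  refine (hasDerivAt_integral_of_dominated_loc_of_deriv_le (Metric.ball_mem_nhds l one_pos)
    (F' := fun l' p ↦ dC l' (γ p.1 ω - γ p.2 ω)) (bound := fun _ ↦ c)
    (Eventually.of_forall fun l' ↦ (continuous_pair hγ (hCc l') ω).aestronglyMeasurable)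
    (Integrable.of_bound (C := c) (continuous_pair hγ (hCc l) ω).aestronglyMeasurable
      (Eventually.of_forall fun p ↦ (hc l (Metric.mem_ball_self one_pos) _).1))
    (continuous_pair hγ (hdCc l) ω).aestronglyMeasurable
    (Eventually.of_forall fun p l' hl' ↦ (hc l' hl' _).2) (integrable_const _)
    (Eventually.of_forall fun p l' _ ↦ hC l' _)).2

lemma norm_exp_pairIntegral_le {t ξ c : ℝ} {C : E → ℂ} (hC : ∀ z, ‖C z‖ ≤ c) (ω : Ω') :
    ‖Complex.exp (-(ξ : ℂ) ^ 2 * pairIntegral γ t C ω)‖ ≤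
      Real.exp (ξ ^ 2 * (c * ((timeMeasure t).prod (timeMeasure t)).real univ)) := by
  refine (Complex.norm_exp_le_exp_norm _).trans (Real.exp_le_exp.2 ?_)
  rw [norm_mul, norm_neg, norm_pow, Complex.norm_real, Real.norm_eq_abs, sq_abs]
  exact mul_le_mul_of_nonneg_left (norm_pairIntegral_le hC ω) (sq_nonneg _)

/-- The bounds uniform on a ball in `l` dominate both the exponential and the factor brought down.
The derivative is written as a pairing with `exists_kernel₂_phaseMean`, for the function `dC l (p.1
- p.2)` and the weight `g` times the exponential. -/
lemma hasDerivAt_phaseMean_pairIntegral {P' : Measure Ω'} [IsFiniteMeasure P']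
    (hγ : IsRandomCurve γ) (t ξ : ℝ) {g : Ω' → ℂ} (hg : Measurable g) {M : ℝ}
    (hgM : ∀ ω, ‖g ω‖ ≤ M) {C dC : ℝ → E → ℂ}
    (hC : ∀ l z, HasDerivAt (fun l' ↦ C l' z) (dC l z) l) (hCc : ∀ l, Continuous (C l))
    (hdCc : ∀ l, Continuous (dC l))
    (hb : ∀ l, ∃ c, ∀ l' ∈ Metric.ball l 1, ∀ z, ‖C l' z‖ ≤ c ∧ ‖dC l' z‖ ≤ c)
    {w : E → ℝ} (hw : Continuous w) (l : ℝ) :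
    HasDerivAt (fun l' ↦ phaseMean P' γ t ξ
        (fun ω ↦ g ω * Complex.exp (-(ξ : ℂ) ^ 2 * pairIntegral γ t (C l') ω)) w)
      (phaseMean P' γ t ξ (fun ω ↦ pairIntegral γ t (dC l) ω *
        (-(ξ : ℂ) ^ 2 * (g ω * Complex.exp (-(ξ : ℂ) ^ 2 * pairIntegral γ t (C l) ω)))) w) l := by
  obtain ⟨c, hc⟩ := hb l
  have hph := measurable_phase hγ t ξ hw
  have hq (l' : ℝ) := measurable_pairIntegral hγ t (hCc l')
  have hdq (l' : ℝ) := measurable_pairIntegral hγ t (hdCc l')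
  set m := ((timeMeasure t).prod (timeMeasure t)).real univ
  have hself := Metric.mem_ball_self (x := l) one_pos
  refine (hasDerivAt_integral_of_dominated_loc_of_deriv_le (Metric.ball_mem_nhds l one_pos)
    (F' := fun l' ω ↦ Complex.exp (-Complex.I * ξ * curveIntegral γ t w ω) *
      (pairIntegral γ t (dC l') ω * (-(ξ : ℂ) ^ 2 * (g ω *
        Complex.exp (-(ξ : ℂ) ^ 2 * pairIntegral γ t (C l') ω)))))
    (bound := fun _ ↦ (c * m) * (ξ ^ 2 * (M * Real.exp (ξ ^ 2 * (c * m)))))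
    (Eventually.of_forall fun l' ↦ ?_) ?_ ?_
    (Eventually.of_forall fun ω l' hl' ↦ ?_) (integrable_const _)
    (Eventually.of_forall fun ω l' _ ↦ ?_)).2
  · have := hq l'
    exact (hph.mul (by fun_prop)).aestronglyMeasurable
  · have := hq l
    refine Integrable.of_bound (C := M * Real.exp (ξ ^ 2 * (c * m)))
      (hph.mul (by fun_prop)).aestronglyMeasurable (Eventually.of_forall fun ω ↦ ?_)
    rw [norm_mul, norm_exp_phase, one_mul, norm_mul]
    exact mul_le_mul (hgM ω) (norm_exp_pairIntegral_le (fun z ↦ (hc l hself z).1) ω)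
      (norm_nonneg _) ((norm_nonneg _).trans (hgM ω))
  · have := hq l
    have := hdq l
    exact (hph.mul (by fun_prop)).aestronglyMeasurable
  · rw [norm_mul, norm_exp_phase, one_mul, norm_mul, norm_mul, norm_mul, norm_neg, norm_pow,
      Complex.norm_real, Real.norm_eq_abs, sq_abs]
    have h1 := norm_pairIntegral_le (γ := γ) (t := t) (fun z ↦ (hc l' hl' z).2) ω
    have h2 := norm_exp_pairIntegral_le (γ := γ) (t := t) (ξ := ξ) (fun z ↦ (hc l' hl' z).1) ω
    have h3 := hgM ω
    have hM : 0 ≤ M := (norm_nonneg _).trans h3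
    have hcm : 0 ≤ c * m := (norm_nonneg _).trans h1
    gcongr
  · have h1 := (((hasDerivAt_pairIntegral hγ t hC hCc hdCc hb l' ω).const_mul
      (-(ξ : ℂ) ^ 2)).cexp.const_mul (g ω)).const_mul
        (Complex.exp (-Complex.I * ξ * curveIntegral γ t w ω))
    refine h1.congr_deriv ?_
    ring

/-- The Polchinski equation for the phase of a random curve averaged over Gaussian fields. -/
theorem satisfiesPolchinski_of_curve [SigmaFinite (volume : Measure E)] {P : Measure Ω}
    {P' : Measure Ω'} [IsFiniteMeasure P'] (hγ : IsRandomCurve γ) {t : ℝ} (ht : 0 ≤ t) (ξ : ℝ)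
    (hac : (P'.prod (timeMeasure t)).map (fun p ↦ γ p.2 p.1) ≪ volume)
    (hac₂ : (P'.prod ((timeMeasure t).prod (timeMeasure t))).map
      (fun p ↦ (γ p.2.1 p.1, γ p.2.2 p.1)) ≪ volume)
    {g : Ω' → ℂ} (hg : Measurable g) {M : ℝ} (hgM : ∀ ω, ‖g ω‖ ≤ M)
    {C dC : ℝ → E → ℂ}
    (hC : ∀ l z, HasDerivAt (fun l' ↦ C l' z) (dC l z) l) (hCc : ∀ l, Continuous (C l))
    (hdCc : ∀ l, Continuous (dC l))
    (hb : ∀ l, ∃ c, ∀ l' ∈ Metric.ball l 1, ∀ z, ‖C l' z‖ ≤ c ∧ ‖dC l' z‖ ≤ c)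
    (hC0 : ∀ z, C 0 z = 0) {L : ℝ} (hL : 0 ≤ L) {R : ℝ → E → ℂ} {X : ℝ → E → Ω → ℝ}
    (hX : ∀ l ∈ Icc 0 L, IsGaussianField P (X l) (R l))
    (hR : ∀ l ∈ Icc 0 L, ∀ z, R l z = C l z + C l (-z))
    {T : (E → ℝ) → ℂ} (hT : ∀ w, Continuous w → T w = phaseMean P' γ t ξ g w) :
    (∀ l ∈ Icc 0 L, ∀ w : E → ℝ, Continuous w →
      Integrable (fun ω ↦ T (fun p ↦ w p + X l p ω)) P) ∧
    SatisfiesPolchinski C L (fun l ↦ partialAverage P T (X l)) ∧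
    ∀ w : E → ℝ, Continuous w → partialAverage P T (X 0) w = T w := by
  have hTae (l : ℝ) (hl : l ∈ Icc 0 L) (w : E → ℝ) (hw : Continuous w) :
      (fun ω ↦ T (fun p ↦ w p + X l p ω)) =ᵐ[P]
        fun ω ↦ phaseMean P' γ t ξ g (fun p ↦ w p + X l p ω) := by
    filter_upwards [(hX l hl).continuous_samples] with ω hω
    exact hT _ (hw.add hω)
  have hbl (l : ℝ) : ∃ c, ∀ z, ‖C l z‖ ≤ c ∧ ‖dC l z‖ ≤ c := by
    obtain ⟨c, hc⟩ := hb l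
    exact ⟨c, hc l (Metric.mem_ball_self one_pos)⟩
  -- Closed formula for the averaged functional: the same phase with the modified weight `g *
  -- exp(-ξ² ∬ C_l)`. Everything else is read off from it.
  have hform (l : ℝ) (hl : l ∈ Icc 0 L) (w : E → ℝ) (hw : Continuous w) :
      partialAverage P T (X l) w = phaseMean P' γ t ξ
        (fun ω' ↦ g ω' * Complex.exp (-(ξ : ℂ) ^ 2 * pairIntegral γ t (C l) ω')) w := by
    obtain ⟨c, hc⟩ := hbl l
    rw [partialAverage, integral_congr_ae (hTae l hl w hw)]
    exact (average_phaseMean hγ ht ξ hg hgM (hX l hl) (hCc l) (fun z ↦ (hc z).1) (hR l hl) hw).2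
  refine ⟨fun l hl w hw ↦ ?_, fun l hl ↦ ⟨fun z ↦ (hC l z).differentiableAt, fun w hw ↦ ?_⟩,
    fun w hw ↦ ?_⟩
  · obtain ⟨c, hc⟩ := hbl l
    exact (average_phaseMean hγ ht ξ hg hgM (hX l hl) (hCc l) (fun z ↦ (hc z).1)
      (hR l hl) hw).1.congr (hTae l hl w hw).symm
  · obtain ⟨c, hc⟩ := hbl l
    have hq := measurable_pairIntegral hγ t (hCc l)
    obtain ⟨K, hK, hKi, hKf⟩ := exists_hasFunctionalDeriv₂ (P' := P') hγ ξ hac hac₂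
      (H := fun ω' ↦ g ω' * Complex.exp (-(ξ : ℂ) ^ 2 * pairIntegral γ t (C l) ω'))
      (M := M * Real.exp (ξ ^ 2 * (c * ((timeMeasure t).prod (timeMeasure t)).real univ)))
      (by fun_prop) (fun ω ↦ by
        rw [norm_mul]
        exact mul_le_mul (hgM ω) (norm_exp_pairIntegral_le (fun z ↦ (hc z).1) ω)
          (norm_nonneg _) ((norm_nonneg _).trans (hgM ω))) (hform l hl) hw
    have hd : ∀ z, deriv (fun l' ↦ C l' z) l = dC l z := fun z ↦ (hC l z).deriv
    have hdm : Continuous fun p : E × E ↦ dC l (p.1 - p.2) :=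
      (hdCc l).comp (continuous_fst.sub continuous_snd)
    refine ⟨K, hK, ?_, ?_⟩
    · simp only [hd]
      exact hKi.bdd_mul hdm.aestronglyMeasurable (Eventually.of_forall fun p ↦ (hc _).2)
    · simp only [hd]
      -- The kernel of the second derivative is tested against the bounded continuous function `∂_l
      -- C_l(x' - y')`.
      rw [hKf _ hdm.measurable ⟨c, fun p ↦ (hc _).2⟩]
      -- The closed formula is differentiable for all real `l`, but equals the average only on `Icc
      -- 0 L`; hence the derivative within the interval.
      refine (hasDerivAt_phaseMean_pairIntegral hγ t ξ hg hgM hC hCc hdCc hb hw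
        l).hasDerivWithinAt.congr (fun l' hl' ↦ hform l' hl' w hw) (hform l hl w hw)
  · rw [hform 0 ⟨le_rfl, hL⟩ w hw, hT w hw]
    simp [pairIntegral, hC0]

end CurveAverage


/-! ### Logarithmic momentum scale and symmetric shells -/

section LogScale

/-- Logarithmic change of variables `k = e^{-s}`. -/
lemma integral_exp_neg_eq (l : ℝ) {f : ℝ → ℂ} (hf : ContinuousOn f (Ioi 0)) :
    ∫ k in (Real.exp (-l))..1, f k = ∫ s in (0 : ℝ)..l, f (Real.exp (-s)) * Real.exp (-s) := by
  have h := intervalIntegral.integral_deriv_smul_comp'' (a := 0) (b := l)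
    (f := fun s ↦ Real.exp (-s)) (f' := fun s ↦ -Real.exp (-s)) (g := f)
    (by fun_prop) (fun x _ ↦ by
      simpa using ((hasDerivAt_neg x).exp).hasDerivWithinAt) (by fun_prop)
    (hf.mono (by rintro _ ⟨s, -, rfl⟩; exact Real.exp_pos _))
  simp only [neg_zero, Real.exp_zero] at h
  rw [intervalIntegral.integral_symm, ← h, ← intervalIntegral.integral_neg]
  refine intervalIntegral.integral_congr fun s _ ↦ ?_
  simp [mul_comm]

/-- Integral over a symmetric shell. -/
lemma integral_indicator_shell {a : ℝ} (ha : 0 < a) (ha1 : a ≤ 1) {f : ℝ → ℂ}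
    (hf : ContinuousOn f {0}ᶜ) :
    ∫ k, indicator {q : ℝ | a < |q| ∧ |q| ≤ 1} f k =
      (∫ k in a..1, f k) + ∫ k in a..1, f (-k) := by
  have hs : {q : ℝ | a < |q| ∧ |q| ≤ 1} = Ioc a 1 ∪ Ico (-1) (-a) := by
    ext q
    simp only [mem_ofPred_eq, mem_union, mem_Ioc, mem_Ico]
    constructor
    · rintro ⟨h1, h2⟩
      rcases le_total 0 q with h | h
      · rw [abs_of_nonneg h] at h1 h2; exact Or.inl ⟨h1, h2⟩
      · rw [abs_of_nonpos h] at h1 h2; exact Or.inr ⟨by linarith, by linarith⟩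
    · rintro (⟨h1, h2⟩ | ⟨h1, h2⟩)
      · rw [abs_of_pos (ha.trans h1)]; exact ⟨h1, h2⟩
      · rw [abs_of_neg (by linarith)]; exact ⟨by linarith, by linarith⟩
  have h1 : IntegrableOn f (Ioc a 1) :=
    ((hf.mono fun x hx ↦ (ha.trans_le hx.1).ne').integrableOn_Icc).mono_set Ioc_subset_Icc_self
  have h2 : IntegrableOn f (Ico (-1) (-a)) :=
    ((hf.mono fun x hx ↦ (hx.2.trans_lt (neg_lt_zero.2 ha)).ne).integrableOn_Icc).mono_set
      Ico_subset_Icc_self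
  rw [hs, integral_indicator (measurableSet_Ioc.union measurableSet_Ico),
    setIntegral_union ?_ measurableSet_Ico h1 h2, ← intervalIntegral.integral_of_le ha1,
    integral_Ico_eq_integral_Ioc, ← intervalIntegral.integral_of_le (by linarith),
    intervalIntegral.integral_comp_neg]
  rw [disjoint_left]
  rintro x ⟨h3, -⟩ ⟨-, h4⟩
  linarith

end LogScale

/-! ### The steady covariance -/

section Steady

/-- Minus the logarithmic derivative of the steady covariance. -/
noncomputable def steadyRate (ε s z : ℝ) : ℂ :=
  Complex.exp (Complex.I * z * Real.exp (-s)) * ((Real.exp (-s) ^ (1 - ε) : ℝ) : ℂ) * Real.exp (-s)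

/-- In the variable `k = e^{-s}` the parameter `l` is merely an upper limit of integration, so `∂_l
C_l` follows from the fundamental theorem of calculus. -/
lemma steadyC_eq (ε l z : ℝ) : steadyC ε l z = ∫ s in (0 : ℝ)..l, steadyRate ε s z := by
  rw [steadyC, integral_exp_neg_eq]
  · simp only [steadyRate, abs_of_pos (Real.exp_pos _)]
  · refine ContinuousOn.mul (by fun_prop) (Complex.continuous_ofReal.comp_continuousOn ?_)
    exact continuous_abs.continuousOn.rpow_const fun x hx ↦ Or.inl (abs_pos.2 hx.ne').ne'

lemma continuous_exp_rpow (c : ℝ) : Continuous fun s : ℝ ↦ Real.exp (-s) ^ c :=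
  (by fun_prop : Continuous fun s : ℝ ↦ Real.exp (-s)).rpow_const
    fun _ ↦ Or.inl (Real.exp_pos _).ne'

lemma _root_.Continuous.steadyRate {Y : Type*} [TopologicalSpace Y] {f g : Y → ℝ} (ε : ℝ)
    (hf : Continuous f) (hg : Continuous g) : Continuous fun y ↦ steadyRate ε (f y) (g y) := by
  have : Continuous fun y ↦ Real.exp (-f y) ^ (1 - ε) := (continuous_exp_rpow _).comp hf
  unfold ShearFlow.steadyRate
  fun_prop

lemma norm_exp_I_mul (a b : ℝ) : ‖Complex.exp (Complex.I * a * b)‖ = 1 := by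
  rw [Complex.norm_exp]; simp

lemma norm_steadyRate (ε s z : ℝ) :
    ‖steadyRate ε s z‖ = Real.exp (-s) ^ (1 - ε) * Real.exp (-s) := by
  rw [steadyRate, norm_mul, norm_mul, norm_exp_I_mul, one_mul, Complex.norm_real,
    Complex.norm_real, Real.norm_of_nonneg (by positivity), Real.norm_of_nonneg (by positivity)]

/-- The negative half of the shell contributes `C_l(-z)` after `k ↦ -k`; the factor `√(2π)` of the
spectrum cancels the normalization. -/
lemma covarianceOfSpectrum_steady (ε : ℝ) {l : ℝ} (hl : 0 ≤ l) (z : ℝ) :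
    covarianceOfSpectrum (steadyHighSpectrum ε l) z = steadyC ε l z + steadyC ε l (-z) := by
  have h2 : ((√(2 * Real.pi) : ℝ) : ℂ) ≠ 0 := by
    exact_mod_cast (Real.sqrt_pos.2 (by positivity)).ne'
  have e : ∀ k : ℝ, Complex.exp (Complex.I * z * k) * (steadyHighSpectrum ε l k : ℂ) =
      ((√(2 * Real.pi) : ℝ) : ℂ) * indicator {q : ℝ | Real.exp (-l) < |q| ∧ |q| ≤ 1}
        (fun k ↦ Complex.exp (Complex.I * z * k) * ((|k| ^ (1 - ε) : ℝ) : ℂ)) k := by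
    intro k
    rw [steadyHighSpectrum]
    by_cases h : k ∈ {q : ℝ | Real.exp (-l) < |q| ∧ |q| ≤ 1}
    · rw [indicator_of_mem h, indicator_of_mem h]; push_cast; ring
    · rw [indicator_of_notMem h, indicator_of_notMem h]; simp
  rw [covarianceOfSpectrum]
  simp_rw [e]
  rw [integral_const_mul, integral_indicator_shell (Real.exp_pos _)
    (Real.exp_le_one_iff.2 (by linarith))]
  · rw [Complex.ofReal_inv, inv_mul_cancel_left₀ h2, steadyC, steadyC]
    congr 1
    refine intervalIntegral.integral_congr fun k _ ↦ ?_
    simp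
  · refine ContinuousOn.mul (by fun_prop) (Complex.continuous_ofReal.comp_continuousOn ?_)
    exact continuous_abs.continuousOn.rpow_const fun x hx ↦ Or.inl (abs_pos.2 hx).ne'

end Steady

/-! ### The unsteady covariance -/

section Unsteady

/-- Fourier integral of the Cauchy kernel. -/
noncomputable def cauchyFourier (u : ℝ) : ℂ :=
  ∫ y : ℝ, Complex.exp (Complex.I * u * y) * (((1 + y ^ 2)⁻¹ : ℝ) : ℂ)

lemma continuous_cauchyFourier : Continuous cauchyFourier := by
  refine continuous_of_dominated (bound := fun y : ℝ ↦ (1 + y ^ 2)⁻¹) (fun u ↦ ?_)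
    (fun u ↦ Eventually.of_forall fun y ↦ ?_) integrable_inv_one_add_sq
    (Eventually.of_forall fun y ↦ by fun_prop)
  · exact Measurable.aestronglyMeasurable (by fun_prop)
  · rw [norm_mul, norm_exp_I_mul, one_mul, Complex.norm_real, Real.norm_of_nonneg (by positivity)]

lemma norm_cauchyFourier_le (u : ℝ) : ‖cauchyFourier u‖ ≤ ∫ y : ℝ, (1 + y ^ 2)⁻¹ := by
  refine norm_integral_le_of_norm_le integrable_inv_one_add_sq (Eventually.of_forall fun y ↦ ?_)
  rw [norm_mul, norm_exp_I_mul, one_mul, Complex.norm_real, Real.norm_of_nonneg (by positivity)]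

/-- Scaling `ω = a y`. Only continuity and boundedness of `cauchyFourier` are used afterwards, so
its explicit value is not needed. -/
lemma integral_exp_mul_lorentzian {a : ℝ} (ha : 0 < a) (τ : ℝ) :
    ∫ ω : ℝ, Complex.exp (Complex.I * τ * ω) * ((a / (a ^ 2 + ω ^ 2) : ℝ) : ℂ) =
      cauchyFourier (a * τ) := by
  have h := Measure.integral_comp_mul_left
    (fun ω : ℝ ↦ Complex.exp (Complex.I * τ * ω) * ((a / (a ^ 2 + ω ^ 2) : ℝ) : ℂ)) a
  have e : ∀ y : ℝ, Complex.exp (Complex.I * τ * ((a * y : ℝ) : ℂ)) *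
      ((a / (a ^ 2 + (a * y) ^ 2) : ℝ) : ℂ) =
      ((a⁻¹ : ℝ) : ℂ) * (Complex.exp (Complex.I * ((a * τ : ℝ) : ℂ) * y) *
        (((1 + y ^ 2)⁻¹ : ℝ) : ℂ)) := by
    intro y
    have h1 : a / (a ^ 2 + (a * y) ^ 2) = a⁻¹ * (1 + y ^ 2)⁻¹ := by
      field_simp
    rw [h1]
    push_cast
    rw [mul_left_comm]
    congr 3
    ring
  simp_rw [e] at h
  rw [integral_const_mul, abs_of_pos (inv_pos.2 ha), Complex.real_smul] at h
  exact (mul_left_cancel₀ (by exact_mod_cast (inv_pos.2 ha).ne') h).symm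

/-- Space-frequency density of the unsteady covariance in logarithmic scale. -/
noncomputable def unsteadyDensity (ε ζ : ℝ) (p : ℝ × ℝ) (s ω : ℝ) : ℂ :=
  steadyRate ε s p.1 * (Complex.exp (Complex.I * p.2 * ω) *
    ((Real.exp (-s) ^ ζ / ((Real.exp (-s) ^ ζ) ^ 2 + ω ^ 2) : ℝ) : ℂ))

/-- Minus the logarithmic derivative of the unsteady covariance. -/
noncomputable def unsteadyRate (ε ζ s : ℝ) (p : ℝ × ℝ) : ℂ :=
  steadyRate ε s p.1 * cauchyFourier (Real.exp (-s) ^ ζ * p.2)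

lemma integral_unsteadyDensity (ε ζ : ℝ) (p : ℝ × ℝ) (s : ℝ) :
    ∫ ω, unsteadyDensity ε ζ p s ω = unsteadyRate ε ζ s p := by
  simp only [unsteadyDensity]
  rw [integral_const_mul, integral_exp_mul_lorentzian (Real.rpow_pos_of_pos (Real.exp_pos _) _)]
  rfl

lemma continuous_unsteadyRate (ε ζ : ℝ) : Continuous (Function.uncurry (unsteadyRate ε ζ)) := by
  have h1 : Continuous fun q : ℝ × (ℝ × ℝ) ↦ steadyRate ε q.1 q.2.1 :=
    continuous_fst.steadyRate ε (continuous_fst.comp continuous_snd)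
  have h2 : Continuous fun q : ℝ × (ℝ × ℝ) ↦ Real.exp (-q.1) ^ ζ :=
    (continuous_exp_rpow ζ).comp continuous_fst
  exact h1.mul (continuous_cauchyFourier.comp (h2.mul (continuous_snd.comp continuous_snd)))

lemma norm_unsteadyRate_le (ε ζ s : ℝ) (p : ℝ × ℝ) : ‖unsteadyRate ε ζ s p‖ ≤
    Real.exp (-s) ^ (1 - ε) * Real.exp (-s) * ∫ y : ℝ, (1 + y ^ 2)⁻¹ := by
  rw [unsteadyRate, norm_mul, norm_steadyRate]
  exact mul_le_mul_of_nonneg_left (norm_cauchyFourier_le _) (by positivity)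

lemma continuous_unsteadyDensity (ε ζ : ℝ) (p : ℝ × ℝ) :
    Continuous (Function.uncurry (unsteadyDensity ε ζ p)) := by
  have h1 : Continuous fun q : ℝ × ℝ ↦ steadyRate ε q.1 p.1 :=
    continuous_fst.steadyRate ε continuous_const
  have h2 : Continuous fun q : ℝ × ℝ ↦ Real.exp (-q.1) ^ ζ :=
    (continuous_exp_rpow ζ).comp continuous_fst
  have h3 : Continuous fun q : ℝ × ℝ ↦
      Real.exp (-q.1) ^ ζ / ((Real.exp (-q.1) ^ ζ) ^ 2 + q.2 ^ 2) :=
    h2.div ((h2.pow 2).add (continuous_snd.pow 2)) fun q ↦ by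
      have := Real.rpow_pos_of_pos (Real.exp_pos (-q.1)) ζ
      positivity
  have h4 : Continuous fun q : ℝ × ℝ ↦ Complex.exp (Complex.I * p.2 * q.2) := by fun_prop
  exact h1.mul (h4.mul (Complex.continuous_ofReal.comp h3))

lemma norm_unsteadyDensity (ε ζ : ℝ) (p : ℝ × ℝ) (s ω : ℝ) : ‖unsteadyDensity ε ζ p s ω‖ =
    Real.exp (-s) ^ (1 - ε) * Real.exp (-s) *
      (Real.exp (-s) ^ ζ / ((Real.exp (-s) ^ ζ) ^ 2 + ω ^ 2)) := by
  rw [unsteadyDensity, norm_mul, norm_mul, norm_exp_I_mul, one_mul, norm_steadyRate,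
    Complex.norm_real, Real.norm_of_nonneg (by positivity)]

/-- A majorant integrable in `ω` and uniform over widths `a` in `[A⁻¹, A]`: two powers of `A` come
from the denominator and one from the numerator. -/
lemma lorentzian_le {a A ω : ℝ} (hA : 1 ≤ A) (ha : a ≤ A) (ha' : A⁻¹ ≤ a) :
    a / (a ^ 2 + ω ^ 2) ≤ A ^ 3 * (1 + ω ^ 2)⁻¹ := by
  have hA0 : 0 < A := by linarith
  have ha0 : 0 < a := (inv_pos.2 hA0).trans_le ha'
  have h1 : 1 ≤ A * a := by
    have := mul_le_mul_of_nonneg_left ha' hA0.le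
    rwa [mul_inv_cancel₀ hA0.ne'] at this
  have h2 : 1 ≤ (A * a) ^ 2 := one_le_pow₀ h1
  have h3 : 1 + ω ^ 2 ≤ A ^ 2 * (a ^ 2 + ω ^ 2) := by 
    nlinarith [mul_nonneg (sub_nonneg.2 (one_le_pow₀ hA : 1 ≤ A ^ 2)) (sq_nonneg ω)]
  rw [← div_eq_mul_inv, div_le_div_iff₀ (by positivity) (by positivity)]
  calc a * (1 + ω ^ 2) ≤ A * (A ^ 2 * (a ^ 2 + ω ^ 2)) := by gcongr
    _ = A ^ 3 * (a ^ 2 + ω ^ 2) := by ring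

/-- Justifies Fubini between scale and frequency. For `|s| ≤ |l|` the width `e^{-sζ}` lies between
`A⁻¹` and `A` with `A = e^{|l| |ζ|}`, so `lorentzian_le` gives a majorant depending on `ω` alone. -/
lemma integrable_unsteadyDensity (ε ζ : ℝ) (p : ℝ × ℝ) (l : ℝ) :
    Integrable (Function.uncurry (unsteadyDensity ε ζ p))
      ((volume.restrict (uIoc 0 l)).prod volume) := by
  set A : ℝ := Real.exp (|l| * |ζ|) with hA
  have hA1 : 1 ≤ A := Real.one_le_exp (by positivity)
  set c : ℝ := Real.exp (|l| * (|1 - ε| + 1))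
  have hfin : IsFiniteMeasure (volume.restrict (uIoc 0 l)) := 
    inferInstanceAs (IsFiniteMeasure (volume.restrict (Ioc _ _)))
  have hint : Integrable (fun q : ℝ × ℝ ↦ c * (A ^ 3 * (1 + q.2 ^ 2)⁻¹))
      ((volume.restrict (uIoc 0 l)).prod volume) :=
    Integrable.mul_prod (f := fun _ ↦ c) (g := fun y : ℝ ↦ A ^ 3 * (1 + y ^ 2)⁻¹)
      (integrable_const _) (integrable_inv_one_add_sq.const_mul _)
  refine hint.mono' (continuous_unsteadyDensity ε ζ p).aestronglyMeasurable ?_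
  have hmem : ∀ᵐ q : ℝ × ℝ ∂((volume.restrict (uIoc 0 l)).prod volume), q.1 ∈ uIoc 0 l :=
    Measure.quasiMeasurePreserving_fst.ae (ae_restrict_mem measurableSet_uIoc)
  filter_upwards [hmem] with q hq
  have hs : |q.1| ≤ |l| := by
    have := abs_sub_left_of_mem_uIcc (uIoc_subset_uIcc hq)
    simpa using this
  have hexp (b : ℝ) : Real.exp (-q.1) ^ b = Real.exp (-q.1 * b) := by rw [← Real.exp_mul]
  have hab (b : ℝ) : |-q.1 * b| ≤ |l| * |b| := by
    rw [abs_mul, abs_neg]; exact mul_le_mul_of_nonneg_right hs (abs_nonneg _)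
  simp only [Function.uncurry]
  rw [norm_unsteadyDensity]
  refine mul_le_mul ?_ (lorentzian_le hA1 ?_ ?_) (by positivity) (by positivity)
  · rw [hexp, ← Real.exp_add]
    refine Real.exp_le_exp.2 ?_
    have h1 := (abs_le.1 (hab (1 - ε))).2
    have h2 := (abs_le.1 hs).1
    nlinarith
  · rw [hexp]
    exact Real.exp_le_exp.2 (abs_le.1 (hab ζ)).2
  · rw [hexp, hA, ← Real.exp_neg]
    exact Real.exp_le_exp.2 (abs_le.1 (hab ζ)).1

lemma continuousOn_unsteadyIntegrand (ε ζ : ℝ) (p : ℝ × ℝ) (ω : ℝ) :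
    ContinuousOn (fun k : ℝ ↦ Complex.exp (Complex.I * p.1 * k + Complex.I * p.2 * ω) *
      ((|k| ^ (1 - ε) * (|k| ^ ζ / (|k| ^ (2 * ζ) + ω ^ 2)) : ℝ) : ℂ)) {0}ᶜ := by
  have h (c : ℝ) : ContinuousOn (fun k : ℝ ↦ |k| ^ c) {0}ᶜ :=
    continuous_abs.continuousOn.rpow_const fun x hx ↦ Or.inl (abs_pos.2 hx).ne'
  refine ContinuousOn.mul (by fun_prop) (Complex.continuous_ofReal.comp_continuousOn ?_)
  refine (h _).mul ((h _).div ((h _).add continuousOn_const) fun k hk ↦ ?_)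
  have := Real.rpow_pos_of_pos (abs_pos.2 hk) (2 * ζ)
  positivity

lemma integral_unsteadyIntegrand (ε ζ l : ℝ) (p : ℝ × ℝ) (ω : ℝ) :
    ∫ k in (Real.exp (-l))..1, Complex.exp (Complex.I * p.1 * k + Complex.I * p.2 * ω) *
      ((|k| ^ (1 - ε) * (|k| ^ ζ / (|k| ^ (2 * ζ) + ω ^ 2)) : ℝ) : ℂ) =
    ∫ s in (0 : ℝ)..l, unsteadyDensity ε ζ p s ω := by
  rw [integral_exp_neg_eq l ((continuousOn_unsteadyIntegrand ε ζ p ω).mono fun x hx ↦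
    (ne_of_gt hx : x ≠ 0))]
  refine intervalIntegral.integral_congr fun s _ ↦ ?_
  have h : Real.exp (-s) ^ (2 * ζ) = (Real.exp (-s) ^ ζ) ^ 2 := by
    rw [mul_comm, Real.rpow_mul (Real.exp_pos _).le]; norm_cast
  simp only [abs_of_pos (Real.exp_pos _), h, unsteadyDensity, steadyRate, Complex.exp_add]
  push_cast
  ring

lemma integrable_integral_unsteadyDensity (ε ζ : ℝ) (p : ℝ × ℝ) (l : ℝ) :
    Integrable fun ω ↦ ∫ s in (0 : ℝ)..l, unsteadyDensity ε ζ p s ω := by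
  have h := (integrable_unsteadyDensity ε ζ p l).integral_prod_right
  simp only [intervalIntegral.intervalIntegral_eq_integral_uIoc]
  exact h.smul _

lemma unsteadyC_eq (ε ζ l : ℝ) (p : ℝ × ℝ) :
    unsteadyC ε ζ l p = ∫ s in (0 : ℝ)..l, unsteadyRate ε ζ s p := by
  simp only [unsteadyC, integral_unsteadyIntegrand, ← integral_unsteadyDensity]
  simp only [intervalIntegral.intervalIntegral_eq_integral_uIoc]
  -- The definition integrates over frequency last; after the exchange the inner frequency integral
  -- is the rate.
  rw [integral_smul, integral_integral_swap (integrable_unsteadyDensity ε ζ p l)]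

lemma covarianceOfSpectrum₂_unsteady (ε ζ : ℝ) {l : ℝ} (hl : 0 ≤ l) (p : ℝ × ℝ) :
    covarianceOfSpectrum₂ (unsteadyHighSpectrum ε ζ l) p =
      unsteadyC ε ζ l p + unsteadyC ε ζ l (-p) := by
  have h2 : ((√(2 * Real.pi) : ℝ) : ℂ) ≠ 0 := by
    exact_mod_cast (Real.sqrt_pos.2 (by positivity)).ne'
  have e : ∀ ω : ℝ, (∫ k : ℝ, Complex.exp (Complex.I * p.1 * k + Complex.I * p.2 * ω) *
      (unsteadyHighSpectrum ε ζ l k ω : ℂ)) =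
      ((√(2 * Real.pi) : ℝ) : ℂ) * ((∫ s in (0 : ℝ)..l, unsteadyDensity ε ζ p s ω) +
        ∫ s in (0 : ℝ)..l, unsteadyDensity ε ζ (-p) s (-ω)) := by
    intro ω
    have e1 : (fun k : ℝ ↦ Complex.exp (Complex.I * p.1 * k + Complex.I * p.2 * ω) *
        (unsteadyHighSpectrum ε ζ l k ω : ℂ)) =ᵐ[volume] fun k ↦ ((√(2 * Real.pi) : ℝ) : ℂ) *
        indicator {q : ℝ | Real.exp (-l) < |q| ∧ |q| ≤ 1}
          (fun k : ℝ ↦ Complex.exp (Complex.I * p.1 * k + Complex.I * p.2 * ω) *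
            ((|k| ^ (1 - ε) * (|k| ^ ζ / (|k| ^ (2 * ζ) + ω ^ 2)) : ℝ) : ℂ)) k := by
      -- The unsteady shell includes the points `±e^{-l}`, a null set, so it may be replaced by the
      -- half-open shell of the steady case.
      have hne : ∀ᵐ k : ℝ ∂volume, k ∉ ({Real.exp (-l), -Real.exp (-l)} : Set ℝ) :=
        measure_eq_zero_iff_ae_notMem.1 ((Set.toFinite _).measure_zero _)
      filter_upwards [hne] with k hk
      simp only [mem_insert_iff, mem_singleton_iff, not_or] at hk
      rw [unsteadyHighSpectrum]
      have hiff : k ∈ {q : ℝ | Real.exp (-l) ≤ |q| ∧ |q| ≤ 1} ↔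
          k ∈ {q : ℝ | Real.exp (-l) < |q| ∧ |q| ≤ 1} := by
        simp only [mem_ofPred_eq]
        refine and_congr_left fun _ ↦ ⟨fun h ↦ h.lt_of_ne fun h' ↦ ?_, le_of_lt⟩
        rcases abs_eq (Real.exp_pos _).le |>.1 h'.symm with h'' | h''
        · exact hk.1 h''
        · exact hk.2 h''
      by_cases h : k ∈ {q : ℝ | Real.exp (-l) < |q| ∧ |q| ≤ 1}
      · rw [indicator_of_mem h, indicator_of_mem (hiff.2 h)]; push_cast; ring
      · rw [indicator_of_notMem h, indicator_of_notMem (mt hiff.1 h)]; simp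
    rw [integral_congr_ae e1, integral_const_mul, integral_indicator_shell (Real.exp_pos _)
      (Real.exp_le_one_iff.2 (by linarith)) (continuousOn_unsteadyIntegrand ε ζ p ω),
      ← integral_unsteadyIntegrand, ← integral_unsteadyIntegrand]
    congr 2
    refine intervalIntegral.integral_congr fun k _ ↦ ?_
    simp
  rw [covarianceOfSpectrum₂]
  simp_rw [e]
  have h3 := integrable_integral_unsteadyDensity ε ζ (-p) l
  -- Reflecting `k` gives the density at `-p` and `-ω`; a reflection of `ω` under the frequency
  -- integral turns it into `C_l(-p)`.
  rw [integral_const_mul, Complex.ofReal_inv, inv_mul_cancel_left₀ h2,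
    integral_add (integrable_integral_unsteadyDensity ε ζ p l) h3.comp_neg,
    integral_neg_eq_self (fun ω ↦ ∫ s in (0 : ℝ)..l, unsteadyDensity ε ζ (-p) s ω)]
  simp only [unsteadyC, integral_unsteadyIntegrand]

end Unsteady

/-- Local bounds for a family of functions given by integration of a rate. -/
lemma exists_bound_integral_rate {E : Type*} {h : ℝ → E → ℂ} {β : ℝ → ℝ} (hβ : Continuous β)
    (hb : ∀ s z, ‖h s z‖ ≤ β s) (l : ℝ) :
    ∃ c, ∀ l' ∈ Metric.ball l 1, ∀ z, ‖∫ s in (0 : ℝ)..l', h s z‖ ≤ c ∧ ‖h l' z‖ ≤ c := by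
  -- For `l'` within distance 1 of `l`, all scales involved lie in the compact interval `|s| ≤ |l| +
  -- 1`, where `β` is bounded.
  obtain ⟨b, hb'⟩ := (isCompact_Icc (a := -(|l| + 1)) (b := |l| + 1)).exists_bound_of_continuousOn
    hβ.continuousOn
  have hB (s : ℝ) (hs : |s| ≤ |l| + 1) (z : E) : ‖h s z‖ ≤ b :=
    (hb s z).trans ((le_abs_self _).trans (hb' s (abs_le.1 hs)))
  refine ⟨max (b * (|l| + 1)) b, fun l' hl' z ↦ ?_⟩
  have hll : |l'| ≤ |l| + 1 := by
    rw [Metric.mem_ball, Real.dist_eq] at hl'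
    have := abs_sub_abs_le_abs_sub l' l
    linarith
  have hb0 : 0 ≤ b := (norm_nonneg _).trans (hB l' hll z)
  refine ⟨?_, (hB l' hll z).trans (le_max_right _ _)⟩
  refine (intervalIntegral.norm_integral_le_of_norm_le_const (C := b) fun s hs ↦ ?_).trans ?_
  · refine hB s (le_trans ?_ hll) z
    simpa using abs_sub_left_of_mem_uIcc (uIoc_subset_uIcc hs)
  · rw [sub_zero]
    exact (mul_le_mul_of_nonneg_left hll hb0).trans (le_max_left _ _)


/-! ### Absolute continuity of joint laws -/

section AbsolutelyContinuous

variable {Ω' Y Z : Type*} [MeasurableSpace Ω'] [MeasurableSpace Y] [MeasurableSpace Z]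
  {P' : Measure Ω'}

/-- If almost every marginal is absolutely continuous, so is the joint law with the parameter. -/
lemma map_prodMk_absolutelyContinuous [SFinite P'] {Λ ρ : Measure Y} [SFinite Λ] [SFinite ρ]
    (hΛ : Λ ≪ ρ) {κ : Measure Z} [SFinite κ] {b : Y → Ω' → Z}
    (hb : Measurable fun p : Ω' × Y ↦ b p.2 p.1) (h : ∀ᵐ y ∂Λ, P'.map (b y) ≪ κ) :
    (P'.prod Λ).map (fun p ↦ (p.2, b p.2 p.1)) ≪ ρ.prod κ := by
  refine Measure.AbsolutelyContinuous.mk fun N hN hN0 ↦ ?_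
  have hm : Measurable fun p : Ω' × Y ↦ (p.2, b p.2 p.1) := measurable_snd.prodMk hb
  -- Tonelli slices the measure at fixed parameter: almost every slice of a null set is null, hence
  -- is not charged by the marginal law.
  rw [Measure.map_apply hm hN, Measure.prod_apply_symm (hm hN)]
  refine lintegral_eq_zero_of_ae_eq_zero ?_
  filter_upwards [h, hΛ.ae_le ((Measure.measure_prod_null hN).1 hN0)] with y hy hy0
  have hby : Measurable (b y) := hb.comp measurable_prodMk_right
  have := hy hy0
  rwa [Measure.map_apply hby (measurable_prodMk_left hN)] at this

/-- Regroups a pair of times and a pair of positions into two space-time points; the map is a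
composition of associators and swaps. -/
lemma measurePreserving_prod_prod_comm :
    MeasurePreserving (fun q : (ℝ × ℝ) × (ℝ × ℝ) ↦ ((q.2.1, q.1.1), (q.2.2, q.1.2)))
      volume volume := by
  have ha := volume_preserving_prodAssoc (α₁ := ℝ) (β₁ := ℝ) (γ₁ := ℝ × ℝ)
  have hb := (volume_preserving_prodAssoc (α₁ := ℝ) (β₁ := ℝ) (γ₁ := ℝ)).symm
  have hb' := (volume_preserving_prodAssoc (α₁ := ℝ) (β₁ := ℝ) (γ₁ := ℝ))
  have hs : MeasurePreserving (Prod.swap : ℝ × ℝ → ℝ × ℝ) volume volume :=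
    Measure.measurePreserving_swap
  have hid := MeasurePreserving.id (volume : Measure ℝ)
  have h1 := hid.prod hb
  have h2 := hid.prod (hs.prod hid)
  have h3 := hid.prod hb'
  have h4 := ha.symm
  have h5 := hs.prod hs
  exact h5.comp (h4.comp (h3.comp (h2.comp (h1.comp ha))))

end AbsolutelyContinuous

/-! ### Absolute continuity of Brownian positions -/

section Brownian

variable {Ω' : Type*} [MeasurableSpace Ω'] {P' : Measure Ω'} {B : ℝ≥0 → Ω' → ℝ}

/-- Brownian motion with diffusivity `ν` started at `x`, with time in `ℝ`. -/
noncomputable def brownianCurve (B : ℝ≥0 → Ω' → ℝ) (ν x s : ℝ) (ω : Ω') : ℝ :=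
  x + √ν * B s.toNNReal ω

lemma isRandomCurve_brownian (hBc : ∀ ω, Continuous fun s ↦ B s ω) (hBm : ∀ s, Measurable (B s))
    (ν x : ℝ) : IsRandomCurve (brownianCurve B ν x) where
  continuous ω := by
    have := (hBc ω).comp continuous_real_toNNReal
    exact continuous_const.add (continuous_const.mul this)
  measurable s := ((hBm _).const_mul _).const_add _

lemma isRandomCurve_spaceTime (hBc : ∀ ω, Continuous fun s ↦ B s ω) (hBm : ∀ s, Measurable (B s))
    (ν x t : ℝ) : IsRandomCurve fun s ω ↦ (brownianCurve B ν x s ω, t - s) where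
  continuous ω := ((isRandomCurve_brownian hBc hBm ν x).continuous ω).prodMk (by fun_prop)
  measurable s := ((isRandomCurve_brownian hBc hBm ν x).measurable s).prodMk measurable_const

lemma map_affine_absolutelyContinuous {X : Ω' → ℝ} {v : ℝ≥0} (hX : HasLaw X (gaussianReal 0 v) P')
    (hv : v ≠ 0) {ν : ℝ} (hν : 0 < ν) (x : ℝ) : P'.map (fun ω ↦ x + √ν * X ω) ≪ volume := by
  have h := gaussianReal_const_add (gaussianReal_const_mul hX (√ν)) x
  rw [h.map_eq]
  refine gaussianReal_absolutelyContinuous _ (mul_ne_zero ?_ hv)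
  rw [← NNReal.coe_ne_zero]
  exact pow_ne_zero _ (Real.sqrt_pos.2 hν).ne'

lemma map_brownianCurve_absolutelyContinuous (hB : IsPreBrownianReal B P') {ν : ℝ} (hν : 0 < ν)
    (x : ℝ) {s : ℝ} (hs : 0 < s) : P'.map (brownianCurve B ν x s) ≪ volume :=
  map_affine_absolutelyContinuous (hB.hasLaw_eval s.toNNReal) (Real.toNNReal_pos.2 hs).ne' hν x

/-- For `s < r` the pair is the image of two independent nondegenerate Gaussians, the position at
`s` and the increment, under `(y, z) ↦ (y, y + z)`, which preserves Lebesgue measure. The other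
order follows by swapping. -/
lemma map_brownianCurve_pair_absolutelyContinuous (hB : IsPreBrownianReal B P')
    (hBm : ∀ s, Measurable (B s)) {ν : ℝ} (hν : 0 < ν) (x : ℝ) {s r : ℝ} (hs : 0 < s) (hr : 0 < r)
    (hsr : s ≠ r) :
    P'.map (fun ω ↦ (brownianCurve B ν x s ω, brownianCurve B ν x r ω)) ≪ volume := by
  have hP := hB.isGaussianProcess.isProbabilityMeasure
  have hm (u : ℝ) : Measurable (brownianCurve B ν x u) := ((hBm _).const_mul _).const_add _
  wlog h : s < r generalizing s r
  · have h1 := this hr hs hsr.symm (lt_of_le_of_ne (not_lt.1 h) hsr.symm)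
    have h2 := h1.map (f := Prod.swap) measurable_swap
    rw [Measure.map_map measurable_swap ((hm r).prodMk (hm s))] at h2
    refine h2.trans ?_
    have h3 : MeasurePreserving (Prod.swap : ℝ × ℝ → ℝ × ℝ) volume volume :=
      Measure.measurePreserving_swap
    rw [h3.map_eq]
  have hle : s.toNNReal ≤ r.toNNReal := Real.toNNReal_le_toNNReal h.le
  have hind := hB.hasIndepIncrements.indepFun_eval_sub (r := 0) zero_le hle
    hB.eval_zero_ae_eq_zero
  -- The starting point goes with the position; the summand `0` brings the increment into the form
  -- of `map_affine_absolutelyContinuous`.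
  have hind2 := hind.comp (φ := fun y ↦ x + √ν * y) (ψ := fun y ↦ 0 + √ν * y)
    (by fun_prop) (by fun_prop)
  have hmU : Measurable fun ω ↦ 0 + √ν * (B r.toNNReal - B s.toNNReal) ω :=
    (((hBm _).sub (hBm _)).const_mul _).const_add _
  have hmap := (indepFun_iff_map_prod_eq_prod_map_map (hm s).aemeasurable hmU.aemeasurable).1 hind2
  have hac : P'.map (fun ω ↦ 0 + √ν * (B r.toNNReal - B s.toNNReal) ω) ≪ volume := by
    refine map_affine_absolutelyContinuous (hB.hasLaw_sub _ _) ?_ hν 0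
    rw [Ne, ← NNReal.coe_eq_zero, coe_nndist, dist_eq_zero]
    change ¬((r.toNNReal : ℝ) = (s.toNNReal : ℝ))
    rw [Real.coe_toNNReal _ hs.le, Real.coe_toNNReal _ hr.le]
    exact hsr.symm
  have hprod := (map_brownianCurve_absolutelyContinuous hB hν x hs).prod hac
  rw [← hmap] at hprod
  have hadd := measurePreserving_prod_add (volume : Measure ℝ) (volume : Measure ℝ)
  have h2 := hprod.map hadd.measurable
  rw [hadd.map_eq, Measure.map_map hadd.measurable ((hm s).prodMk hmU)] at h2
  have e : (fun ω ↦ (brownianCurve B ν x s ω, brownianCurve B ν x r ω)) =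
      (fun z : ℝ × ℝ ↦ (z.1, z.1 + z.2)) ∘
        fun ω ↦ (brownianCurve B ν x s ω, 0 + √ν * (B r.toNNReal - B s.toNNReal) ω) := by
    ext ω
    · rfl
    · simp only [brownianCurve, Function.comp, Pi.sub_apply]
      ring
  rw [e]
  exact h2

lemma timeMeasure_absolutelyContinuous (t : ℝ) : timeMeasure t ≪ volume :=
  Measure.absolutelyContinuous_of_le Measure.restrict_le_self

lemma ae_pos_timeMeasure (t : ℝ) : ∀ᵐ s ∂(timeMeasure t), 0 < s := by
  filter_upwards [ae_restrict_mem (measurableSet_Ioc (a := (0 : ℝ)) (b := t))] with s hs using hs.1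

/-- Excludes the times at which the law of the pair degenerates: time zero and the diagonal. -/
lemma ae_ne_timeMeasure_prod (t : ℝ) :
    ∀ᵐ q ∂((timeMeasure t).prod (timeMeasure t)), 0 < q.1 ∧ 0 < q.2 ∧ q.1 ≠ q.2 := by
  refine (Measure.quasiMeasurePreserving_fst.ae (ae_pos_timeMeasure t)).and
    ((Measure.quasiMeasurePreserving_snd.ae (ae_pos_timeMeasure t)).and ?_)
  have hd : MeasurableSet {q : ℝ × ℝ | q.1 ≠ q.2} :=
    (measurableSet_eq_fun measurable_fst measurable_snd).compl
  rw [Measure.ae_prod_iff_ae_ae hd]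
  refine Eventually.of_forall fun s ↦ (timeMeasure_absolutelyContinuous t).ae_le ?_
  filter_upwards [Measure.ae_ne volume s] with r hr using hr.symm

lemma map_time_brownianCurve (hB : IsPreBrownianReal B P') (hBc : ∀ ω, Continuous fun s ↦ B s ω)
    (hBm : ∀ s, Measurable (B s)) {ν : ℝ} (hν : 0 < ν) (x t : ℝ) :
    (P'.prod (timeMeasure t)).map (fun p ↦ (p.2, brownianCurve B ν x p.2 p.1)) ≪
      (volume : Measure (ℝ × ℝ)) := by
  have hP := hB.isGaussianProcess.isProbabilityMeasure
  refine map_prodMk_absolutelyContinuous (timeMeasure_absolutelyContinuous t)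
    (isRandomCurve_brownian hBc hBm ν x).measurable_uncurry ?_
  filter_upwards [ae_pos_timeMeasure t] with s hs
  exact map_brownianCurve_absolutelyContinuous hB hν x hs

lemma measurable_pair_curve {E : Type*} [NormedAddCommGroup E] [NormedSpace ℝ E] [MeasureSpace E]
    [BorelSpace E] [SecondCountableTopology E] {γ : ℝ → Ω' → E} (hγ : IsRandomCurve γ) :
    Measurable fun p : Ω' × (ℝ × ℝ) ↦ (γ p.2.1 p.1, γ p.2.2 p.1) :=
  (hγ.measurable_uncurry.comp (measurable_fst.prodMk (measurable_fst.comp measurable_snd))).prodMk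
    (hγ.measurable_uncurry.comp (measurable_fst.prodMk (measurable_snd.comp measurable_snd)))

lemma map_time_brownianCurve_pair (hB : IsPreBrownianReal B P')
    (hBc : ∀ ω, Continuous fun s ↦ B s ω)
    (hBm : ∀ s, Measurable (B s)) {ν : ℝ} (hν : 0 < ν) (x t : ℝ) :
    (P'.prod ((timeMeasure t).prod (timeMeasure t))).map
      (fun p ↦ (p.2, (brownianCurve B ν x p.2.1 p.1, brownianCurve B ν x p.2.2 p.1))) ≪
      (volume : Measure ((ℝ × ℝ) × (ℝ × ℝ))) := by
  have hP := hB.isGaussianProcess.isProbabilityMeasure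
  refine map_prodMk_absolutelyContinuous
    (b := fun (q : ℝ × ℝ) ω ↦ (brownianCurve B ν x q.1 ω, brownianCurve B ν x q.2 ω))
    ((timeMeasure_absolutelyContinuous t).prod (timeMeasure_absolutelyContinuous t))
    (measurable_pair_curve (isRandomCurve_brownian hBc hBm ν x)) ?_
  filter_upwards [ae_ne_timeMeasure_prod t] with q hq
  exact map_brownianCurve_pair_absolutelyContinuous hB hBm hν x hq.1 hq.2.1 hq.2.2

/-- Obtained from the law of time and position by forgetting time: the preimage of a Lebesgue null
set under the projection is null. -/
lemma map_steady (hB : IsPreBrownianReal B P') (hBc : ∀ ω, Continuous fun s ↦ B s ω)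
    (hBm : ∀ s, Measurable (B s)) {ν : ℝ} (hν : 0 < ν) (x t : ℝ) :
    (P'.prod (timeMeasure t)).map (fun p ↦ brownianCurve B ν x p.2 p.1) ≪ volume := by
  have h := (map_time_brownianCurve hB hBc hBm hν x t).map measurable_snd
  rw [Measure.map_map measurable_snd (measurable_snd.prodMk
    (isRandomCurve_brownian hBc hBm ν x).measurable_uncurry)] at h
  exact h.trans Measure.quasiMeasurePreserving_snd.absolutelyContinuous

lemma map_steady₂ (hB : IsPreBrownianReal B P') (hBc : ∀ ω, Continuous fun s ↦ B s ω)
    (hBm : ∀ s, Measurable (B s)) {ν : ℝ} (hν : 0 < ν) (x t : ℝ) :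
    (P'.prod ((timeMeasure t).prod (timeMeasure t))).map
      (fun p ↦ (brownianCurve B ν x p.2.1 p.1, brownianCurve B ν x p.2.2 p.1)) ≪ volume := by
  have h := (map_time_brownianCurve_pair hB hBc hBm hν x t).map measurable_snd
  rw [Measure.map_map measurable_snd (measurable_snd.prodMk
    (measurable_pair_curve (isRandomCurve_brownian hBc hBm ν x)))] at h
  exact h.trans Measure.quasiMeasurePreserving_snd.absolutelyContinuous

lemma measurePreserving_reverse (t : ℝ) :
    MeasurePreserving (fun q : ℝ × ℝ ↦ (q.1, t - q.2)) volume volume :=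
  (MeasurePreserving.id (volume : Measure ℝ)).prod (Measure.measurePreserving_sub_left volume t)

/-- Here time is kept: swapping the coordinates and reversing `s ↦ t - s` preserves Lebesgue
measure, hence absolute continuity. -/
lemma map_unsteady (hB : IsPreBrownianReal B P') (hBc : ∀ ω, Continuous fun s ↦ B s ω)
    (hBm : ∀ s, Measurable (B s)) {ν : ℝ} (hν : 0 < ν) (x t : ℝ) :
    (P'.prod (timeMeasure t)).map (fun p ↦ (brownianCurve B ν x p.2 p.1, t - p.2)) ≪ volume := by
  have hs : MeasurePreserving (Prod.swap : ℝ × ℝ → ℝ × ℝ) volume volume :=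
    Measure.measurePreserving_swap
  have hr := (measurePreserving_reverse t).comp hs
  have h := (map_time_brownianCurve hB hBc hBm hν x t).map hr.measurable
  rw [Measure.map_map hr.measurable (measurable_snd.prodMk
    (isRandomCurve_brownian hBc hBm ν x).measurable_uncurry), hr.map_eq] at h
  exact h

lemma map_unsteady₂ (hB : IsPreBrownianReal B P') (hBc : ∀ ω, Continuous fun s ↦ B s ω)
    (hBm : ∀ s, Measurable (B s)) {ν : ℝ} (hν : 0 < ν) (x t : ℝ) :
    (P'.prod ((timeMeasure t).prod (timeMeasure t))).map
      (fun p ↦ ((brownianCurve B ν x p.2.1 p.1, t - p.2.1),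
        (brownianCurve B ν x p.2.2 p.1, t - p.2.2))) ≪ volume := by
  have hr : MeasurePreserving (fun q : (ℝ × ℝ) × (ℝ × ℝ) ↦
      ((q.2.1, t - q.1.1), (q.2.2, t - q.1.2))) volume volume :=
    ((measurePreserving_reverse t).prod (measurePreserving_reverse t)).comp
      measurePreserving_prod_prod_comm
  have h := (map_time_brownianCurve_pair hB hBc hBm hν x t).map hr.measurable
  rw [Measure.map_map hr.measurable (measurable_snd.prodMk
    (measurable_pair_curve (isRandomCurve_brownian hBc hBm ν x))), hr.map_eq] at h
  exact h

end Brownian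


/-! ### One step of the product formula -/

section OneStep

/-- Second-order Taylor estimate with the modulus of continuity of the second derivative. -/
lemma norm_taylor_two_le {f f' f'' : ℝ → ℂ} (hf : ∀ z, HasDerivAt f (f' z) z)
    (hf' : ∀ z, HasDerivAt f' (f'' z) z) {y r ε d : ℝ}
    (hε : ∀ z, |z - y| ≤ r → ‖f'' z - f'' y‖ ≤ ε) (hd : |d| ≤ r) :
    ‖f (y + d) - f y - d * f' y - (d ^ 2 / 2 : ℝ) * f'' y‖ ≤ ε * d ^ 2 := by
  have hconv : Convex ℝ (Metric.closedBall y |d|) := convex_closedBall _ _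
  have hy : y ∈ Metric.closedBall y |d| := Metric.mem_closedBall_self (abs_nonneg _)
  have hyd : y + d ∈ Metric.closedBall y |d| := by simp
  have hmem : ∀ z ∈ Metric.closedBall y |d|, |z - y| ≤ |d| := fun z hz ↦ by
    rwa [Metric.mem_closedBall, Real.dist_eq] at hz
  have hε0 : 0 ≤ ε := (norm_nonneg _).trans (hε y (by simpa using (abs_nonneg d).trans hd))
  -- The mean value inequality is applied twice, first to `f'` and then to `f`, each time with the
  -- Taylor polynomial subtracted.
  have h1 : ∀ z ∈ Metric.closedBall y |d|, ‖f' z - f' y - (z - y : ℝ) * f'' y‖ ≤ ε * |d| := by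
    intro z hz
    have hder (w : ℝ) : HasDerivAt (fun w ↦ f' w - (w - y : ℝ) * f'' y) (f'' w - f'' y) w := by
      have h2 : HasDerivAt (fun w : ℝ ↦ ((w - y : ℝ) : ℂ)) ((1 : ℝ) : ℂ) w :=
        ((hasDerivAt_id w).sub_const y).ofReal_comp
      exact ((hf' w).sub (h2.mul_const (f'' y))).congr_deriv (by simp)
    have h3 := hconv.norm_image_sub_le_of_norm_hasDerivWithin_le
      (fun w _ ↦ (hder w).hasDerivWithinAt) (fun w hw ↦ hε w ((hmem w hw).trans hd)) hy hz
    simp only [sub_self, Complex.ofReal_zero, zero_mul, sub_zero] at h3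
    rw [sub_right_comm]
    exact h3.trans (mul_le_mul_of_nonneg_left (hmem z hz) hε0)
  have hder (w : ℝ) : HasDerivAt
      (fun w ↦ f w - (w - y : ℝ) * f' y - (((w - y) ^ 2 / 2 : ℝ) : ℂ) * f'' y)
      (f' w - f' y - (w - y : ℝ) * f'' y) w := by
    have h2 : HasDerivAt (fun w : ℝ ↦ ((w - y : ℝ) : ℂ)) ((1 : ℝ) : ℂ) w :=
      ((hasDerivAt_id w).sub_const y).ofReal_comp
    have h3 : HasDerivAt (fun w : ℝ ↦ (((w - y) ^ 2 / 2 : ℝ) : ℂ)) ((w - y : ℝ) : ℂ) w := by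
      refine HasDerivAt.ofReal_comp ?_
      refine ((((hasDerivAt_id w).sub_const y).pow 2).div_const 2).congr_deriv ?_
      simp
    exact (((hf w).sub (h2.mul_const (f' y))).sub (h3.mul_const (f'' y))).congr_deriv (by simp)
  have h4 := hconv.norm_image_sub_le_of_norm_hasDerivWithin_le
    (fun w _ ↦ (hder w).hasDerivWithinAt) h1 hy hyd
  simp only [sub_self, Complex.ofReal_zero, zero_mul, sub_zero, add_sub_cancel_left, ne_eq,
    OfNat.ofNat_ne_zero, not_false_eq_true, zero_pow, zero_div] at h4
  have e : f (y + d) - f y - d * f' y - (d ^ 2 / 2 : ℝ) * f'' y =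
      f (y + d) - d * f' y - (d ^ 2 / 2 : ℝ) * f'' y - f y := by ring
  rw [e]
  refine h4.trans (le_of_eq ?_)
  rw [Real.norm_eq_abs, mul_assoc, ← pow_two, sq_abs]

/-- Second-order expansion of a bounded function with a global quartic remainder. -/
lemma norm_taylor_global_le {f f' f'' : ℝ → ℂ} {y r ε M A₁ A₂ : ℝ} (hr0 : 0 < r)
    (hf : ∀ z, HasDerivAt f (f' z) z) (hf' : ∀ z, HasDerivAt f' (f'' z) z) (hM : ∀ z, ‖f z‖ ≤ M)
    (h1 : ‖f' y‖ ≤ A₁) (h2 : ‖f'' y‖ ≤ A₂) (hε : ∀ z, |z - y| ≤ r → ‖f'' z - f'' y‖ ≤ ε) (d : ℝ) :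
    ‖f (y + d) - f y - d * f' y - (d ^ 2 / 2 : ℝ) * f'' y‖ ≤
      ε * d ^ 2 + (2 * M / r ^ 4 + A₁ / r ^ 3 + A₂ / (2 * r ^ 2)) * d ^ 4 := by
  have hM0 : 0 ≤ M := (norm_nonneg _).trans (hM 0)
  have hA₁ : 0 ≤ A₁ := (norm_nonneg _).trans h1
  have hA₂ : 0 ≤ A₂ := (norm_nonneg _).trans h2
  have hε0 : 0 ≤ ε := (norm_nonneg _).trans (hε y (by simpa using hr0.le))
  rcases le_or_gt |d| r with hdr | hdr
  · exact (norm_taylor_two_le hf hf' hε hdr).trans (le_add_of_nonneg_right (by positivity))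
  have hb0 : ‖f (y + d) - f y‖ ≤ 2 * M := by
    refine (norm_sub_le _ _).trans ?_
    linarith [hM (y + d), hM y]
  -- For large displacements each term is bounded separately, and powers of `|d| / r ≥ 1` raise it
  -- to order `d ^ 4`. The Gaussian average of that remainder is of order `h ^ 2`, although
  -- increments are unbounded.
  have hq : 1 ≤ |d| / r := by rw [le_div_iff₀ hr0]; linarith
  have hd4 : |d| ^ 4 = d ^ 4 := by rw [← abs_pow]; exact abs_of_nonneg (by positivity)
  have p1 : 2 * M ≤ 2 * M / r ^ 4 * d ^ 4 := by
    have : 2 * M / r ^ 4 * d ^ 4 = 2 * M * (|d| / r) ^ 4 := by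
      rw [← hd4, div_pow]; ring
    rw [this]
    exact le_mul_of_one_le_right (by positivity) (one_le_pow₀ hq)
  have p2 : |d| * A₁ ≤ A₁ / r ^ 3 * d ^ 4 := by
    have : A₁ / r ^ 3 * d ^ 4 = |d| * A₁ * (|d| / r) ^ 3 := by
      rw [← hd4, div_pow]; ring
    rw [this]
    exact le_mul_of_one_le_right (by positivity) (one_le_pow₀ hq)
  have p3 : d ^ 2 / 2 * A₂ ≤ A₂ / (2 * r ^ 2) * d ^ 4 := by
    have : A₂ / (2 * r ^ 2) * d ^ 4 = d ^ 2 / 2 * A₂ * (|d| / r) ^ 2 := by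
      rw [div_pow, sq_abs]; field_simp
    rw [this]
    exact le_mul_of_one_le_right (by positivity) (one_le_pow₀ hq)
  have n1 : ‖(d : ℂ) * f' y‖ ≤ |d| * A₁ := by
    rw [norm_mul, Complex.norm_real, Real.norm_eq_abs]
    exact mul_le_mul_of_nonneg_left h1 (abs_nonneg _)
  have n2 : ‖((d ^ 2 / 2 : ℝ) : ℂ) * f'' y‖ ≤ d ^ 2 / 2 * A₂ := by
    rw [norm_mul, Complex.norm_real, Real.norm_of_nonneg (by positivity)]
    exact mul_le_mul_of_nonneg_left h2 (by positivity)
  refine (norm_sub_le _ _).trans ((add_le_add_left (norm_sub_le _ _) _).trans ?_)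
  have h0 : 0 ≤ ε * d ^ 2 := by positivity
  rw [add_mul, add_mul]
  linarith

/-- Fourth moment of the standard Gaussian. -/
noncomputable def gaussianMoment₄ : ℝ := ∫ z, z ^ 4 ∂(gaussianReal 0 1)

lemma integrable_pow_gaussian (n : ℕ) : Integrable (fun z : ℝ ↦ z ^ n) (gaussianReal 0 1) := by
  rcases Nat.eq_zero_or_pos n with rfl | hn
  · simp
  have h := memLp_id_gaussianReal (μ := 0) (v := 1) n
  have h1 := h.integrable_norm_pow hn.ne'
  refine h1.congr' (by fun_prop) (Eventually.of_forall fun z ↦ ?_)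
  simp

lemma integral_sq_gaussian : ∫ z, z ^ 2 ∂(gaussianReal 0 1) = 1 := by
  have h := variance_id_gaussianReal (μ := 0) (v := 1)
  rw [variance_eq_integral (by fun_prop)] at h
  simpa using h

lemma gaussianMoment₄_nonneg : 0 ≤ gaussianMoment₄ :=
  integral_nonneg fun z ↦ by positivity

/-- Gaussian average of a function with a second-order expansion. -/
lemma norm_gaussian_average_sub_le {f : ℝ → ℂ} (hf : Continuous f) {M : ℝ} (hM : ∀ z, ‖f z‖ ≤ M)
    {y ε K σ : ℝ} {a b : ℂ}
    (h : ∀ d : ℝ, ‖f (y + d) - f y - d * a - (d ^ 2 / 2 : ℝ) * b‖ ≤ ε * d ^ 2 + K * d ^ 4) :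
    ‖(∫ z, f (y + σ * z) ∂(gaussianReal 0 1)) - f y - (σ ^ 2 / 2 : ℝ) * b‖ ≤
      ε * σ ^ 2 + K * σ ^ 4 * gaussianMoment₄ := by
  have i0 : Integrable (fun z ↦ f (y + σ * z)) (gaussianReal 0 1) :=
    Integrable.of_bound (C := M) (by fun_prop) (Eventually.of_forall fun z ↦ hM _)
  have i1 : Integrable (fun z : ℝ ↦ ((σ * z : ℝ) : ℂ) * a) (gaussianReal 0 1) := by
    have := (((integrable_pow_gaussian 1).const_mul σ).ofReal (𝕜 := ℂ)).mul_const a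
    simpa using this
  have i2 : Integrable (fun z : ℝ ↦ (((σ * z) ^ 2 / 2 : ℝ) : ℂ) * b) (gaussianReal 0 1) := by
    have := (((integrable_pow_gaussian 2).const_mul (σ ^ 2 / 2)).ofReal (𝕜 := ℂ)).mul_const b
    refine this.congr (Eventually.of_forall fun z ↦ ?_)
    have e : σ ^ 2 / 2 * z ^ 2 = (σ * z) ^ 2 / 2 := by ring
    dsimp only
    rw [e]
    rfl
  have e1 : ∫ z : ℝ, ((σ * z : ℝ) : ℂ) * a ∂(gaussianReal 0 1) = 0 := by
    rw [integral_mul_const, integral_complex_ofReal, integral_const_mul,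
      integral_id_gaussianReal]
    simp
  have e2 : ∫ z : ℝ, (((σ * z) ^ 2 / 2 : ℝ) : ℂ) * b ∂(gaussianReal 0 1) = (σ ^ 2 / 2 : ℝ) * b := by
    rw [integral_mul_const, integral_complex_ofReal]
    have : ∀ z : ℝ, (σ * z) ^ 2 / 2 = σ ^ 2 / 2 * z ^ 2 := fun z ↦ by ring
    simp_rw [this]
    rw [integral_const_mul, integral_sq_gaussian, mul_one]
  have i01 : Integrable (fun z ↦ f (y + σ * z) - f y) (gaussianReal 0 1) :=
    i0.sub (integrable_const _)
  have i012 : Integrable (fun z : ℝ ↦ f (y + σ * z) - f y - ((σ * z : ℝ) : ℂ) * a)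
    (gaussianReal 0 1) := i01.sub i1
  -- The first-order term averages to zero and the second moment is one, so only the remainder is
  -- left under the integral.
  have key : (∫ z, f (y + σ * z) ∂(gaussianReal 0 1)) - f y - (σ ^ 2 / 2 : ℝ) * b =
      ∫ z : ℝ, f (y + σ * z) - f y - ((σ * z : ℝ) : ℂ) * a - (((σ * z) ^ 2 / 2 : ℝ) : ℂ) * b
        ∂(gaussianReal 0 1) := by
    rw [integral_sub i012 i2, integral_sub i01 i1, integral_sub i0 (integrable_const _), e1, e2]
    simp
  rw [key]
  have i2' := (integrable_pow_gaussian 2).const_mul (ε * σ ^ 2)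
  have i4' := (integrable_pow_gaussian 4).const_mul (K * σ ^ 4)
  refine (norm_integral_le_of_norm_le (i2'.add i4') (Eventually.of_forall fun z ↦ ?_)).trans
    (le_of_eq ?_)
  · refine (h (σ * z)).trans (le_of_eq ?_)
    simp only [Pi.add_apply]
    ring
  · have := integral_add i2' i4'
    simp only [Pi.add_apply]
    rw [this, integral_const_mul, integral_const_mul, integral_sq_gaussian, mul_one]
    rfl

lemma norm_time_increment_le {f f' : ℝ → ℂ} {τ h ε : ℝ} (hh : 0 ≤ h)
    (hf : ∀ s ∈ Icc (τ - h) τ, HasDerivAt f (f' s) s)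
    (hε : ∀ s ∈ Icc (τ - h) τ, ‖f' s - f' τ‖ ≤ ε) :
    ‖f (τ - h) - f τ + h * f' τ‖ ≤ ε * h := by
  have hder (s : ℝ) (hs : s ∈ Icc (τ - h) τ) :
      HasDerivAt (fun s ↦ f s - (s : ℂ) * f' τ) (f' s - f' τ) s := by
    have h2 : HasDerivAt (fun w : ℝ ↦ (w : ℂ)) ((1 : ℝ) : ℂ) s := (hasDerivAt_id s).ofReal_comp
    exact ((hf s hs).sub (h2.mul_const (f' τ))).congr_deriv (by simp)
  have h1 := (convex_Icc (τ - h) τ).norm_image_sub_le_of_norm_hasDerivWithin_le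
    (fun s hs ↦ (hder s hs).hasDerivWithinAt) hε (right_mem_Icc.2 (by linarith))
    (left_mem_Icc.2 (by linarith))
  have e : f (τ - h) - f τ + h * f' τ =
      f (τ - h) - ((τ - h : ℝ) : ℂ) * f' τ - (f τ - (τ : ℂ) * f' τ) := by push_cast; ring
  rw [e]
  refine h1.trans (le_of_eq ?_)
  rw [Real.norm_eq_abs, sub_sub_cancel_left, abs_neg, abs_of_nonneg hh]

/-- Algebra of one step of the product formula. -/
lemma norm_one_step_le {c U q J a : ℂ} {h C M ε₁ : ℝ} (hh : 0 ≤ h)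
    (hc : ‖c‖ ≤ C) (hU : ‖U‖ ≤ M) (hhC : h * C ≤ 1) (ha : a = Complex.exp (h * c))
    (hcre : c.re ≤ 0) (hq : q = -c * U) (hJ : ‖J - U - h * q‖ ≤ ε₁ * h) :
    ‖a * J - U‖ ≤ (3 * C ^ 2 * M) * h ^ 2 + ε₁ * h := by
  have hC : 0 ≤ C := (norm_nonneg _).trans hc
  have hM : 0 ≤ M := (norm_nonneg _).trans hU
  have hw : ‖(h : ℂ) * c‖ ≤ h * C := by
    rw [norm_mul, Complex.norm_real, Real.norm_of_nonneg hh]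
    exact mul_le_mul_of_nonneg_left hc hh
  have hρ : ‖a - 1 - h * c‖ ≤ (h * C) ^ 2 := by
    rw [ha]
    exact (Complex.norm_exp_sub_one_sub_id_le (hw.trans hhC)).trans
      (pow_le_pow_left₀ (norm_nonneg _) hw 2)
  have ha1 : ‖a‖ ≤ 1 := by
    rw [ha, Complex.norm_exp]
    refine Real.exp_le_one_iff.2 ?_
    rw [Complex.re_ofReal_mul]
    exact mul_nonpos_of_nonneg_of_nonpos hh hcre
  -- By the equation `J ≈ U + h q = (1 - h c) U`, and `exp(h c) (1 - h c) = 1 + O(h²)`. In the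
  -- constant `3 C² M`, two units come from the exponential remainder and one from `(h c)² U`.
  have e : a * J - U = a * (J - U - h * q) + (a - 1 - h * c) * (U - h * c * U) -
      (h * c) * (h * c) * U := by rw [hq]; ring
  have h2 : ‖U - h * c * U‖ ≤ 2 * M := by
    refine (norm_sub_le _ _).trans ?_
    rw [norm_mul]
    have : ‖(h : ℂ) * c‖ * ‖U‖ ≤ 1 * M :=
      mul_le_mul (hw.trans hhC) hU (norm_nonneg _) zero_le_one
    linarith
  rw [e]
  refine (norm_sub_le _ _).trans ((add_le_add_left (norm_add_le _ _) _).trans ?_)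
  have h3 : ‖a * (J - U - h * q)‖ ≤ ε₁ * h := by
    rw [norm_mul]
    exact (mul_le_of_le_one_left (norm_nonneg _) ha1).trans hJ
  have h4 : ‖(a - 1 - h * c) * (U - h * c * U)‖ ≤ (h * C) ^ 2 * (2 * M) := by
    rw [norm_mul]
    exact mul_le_mul hρ h2 (norm_nonneg _) (by positivity)
  have h5 : ‖(h * c) * (h * c) * U‖ ≤ (h * C) * (h * C) * M := by
    rw [norm_mul, norm_mul]
    exact mul_le_mul (mul_le_mul hw hw (norm_nonneg _) (by positivity)) hU (norm_nonneg _)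
      (by positivity)
  nlinarith

set_option maxHeartbeats 1000000 in
/-- One step of the product formula, locally uniformly. -/
lemma norm_productFormula_step_le {ν ξ : ℝ} {v : ℝ → ℝ → ℝ} {g : ℝ → ℂ} {u : ℝ → ℝ → ℂ} (hν : 0 < ν)
    (hv : Continuous fun p : ℝ × ℝ ↦ v p.1 p.2) (hu : IsBoundedClassicalSolution ν ξ v g u)
    (R : ℝ) {η : ℝ} (hη : 0 < η) (t : ℝ) {ε : ℝ} (hε : 0 < ε) :
    ∃ h₀ > 0, ∀ h, 0 < h → h < h₀ → ∀ y, |y| ≤ R → ∀ τ, η ≤ τ - h → τ ≤ t →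
      ‖Complex.exp (-(ν / 2) * ξ ^ 2 * h - Complex.I * ξ * (h * v y τ)) *
        (∫ z, u (y + √ν * (√h * z)) (τ - h) ∂(gaussianReal 0 1)) - u y τ‖ ≤ ε * h := by
  obtain ⟨M, hM⟩ := hu.bounded
  obtain ⟨ut, ux, uxx, hutc, huxc, huxxc, heq⟩ := hu.equation
  -- The margin 1 in space holds the displacements `r ≤ 1`; times below `η` are excluded since the
  -- derivatives are continuous only for positive times.
  set S : Set (ℝ × ℝ) := Icc (-(R + 1)) (R + 1) ×ˢ Icc η t with hS
  have hSc : IsCompact S := isCompact_Icc.prod isCompact_Icc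
  have hSpos : S ⊆ {p : ℝ × ℝ | 0 < p.2} := fun p hp ↦ hη.trans_le hp.2.1
  obtain ⟨A₁, hA₁⟩ := hSc.exists_bound_of_continuousOn (huxc.mono hSpos)
  obtain ⟨A₂, hA₂⟩ := hSc.exists_bound_of_continuousOn (huxxc.mono hSpos)
  obtain ⟨V, hV⟩ := hSc.exists_bound_of_continuousOn hv.continuousOn
  -- The shares of `ε₁ h` are `ν` from the spatial Taylor remainder, `1` from the time increment and
  -- `ν / 2` from moving `uxx` from `τ - h` to `τ`. Together they use half of `ε`.
  set ε₁ : ℝ := ε / (2 * (1 + 3 * ν / 2)) with hε₁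
  have hε₁0 : 0 < ε₁ := by positivity
  obtain ⟨r₁, hr₁, hut⟩ := Metric.uniformContinuousOn_iff_le.1
    (hSc.uniformContinuousOn_of_continuous (hutc.mono hSpos)) ε₁ hε₁0
  obtain ⟨r₂, hr₂, huxx⟩ := Metric.uniformContinuousOn_iff_le.1
    (hSc.uniformContinuousOn_of_continuous (huxxc.mono hSpos)) ε₁ hε₁0
  set r := min 1 (min r₁ r₂) with hr
  have hr0 : 0 < r := by positivity
  have hr1 : r ≤ 1 := min_le_left _ _
  have hrr₁ : r ≤ r₁ := (min_le_right _ _).trans (min_le_left _ _)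
  have hrr₂ : r ≤ r₂ := (min_le_right _ _).trans (min_le_right _ _)
  set K : ℝ := 2 * |M| / r ^ 4 + |A₁| / r ^ 3 + |A₂| / (2 * r ^ 2) with hK
  have hK0 : 0 ≤ K := by positivity
  set C : ℝ := ν / 2 * ξ ^ 2 + |ξ| * |V| with hC
  have hC0 : 0 ≤ C := by positivity
  set D : ℝ := 3 * C ^ 2 * |M| + K * ν ^ 2 * gaussianMoment₄ with hD
  have hD0 : 0 ≤ D := by have := gaussianMoment₄_nonneg; positivity
  -- The three bounds give `h ≤ r` for uniform continuity, `h C ≤ 1` for the exponential, and `D h ≤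
  -- ε / 2` for the terms of order `h ^ 2`.
  refine ⟨min r (min (1 / (C + 1)) (ε / (2 * (D + 1)))), by positivity, ?_⟩
  intro h hh hh₀ y hy τ hτη hτt
  have hhr : h ≤ r := hh₀.le.trans (min_le_left _ _)
  have hhC : h * C ≤ 1 := by
    have h1 : h ≤ 1 / (C + 1) := hh₀.le.trans ((min_le_right _ _).trans (min_le_left _ _))
    rw [le_div_iff₀ (by positivity)] at h1
    nlinarith
  have hhD : D * h ≤ ε / 2 := by
    have h1 : h ≤ ε / (2 * (D + 1)) := hh₀.le.trans ((min_le_right _ _).trans (min_le_right _ _))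
    rw [le_div_iff₀ (by positivity)] at h1
    nlinarith
  have hτ0 : 0 < τ - h := hη.trans_le hτη
  have hτ : 0 < τ := by linarith
  have hmem (z s : ℝ) (hz : |z - y| ≤ 1) (hs : s ∈ Icc (τ - h) τ) : (z, s) ∈ S := by
    have h1 := abs_le.1 hz
    have h2 := abs_le.1 hy
    exact ⟨⟨by linarith, by linarith⟩, ⟨by linarith [hs.1], by linarith [hs.2]⟩⟩
  have hsl : τ - h ∈ Icc (τ - h) τ := left_mem_Icc.2 (by linarith)
  have hsr : τ ∈ Icc (τ - h) τ := right_mem_Icc.2 (by linarith)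
  have hyS (s : ℝ) (hs : s ∈ Icc (τ - h) τ) : (y, s) ∈ S := hmem y s (by simp) hs
  have hcont : Continuous fun z ↦ u z (τ - h) := by
    have := hu.continuous.comp_continuous (f := fun z : ℝ ↦ (z, τ - h)) (by fun_prop)
      fun z ↦ hτ0.le
    exact this
  -- spatial average
  have hspace := norm_gaussian_average_sub_le (f := fun z ↦ u z (τ - h)) hcont
    (M := M) (fun z ↦ hM z _ hτ0.le) (y := y) (ε := ε₁) (K := K) (σ := √ν * √h)
    (a := ux y (τ - h)) (b := uxx y (τ - h)) fun d ↦ by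
      refine norm_taylor_global_le hr0 (fun z ↦ (heq z _ hτ0).2.1) (fun z ↦ (heq z _ hτ0).2.2.1)
        (fun z ↦ (hM z _ hτ0.le).trans (le_abs_self M))
        ((hA₁ _ (hyS _ hsl)).trans (le_abs_self _)) ((hA₂ _ (hyS _ hsl)).trans (le_abs_self _))
        (fun z hz ↦ ?_) d
      rw [← dist_eq_norm]
      refine huxx (z, τ - h) (hmem z _ (hz.trans hr1) hsl) (y, τ - h) (hyS _ hsl) ?_
      rw [Prod.dist_eq]
      simpa [Real.dist_eq, hr₂.le] using hz.trans hrr₂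
  have hσ2 : (√ν * √h) ^ 2 = ν * h := by
    rw [mul_pow, Real.sq_sqrt hν.le, Real.sq_sqrt hh.le]
  have hσ4 : (√ν * √h) ^ 4 = (ν * h) ^ 2 := by rw [← hσ2]; ring
  rw [hσ2, hσ4] at hspace
  -- time increment
  have htime := norm_time_increment_le (f := fun s ↦ u y s) (f' := fun s ↦ ut y s) (ε := ε₁) hh.le
    (fun s hs ↦ (heq y s (hτ0.trans_le hs.1)).1) fun s hs ↦ by
      rw [← dist_eq_norm]
      refine hut (y, s) (hyS s hs) (y, τ) (hyS τ hsr) ?_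
      rw [Prod.dist_eq]
      have : |s - τ| ≤ r₁ := by
        rw [abs_sub_comm, abs_of_nonneg (by linarith [hs.2])]
        linarith [hs.1]
      simpa [Real.dist_eq, hr₁.le] using this
  have huxx' : ‖uxx y (τ - h) - uxx y τ‖ ≤ ε₁ := by
    rw [← dist_eq_norm]
    refine huxx (y, τ - h) (hyS _ hsl) (y, τ) (hyS τ hsr) ?_
    rw [Prod.dist_eq]
    have : |h| ≤ r₂ := by rw [abs_of_pos hh]; linarith
    simpa [Real.dist_eq, hr₂.le] using this
  have hpde := (heq y τ hτ).2.2.2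
  set c : ℂ := -(ν / 2) * ξ ^ 2 - Complex.I * ξ * v y τ with hc
  have hcn : ‖c‖ ≤ C := by
    rw [hc]
    refine (norm_sub_le _ _).trans (add_le_add (le_of_eq ?_) ?_)
    · rw [show (-(ν / 2) * ξ ^ 2 : ℂ) = ((-(ν / 2 * ξ ^ 2) : ℝ) : ℂ) by push_cast; ring,
        Complex.norm_real, norm_neg, Real.norm_of_nonneg (by positivity)]
    · rw [norm_mul, norm_mul, Complex.norm_I, one_mul, Complex.norm_real, Complex.norm_real]
      exact mul_le_mul_of_nonneg_left ((hV _ (hyS τ hsr)).trans (le_abs_self _)) (norm_nonneg _)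
  have hcre : c.re ≤ 0 := by
    have : c = ((-(ν / 2 * ξ ^ 2) : ℝ) : ℂ) + ((-(ξ * v y τ) : ℝ) : ℂ) * Complex.I := by
      rw [hc]; push_cast; ring
    rw [this, Complex.add_re, Complex.ofReal_re, Complex.re_ofReal_mul, Complex.I_re, mul_zero,
      add_zero]
    exact neg_nonpos.2 (by positivity)
  set J := ∫ z, u (y + √ν * (√h * z)) (τ - h) ∂(gaussianReal 0 1) with hJ
  have hJ' : (∫ z, u (y + √ν * √h * z) (τ - h) ∂(gaussianReal 0 1)) = J := by
    simp only [hJ, mul_assoc]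
  rw [hJ'] at hspace
  have hfin := norm_one_step_le (c := c) (U := u y τ) (J := J)
    (a := Complex.exp (-(ν / 2) * ξ ^ 2 * h - Complex.I * ξ * (h * v y τ)))
    (q := (1 / 2) * ν * uxx y τ - ut y τ) (C := C) (M := |M|)
    (ε₁ := ε₁ * (1 + 3 * ν / 2) + K * ν ^ 2 * gaussianMoment₄ * h) hh.le hcn
    ((hM y τ hτ.le).trans (le_abs_self _)) hhC (by rw [hc]; congr 1; ring) hcre
    (by rw [hc]; linear_combination -hpde) (by
      have e : J - u y τ - h * ((1 / 2) * ν * uxx y τ - ut y τ) =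
          (J - u y (τ - h) - ((ν * h / 2 : ℝ) : ℂ) * uxx y (τ - h)) +
          (u y (τ - h) - u y τ + h * ut y τ) +
          ((ν * h / 2 : ℝ) : ℂ) * (uxx y (τ - h) - uxx y τ) := by push_cast; ring
      have h3 : ‖((ν * h / 2 : ℝ) : ℂ) * (uxx y (τ - h) - uxx y τ)‖ ≤ ν * h / 2 * ε₁ := by
        rw [norm_mul, Complex.norm_real, Real.norm_of_nonneg (by positivity)]
        exact mul_le_mul_of_nonneg_left huxx' (by positivity)
      rw [e]
      refine (norm_add_le _ _).trans ((add_le_add_left (norm_add_le _ _) _).trans ?_)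
      nlinarith)
  refine hfin.trans ?_
  have e1 : ε₁ * (1 + 3 * ν / 2) = ε / 2 := by rw [hε₁]; field_simp
  have e2 : (3 * C ^ 2 * |M|) * h ^ 2 +
      (ε₁ * (1 + 3 * ν / 2) + K * ν ^ 2 * gaussianMoment₄ * h) * h = (D * h + ε / 2) * h := by
    rw [e1, hD]; ring
  rw [e2]
  exact mul_le_mul_of_nonneg_right (by linarith) hh.le

end OneStep


/-! ### Markov property and the killed product formula -/

section FeynmanKac

variable {Ω' : Type*} [MeasurableSpace Ω'] {P' : Measure Ω'} {B : ℝ≥0 → Ω' → ℝ}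

/-- Extension by zero of a path on `[0, s]`. -/
noncomputable def extendPath (s : ℝ≥0) (b : Iic s → ℝ) (q : ℝ≥0) : ℝ :=
  if h : q ≤ s then b ⟨q, h⟩ else 0

lemma measurable_extendPath (s : ℝ≥0) : Measurable (extendPath s) := by
  refine measurable_pi_lambda _ fun q ↦ ?_
  by_cases h : q ≤ s
  · simp only [extendPath, h, dif_pos]
    exact measurable_pi_apply _
  · simp only [extendPath, h, dif_neg, not_false_eq_true]
    exact measurable_const

/-- Markov property of Brownian motion at a deterministic time, tested against functionals `G`
of the past. -/
lemma integral_mul_increment (hB : IsPreBrownianReal B P') (hBm : ∀ s, Measurable (B s))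
    {G : (ℝ≥0 → ℝ) → ℂ} (hG : Measurable G) {M₁ M₂ : ℝ} (hG₁ : ∀ b, ‖G b‖ ≤ M₁) {s : ℝ≥0}
    (hGs : ∀ b b' : ℝ≥0 → ℝ, (∀ q ≤ s, b q = b' q) → G b = G b') {f : ℝ → ℂ} (hf : Continuous f)
    (hfM : ∀ y, ‖f y‖ ≤ M₂) (x σ : ℝ) {h : ℝ} (hh : 0 ≤ h) :
    ∫ ω, G (fun q ↦ B q ω) * f (x + σ * B (s + h.toNNReal) ω) ∂P' =
      ∫ ω, G (fun q ↦ B q ω) *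
        (∫ z, f (x + σ * B s ω + σ * (√h * z)) ∂(gaussianReal 0 1)) ∂P' := by
  have hP := hB.isGaussianProcess.isProbabilityMeasure
  set Z : Ω' → (Iic s → ℝ) := fun ω q ↦ B q ω with hZ
  set Δ : Ω' → ℝ := fun ω ↦ B (s + h.toNNReal) ω - B s ω with hΔ
  have hZm : Measurable Z := measurable_pi_lambda _ fun q ↦ hBm _
  have hΔm : Measurable Δ := (hBm _).sub (hBm _)
  have hind : IndepFun Z Δ P' :=
    ((hB.indepFun_shift s).comp (measurable_pi_apply h.toNNReal) measurable_id).symm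
  have hlaw : P'.map Δ = (gaussianReal 0 1).map (fun z ↦ √h * z) := by
    have h1 := (hB.hasLaw_sub (s + h.toNNReal) s).map_eq
    rw [gaussianReal_map_const_mul]
    refine h1.trans ?_
    congr 1
    · simp
    · ext
      rw [coe_nndist, Real.dist_eq]
      change |((s + h.toNNReal : ℝ≥0) : ℝ) - (s : ℝ)| = √h ^ 2 * 1
      rw [NNReal.coe_add, add_sub_cancel_left, Real.coe_toNNReal _ hh, abs_of_nonneg hh,
        Real.sq_sqrt hh, mul_one]
  -- `G` sees only the path up to `s`, so it is a function of the restricted path, which is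
  -- independent of the later increment.
  have hGZ (ω : Ω') : G (fun q ↦ B q ω) = G (extendPath s (Z ω)) :=
    hGs _ _ fun q hq ↦ by simp [extendPath, hq, hZ]
  have hGe : Measurable fun b ↦ G (extendPath s b) := hG.comp (measurable_extendPath s)
  set k : (Iic s → ℝ) × ℝ → ℂ := fun p ↦
    G (extendPath s p.1) * f (x + σ * p.1 ⟨s, self_mem_Iic⟩ + σ * p.2) with hk
  have hkm : Measurable k := by
    refine (hGe.comp measurable_fst).mul (hf.measurable.comp ?_)
    have : Measurable fun p : (Iic s → ℝ) × ℝ ↦ p.1 ⟨s, self_mem_Iic⟩ :=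
      (measurable_pi_apply _).comp measurable_fst
    fun_prop
  have hkb (p : (Iic s → ℝ) × ℝ) : ‖k p‖ ≤ M₁ * M₂ := by
    simp only [hk]
    rw [norm_mul]
    exact mul_le_mul (hG₁ _) (hfM _) (norm_nonneg _) ((norm_nonneg _).trans (hG₁ 0))
  have e1 : ∫ ω, G (fun q ↦ B q ω) * f (x + σ * B (s + h.toNNReal) ω) ∂P' =
      ∫ ω, k (Z ω, Δ ω) ∂P' := by
    refine integral_congr_ae (Eventually.of_forall fun ω ↦ ?_)
    simp only [hk, hGZ ω, hZ, hΔ]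
    congr 2
    ring
  have hpm := (indepFun_iff_map_prod_eq_prod_map_map hZm.aemeasurable hΔm.aemeasurable).1 hind
  rw [e1, ← integral_map (φ := fun ω ↦ (Z ω, Δ ω)) (hZm.prodMk hΔm).aemeasurable
    hkm.aestronglyMeasurable, hpm]
  have hfin1 : IsProbabilityMeasure (P'.map Z) := Measure.isProbabilityMeasure_map hZm.aemeasurable
  have hfin2 : IsProbabilityMeasure (P'.map Δ) := Measure.isProbabilityMeasure_map hΔm.aemeasurable
  have hki : Integrable k ((P'.map Z).prod (P'.map Δ)) :=
    Integrable.of_bound hkm.aestronglyMeasurable (M₁ * M₂) (Eventually.of_forall hkb)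
  rw [integral_prod _ hki, integral_map hZm.aemeasurable
    hki.integral_prod_left.aestronglyMeasurable]
  refine integral_congr_ae (Eventually.of_forall fun ω ↦ ?_)
  dsimp only
  have hkω : Measurable fun y ↦ k (Z ω, y) := hkm.comp measurable_prodMk_left
  rw [hlaw, integral_map (by fun_prop) hkω.aestronglyMeasurable]
  simp only [hk, hGZ ω]
  rw [integral_const_mul]

/-- Product of the killed weights along the first `j` points of the grid of mesh `h`. -/
noncomputable def gridProduct (ν x h : ℝ) (χ : ℝ → ℝ) (a : ℕ → ℝ → ℂ) (j : ℕ) (b : ℝ≥0 → ℝ) : ℂ :=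
  ∏ i ∈ Finset.range j,
    ((χ (x + √ν * b ((i : ℝ) * h).toNNReal) : ℝ) : ℂ) * a i (x + √ν * b ((i : ℝ) * h).toNNReal)

/-- Probability weight of the paths that are not killed on the first `j` points of the grid. -/
noncomputable def gridSurvival (ν x h : ℝ) (χ : ℝ → ℝ) (j : ℕ) (b : ℝ≥0 → ℝ) : ℝ :=
  ∏ i ∈ Finset.range j, χ (x + √ν * b ((i : ℝ) * h).toNNReal)

lemma measurable_gridProduct (ν x h : ℝ) {χ : ℝ → ℝ} (hχ : Measurable χ) {a : ℕ → ℝ → ℂ}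
    (ha : ∀ i, Measurable (a i)) (j : ℕ) : Measurable (gridProduct ν x h χ a j) := by
  refine Finset.measurable_prod _ fun i _ ↦ ?_
  have h1 : Measurable fun b : ℝ≥0 → ℝ ↦ x + √ν * b ((i : ℝ) * h).toNNReal :=
    ((measurable_pi_apply _).const_mul _).const_add _
  exact (Complex.measurable_ofReal.comp (hχ.comp h1)).mul ((ha i).comp h1)

lemma measurable_gridSurvival (ν x h : ℝ) {χ : ℝ → ℝ} (hχ : Measurable χ) (j : ℕ) :
    Measurable (gridSurvival ν x h χ j) := by
  refine Finset.measurable_prod _ fun i _ ↦ ?_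
  have h1 : Measurable fun b : ℝ≥0 → ℝ ↦ x + √ν * b ((i : ℝ) * h).toNNReal :=
    ((measurable_pi_apply _).const_mul _).const_add _
  exact hχ.comp h1

lemma norm_gridProduct_le (ν x h : ℝ) {χ : ℝ → ℝ} (hχ0 : ∀ y, 0 ≤ χ y)
    {a : ℕ → ℝ → ℂ} (ha : ∀ i y, ‖a i y‖ ≤ 1) (j : ℕ) (b : ℝ≥0 → ℝ) :
    ‖gridProduct ν x h χ a j b‖ ≤ gridSurvival ν x h χ j b := by
  rw [gridProduct, gridSurvival, norm_prod]
  refine Finset.prod_le_prod (fun _ _ ↦ norm_nonneg _) fun i _ ↦ ?_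
  rw [norm_mul, Complex.norm_real, Real.norm_of_nonneg (hχ0 _)]
  exact mul_le_of_le_one_right (hχ0 _) (ha _ _)

lemma gridSurvival_mem (ν x h : ℝ) {χ : ℝ → ℝ} (hχ0 : ∀ y, 0 ≤ χ y) (hχ1 : ∀ y, χ y ≤ 1) (j : ℕ)
    (b : ℝ≥0 → ℝ) : 0 ≤ gridSurvival ν x h χ j b ∧ gridSurvival ν x h χ j b ≤ 1 :=
  ⟨Finset.prod_nonneg fun _ _ ↦ hχ0 _, Finset.prod_le_one (fun _ _ ↦ hχ0 _) fun _ _ ↦ hχ1 _⟩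

/-- Telescoping estimate for the killed product formula. -/
lemma norm_gridProduct_expectation_sub_le (hB : IsPreBrownianReal B P')
    (hBm : ∀ s, Measurable (B s)) {ν x h c M : ℝ} (hh : 0 ≤ h) (hc : 0 ≤ c) {χ : ℝ → ℝ}
    (hχ : Measurable χ) (hχ0 : ∀ y, 0 ≤ χ y) (hχ1 : ∀ y, χ y ≤ 1) {a : ℕ → ℝ → ℂ}
    (ham : ∀ i, Measurable (a i)) (ha : ∀ i y, ‖a i y‖ ≤ 1) {U : ℕ → ℝ → ℂ} {N : ℕ}
    (hU : ∀ i ≤ N, Continuous (U i)) (hUM : ∀ i ≤ N, ∀ y, ‖U i y‖ ≤ M)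
    (hstep : ∀ i < N, ∀ y, χ y ≠ 0 →
      ‖a i y * (∫ z, U (i + 1) (y + √ν * (√h * z)) ∂(gaussianReal 0 1)) - U i y‖ ≤ c)
    (j : ℕ) (hj : j ≤ N) :
    ‖(∫ ω, gridProduct ν x h χ a j (fun q ↦ B q ω) *
        U j (x + √ν * B ((j : ℝ) * h).toNNReal ω) ∂P') -
      ∫ ω, U 0 (x + √ν * B 0 ω) ∂P'‖ ≤
      j * c + M * (1 - ∫ ω, gridSurvival ν x h χ j (fun q ↦ B q ω) ∂P') := by
  have hP := hB.isGaussianProcess.isProbabilityMeasure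
  have hpath : Measurable fun ω (q : ℝ≥0) ↦ B q ω := measurable_pi_lambda _ hBm
  have hM : 0 ≤ M := (norm_nonneg _).trans (hUM 0 (Nat.zero_le _) 0)
  have hSi (j : ℕ) : Integrable (fun ω ↦ gridSurvival ν x h χ j (fun q ↦ B q ω)) P' :=
    Integrable.of_bound ((measurable_gridSurvival ν x h hχ j).comp hpath).aestronglyMeasurable 1
      (Eventually.of_forall fun ω ↦ by
        have := gridSurvival_mem ν x h hχ0 hχ1 j (fun q ↦ B q ω)
        rw [Real.norm_of_nonneg this.1]; exact this.2)
  have hW1 (j : ℕ) (b : ℝ≥0 → ℝ) : ‖gridProduct ν x h χ a j b‖ ≤ 1 :=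
    (norm_gridProduct_le ν x h hχ0 ha j b).trans (gridSurvival_mem ν x h hχ0 hχ1 j b).2
  induction j with
  | zero => simp [gridProduct, gridSurvival]
  | succ j ih =>
    have hjN : j < N := hj
    have ih := ih hjN.le
    set X : Ω' → ℝ := fun ω ↦ x + √ν * B ((j : ℝ) * h).toNNReal ω with hX
    have hXm : Measurable X := ((hBm _).const_mul _).const_add _
    set W : Ω' → ℂ := fun ω ↦ gridProduct ν x h χ a j (fun q ↦ B q ω) with hW
    have hWm : Measurable W := (measurable_gridProduct ν x h hχ ham j).comp hpath
    set I : ℝ → ℂ := fun y ↦ ∫ z, U (j + 1) (y + √ν * (√h * z)) ∂(gaussianReal 0 1) with hI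
    have hIm : Measurable I := by
      have : StronglyMeasurable fun p : ℝ × ℝ ↦ U (j + 1) (p.1 + √ν * (√h * p.2)) :=
        ((hU (j + 1) hj).comp (by fun_prop)).stronglyMeasurable
      exact this.integral_prod_right'.measurable
    have hsucc (b : ℝ≥0 → ℝ) : gridProduct ν x h χ a (j + 1) b = gridProduct ν x h χ a j b *
        (((χ (x + √ν * b ((j : ℝ) * h).toNNReal) : ℝ) : ℂ) *
          a j (x + √ν * b ((j : ℝ) * h).toNNReal)) := Finset.prod_range_succ _ _
    have hsuccS (b : ℝ≥0 → ℝ) : gridSurvival ν x h χ (j + 1) b = gridSurvival ν x h χ j b *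
        χ (x + √ν * b ((j : ℝ) * h).toNNReal) := Finset.prod_range_succ _ _
    have hmarkov := integral_mul_increment hB hBm (measurable_gridProduct ν x h hχ ham (j + 1))
      (hW1 (j + 1)) (s := ((j : ℝ) * h).toNNReal) (fun b b' hbb ↦ by
        refine Finset.prod_congr rfl fun i hi ↦ ?_
        have hij : (i : ℝ) ≤ j := by exact_mod_cast Nat.lt_succ_iff.1 (Finset.mem_range.1 hi)
        rw [hbb _ (Real.toNNReal_le_toNNReal (mul_le_mul_of_nonneg_right hij hh))])
      (hU (j + 1) hj) (hUM (j + 1) hj) x (√ν) hh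
    rw [← Real.toNNReal_add (by positivity) hh,
      show (j : ℝ) * h + h = ((j + 1 : ℕ) : ℝ) * h by push_cast; ring] at hmarkov
    rw [hmarkov]
    have hYi : Integrable (fun ω ↦ W ω * U j (X ω)) P' :=
      Integrable.of_bound (hWm.mul ((hU j hjN.le).measurable.comp hXm)).aestronglyMeasurable
        (1 * M) (Eventually.of_forall fun ω ↦ by
          rw [norm_mul]
          exact mul_le_mul (hW1 j _) (hUM j hjN.le _) (norm_nonneg _) zero_le_one)
    have hIM (y : ℝ) : ‖I y‖ ≤ M := by
      have := norm_integral_le_of_norm_le_const (μ := gaussianReal 0 1)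
        (f := fun z ↦ U (j + 1) (y + √ν * (√h * z)))
        (Eventually.of_forall fun z ↦ hUM (j + 1) hj (y + √ν * (√h * z)))
      simpa using this
    have hNi : Integrable (fun ω ↦ gridProduct ν x h χ a (j + 1) (fun q ↦ B q ω) * I (X ω)) P' :=
      Integrable.of_bound (((measurable_gridProduct ν x h hχ ham (j + 1)).comp hpath).mul
        (hIm.comp hXm)).aestronglyMeasurable
        (1 * M) (Eventually.of_forall fun ω ↦ by
          rw [norm_mul]
          exact mul_le_mul (hW1 (j + 1) _) (hIM _) (norm_nonneg _) zero_le_one)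
    have hdiff : ‖(∫ ω, gridProduct ν x h χ a (j + 1) (fun q ↦ B q ω) * I (X ω) ∂P') -
        ∫ ω, W ω * U j (X ω) ∂P'‖ ≤ c + M * ((∫ ω, gridSurvival ν x h χ j (fun q ↦ B q ω) ∂P') -
          ∫ ω, gridSurvival ν x h χ (j + 1) (fun q ↦ B q ω) ∂P') := by
      rw [← integral_sub hNi hYi, ← integral_sub (hSi j) (hSi (j + 1))]
      have hbi : Integrable (fun ω ↦ c + M * (gridSurvival ν x h χ j (fun q ↦ B q ω) -
          gridSurvival ν x h χ (j + 1) (fun q ↦ B q ω))) P' :=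
        (integrable_const _).add (((hSi j).sub (hSi (j + 1))).const_mul M)
      refine (norm_integral_le_of_norm_le hbi (Eventually.of_forall fun ω ↦ ?_)).trans
        (le_of_eq ?_)
      · have hχX0 := hχ0 (X ω)
        have hχX1 := hχ1 (X ω)
        have hS := gridSurvival_mem ν x h hχ0 hχ1 j (fun q ↦ B q ω)
        have hWS := norm_gridProduct_le ν x h hχ0 ha j (fun q ↦ B q ω)
        rw [hsucc, hsuccS]
        -- On the surviving part the one-step estimate applies, and it is needed only where `χ ≠ 0`.
        -- The killed part is bounded by `M` times the loss of survival weight, which telescopes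
        -- over the steps.
        have e : W ω * (((χ (X ω) : ℝ) : ℂ) * a j (X ω)) * I (X ω) - W ω * U j (X ω) =
            W ω * (((χ (X ω) : ℝ) : ℂ) * (a j (X ω) * I (X ω) - U j (X ω))) -
              W ω * (((1 - χ (X ω) : ℝ) : ℂ) * U j (X ω)) := by push_cast; ring
        change ‖W ω * (((χ (X ω) : ℝ) : ℂ) * a j (X ω)) * I (X ω) - W ω * U j (X ω)‖ ≤
          c + M * (gridSurvival ν x h χ j (fun q ↦ B q ω) -
            gridSurvival ν x h χ j (fun q ↦ B q ω) * χ (X ω))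
        rw [e]
        refine (norm_sub_le _ _).trans (add_le_add ?_ ?_)
        · rw [norm_mul, norm_mul, Complex.norm_real, Real.norm_of_nonneg hχX0]
          by_cases h0 : χ (X ω) = 0
          · rw [h0, zero_mul, mul_zero]; exact hc
          · have h1 := hstep j hjN (X ω) h0
            calc ‖W ω‖ * (χ (X ω) * ‖a j (X ω) * I (X ω) - U j (X ω)‖) ≤ 1 * (1 * c) :=
                  mul_le_mul (hW1 j _) (mul_le_mul hχX1 h1 (norm_nonneg _) zero_le_one)
                    (by positivity) zero_le_one
              _ = c := by ring
        · rw [norm_mul, norm_mul, Complex.norm_real, Real.norm_of_nonneg (by linarith)]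
          calc ‖W ω‖ * ((1 - χ (X ω)) * ‖U j (X ω)‖) ≤
                gridSurvival ν x h χ j (fun q ↦ B q ω) * ((1 - χ (X ω)) * M) :=
                mul_le_mul hWS (mul_le_mul_of_nonneg_left (hUM j hjN.le _) (by linarith))
                  (mul_nonneg (by linarith) (norm_nonneg _)) hS.1
            _ = _ := by ring
      · have h1 : Integrable (fun ω ↦ M * (gridSurvival ν x h χ j (fun q ↦ B q ω) -
          gridSurvival ν x h χ (j + 1) (fun q ↦ B q ω))) P' :=
          ((hSi j).sub (hSi (j + 1))).const_mul M
        rw [integral_add (integrable_const _) h1, integral_const_mul]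
        simp
    have htri := norm_sub_le_norm_sub_add_norm_sub
      (∫ ω, gridProduct ν x h χ a (j + 1) (fun q ↦ B q ω) * I (X ω) ∂P')
      (∫ ω, W ω * U j (X ω) ∂P') (∫ ω, U 0 (x + √ν * B 0 ω) ∂P')
    refine htri.trans ((add_le_add hdiff ih).trans (le_of_eq ?_))
    push_cast
    ring

end FeynmanKac


/-! ### Removal of the killing and the Feynman-Kac formula -/

section FeynmanKacLimit

variable {Ω' : Type*} [MeasurableSpace Ω'] {P' : Measure Ω'} {B : ℝ≥0 → Ω' → ℝ}

/-- Feynman-Kac formula between two positive times. -/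
lemma feynmanKac_of_pos (hB : IsPreBrownianReal B P') (hBc : ∀ ω, Continuous fun s ↦ B s ω)
    (hBm : ∀ s, Measurable (B s)) {ν ξ : ℝ} (hν : 0 < ν) {v : ℝ → ℝ → ℝ}
    (hv : Continuous fun p : ℝ × ℝ ↦ v p.1 p.2) {g : ℝ → ℂ} {u : ℝ → ℝ → ℂ}
    (hu : IsBoundedClassicalSolution ν ξ v g u) (x : ℝ) {t η : ℝ} (hη : 0 < η) (hηt : η < t) :
    u x t = ∫ ω, Complex.exp (-(ν / 2) * ξ ^ 2 * (t - η : ℝ) - Complex.I * ξ *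
      (∫ s in (0 : ℝ)..(t - η), v (brownianCurve B ν x s ω) (t - s) : ℝ)) *
        u (brownianCurve B ν x (t - η) ω) η ∂P' := by
  have hP := hB.isGaussianProcess.isProbabilityMeasure
  obtain ⟨M, hM⟩ := hu.bounded
  have hM0 : 0 ≤ M := (norm_nonneg _).trans (hM 0 0 le_rfl)
  set T := t - η with hT
  have hT0 : 0 < T := sub_pos.2 hηt
  have hucont (s : ℝ) (hs : 0 ≤ s) : Continuous fun y ↦ u y s :=
    hu.continuous.comp_continuous (f := fun z : ℝ ↦ (z, s)) (by fun_prop) fun _ ↦ hs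
  -- The number of steps is chosen after the radius `n`: the mesh must be fine enough for the local
  -- estimate on `[-n, n]` with error `h / (n + 1)` per step.
  have hex (n : ℕ) : ∃ N : ℕ, n < N ∧ ∀ y : ℝ, |y| ≤ (n : ℝ) →
      ∀ τ : ℝ, η ≤ τ - T / N → τ ≤ t →
      ‖Complex.exp (-(ν / 2) * ξ ^ 2 * (T / N : ℝ) - Complex.I * ξ * ((T / N : ℝ) * v y τ)) *
        (∫ z, u (y + √ν * (√(T / N) * z)) (τ - T / N) ∂(gaussianReal 0 1)) - u y τ‖ ≤
          1 / ((n : ℝ) + 1) * (T / N) := by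
    obtain ⟨h₀, hh₀, hstep⟩ := norm_productFormula_step_le hν hv hu n hη t
      (ε := 1 / ((n : ℝ) + 1)) (by positivity)
    obtain ⟨N₀, hN₀⟩ := exists_nat_gt (T / h₀)
    refine ⟨max N₀ (n + 1), by omega, ?_⟩
    have hNpos : (0 : ℝ) < (max N₀ (n + 1) : ℕ) := by
      exact_mod_cast lt_of_lt_of_le (Nat.succ_pos n) (le_max_right _ _)
    refine hstep _ (div_pos hT0 hNpos) ?_
    rw [div_lt_comm₀ hNpos hh₀]
    exact hN₀.trans_le (by exact_mod_cast le_max_left _ _)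
  choose N hnN hN using hex
  have hNpos (n : ℕ) : (0 : ℝ) < N n := by exact_mod_cast (Nat.zero_le n).trans_lt (hnN n)
  set h : ℕ → ℝ := fun n ↦ T / N n with hh
  have hh0 (n : ℕ) : 0 < h n := div_pos hT0 (hNpos n)
  have hNh (n : ℕ) : (N n : ℝ) * h n = T := by
    have := (hNpos n).ne'
    simp only [hh]; field_simp
  have hNtop : Tendsto N atTop atTop := tendsto_atTop_mono (fun n ↦ (hnN n).le) tendsto_id
  set χ : ℕ → ℝ → ℝ := fun n ↦ indicator {y : ℝ | |y| ≤ n} 1 with hχ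
  set a : ℕ → ℕ → ℝ → ℂ := fun n i y ↦ Complex.exp (-(ν / 2) * ξ ^ 2 * (h n : ℝ) -
    Complex.I * ξ * ((h n : ℝ) * v y (t - i * h n))) with ha
  set U : ℕ → ℕ → ℝ → ℂ := fun n i y ↦ u y (t - i * h n) with hU
  have hχm (n : ℕ) : Measurable (χ n) :=
    measurable_one.indicator (measurableSet_le measurable_id.norm measurable_const)
  have hχ0 (n : ℕ) (y : ℝ) : 0 ≤ χ n y := indicator_nonneg (fun _ _ ↦ zero_le_one) _
  have hχ1 (n : ℕ) (y : ℝ) : χ n y ≤ 1 := indicator_le_self' (fun _ _ ↦ zero_le_one) _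
  have hvc (s : ℝ) : Continuous fun y ↦ v y s := hv.comp (by fun_prop : Continuous fun y ↦ (y, s))
  have ham (n i : ℕ) : Measurable (a n i) := by
    have := hvc (t - i * h n)
    exact Continuous.measurable (by fun_prop)
  have hexp (H V : ℝ) (hH : 0 ≤ H) :
      ‖Complex.exp (-(ν / 2) * ξ ^ 2 * (H : ℝ) - Complex.I * ξ * V)‖ ≤ 1 := by
    rw [Complex.norm_exp]
    refine Real.exp_le_one_iff.2 ?_
    rw [show (-(ν / 2) * ξ ^ 2 * (H : ℝ) - Complex.I * ξ * V : ℂ) =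
      ((-(ν / 2 * ξ ^ 2 * H) : ℝ) : ℂ) + ((-(ξ * V) : ℝ) : ℂ) * Complex.I by push_cast; ring,
      Complex.add_re, Complex.ofReal_re, Complex.re_ofReal_mul, Complex.I_re, mul_zero, add_zero]
    exact neg_nonpos.2 (by positivity)
  have ha1 (n i : ℕ) (y : ℝ) : ‖a n i y‖ ≤ 1 := by
    have := hexp (h n) (h n * v y (t - i * h n)) (hh0 n).le
    rwa [Complex.ofReal_mul] at this
  have htime (n i : ℕ) (hi : i ≤ N n) : η ≤ t - i * h n := by
    have h1 : (i : ℝ) * h n ≤ N n * h n :=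
      mul_le_mul_of_nonneg_right (by exact_mod_cast hi) (hh0 n).le
    rw [hNh] at h1
    linarith
  have hbound (n : ℕ) := norm_gridProduct_expectation_sub_le hB hBm (ν := ν) (x := x)
    (c := 1 / ((n : ℝ) + 1) * h n) (M := M) (hh0 n).le
    (mul_nonneg (by positivity) (hh0 n).le) (hχm n) (hχ0 n) (hχ1 n) (ham n) (ha1 n) (U := U n)
    (N := N n) (fun i hi ↦ hucont _ (hη.le.trans (htime n i hi)))
    (fun i hi y ↦ hM _ _ (hη.le.trans (htime n i hi))) (fun i hi y hy ↦ by
      have hy' : |y| ≤ n := by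
        by_contra hcon
        exact hy (indicator_of_notMem (s := {y : ℝ | |y| ≤ n}) hcon _)
      have h1 := htime n (i + 1) hi
      have e : t - ((i + 1 : ℕ) : ℝ) * h n = t - i * h n - T / N n := by
        simp only [hh]; push_cast; ring
      have h2 := hN n y hy' (t - i * h n) (by rw [← e]; exact h1)
        (sub_le_self _ (mul_nonneg (Nat.cast_nonneg i) (hh0 n).le))
      simp only [ha, hU]
      rw [e]
      exact h2) (N n) le_rfl
  have hpath : Measurable fun ω (q : ℝ≥0) ↦ B q ω := measurable_pi_lambda _ hBm
  -- eventually no killing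
  have hsurv (ω : Ω') : ∀ᶠ n in atTop, ∀ i ≤ N n,
      χ n (x + √ν * B ((i : ℝ) * h n).toNNReal ω) = 1 := by
    obtain ⟨b, hb⟩ := (isCompact_Icc (a := (0 : ℝ)) (b := T)).exists_bound_of_continuousOn
      ((isRandomCurve_brownian hBc hBm ν x).continuous ω).continuousOn
    obtain ⟨n₀, hn₀⟩ := exists_nat_ge b
    filter_upwards [eventually_ge_atTop n₀] with n hn i hi
    have h1 : (i : ℝ) * h n ∈ Icc 0 T := by
      refine ⟨mul_nonneg (Nat.cast_nonneg i) (hh0 n).le, ?_⟩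
      rw [← hNh n]
      exact mul_le_mul_of_nonneg_right (by exact_mod_cast hi) (hh0 n).le
    have h2 := hb _ h1
    simp only [hχ]
    rw [indicator_of_mem]
    · rfl
    · exact h2.trans (hn₀.trans (by exact_mod_cast hn))
  have hS : Tendsto (fun n ↦ ∫ ω, gridSurvival ν x (h n) (χ n) (N n) (fun q ↦ B q ω) ∂P') atTop
      (𝓝 1) := by
    have h1 : Tendsto (fun n ↦ ∫ ω, gridSurvival ν x (h n) (χ n) (N n) (fun q ↦ B q ω) ∂P') atTop
        (𝓝 (∫ _, (1 : ℝ) ∂P')) := by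
      refine tendsto_integral_of_dominated_convergence (fun _ ↦ 1)
        (fun n ↦ ((measurable_gridSurvival ν x (h n) (hχm n) (N n)).comp
          hpath).aestronglyMeasurable) (integrable_const _)
        (fun n ↦ Eventually.of_forall fun ω ↦ ?_) (Eventually.of_forall fun ω ↦ ?_)
      · have := gridSurvival_mem ν x (h n) (hχ0 n) (hχ1 n) (N n) (fun q ↦ B q ω)
        rw [Real.norm_of_nonneg this.1]; exact this.2
      · refine tendsto_const_nhds.congr' ?_
        filter_upwards [hsurv ω] with n hn
        exact (Finset.prod_eq_one fun i hi ↦ hn i (Finset.mem_range.1 hi).le).symm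
    simpa using h1
  have hUN (n : ℕ) (y : ℝ) : U n (N n) y = u y η := by
    simp only [hU]; rw [hNh, hT]; congr 1; ring
  -- Once nothing is killed, the product of exponentials is the exponential of a Riemann sum along
  -- the path.
  have hprod (ω : Ω') : Tendsto (fun n ↦ gridProduct ν x (h n) (χ n) (a n) (N n)
      (fun q ↦ B q ω)) atTop (𝓝 (Complex.exp (-(ν / 2) * ξ ^ 2 * (T : ℝ) - Complex.I * ξ *
        (∫ s in (0 : ℝ)..T, v (brownianCurve B ν x s ω) (t - s) : ℝ)))) := by
    have hcurve : Continuous fun s ↦ v (brownianCurve B ν x s ω) (t - s) :=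
      hv.comp (((isRandomCurve_brownian hBc hBm ν x).continuous ω).prodMk (by fun_prop))
    have h1 := (tendsto_riemannSum hT0.le hcurve).comp hNtop
    have h2 : Continuous fun r : ℝ ↦
      Complex.exp (-(ν / 2) * ξ ^ 2 * (T : ℝ) - Complex.I * ξ * (r : ℂ)) := by fun_prop
    refine ((h2.tendsto _).comp h1).congr' ?_
    filter_upwards [hsurv ω] with n hn
    simp only [Function.comp, gridProduct]
    have e : ∀ i ∈ Finset.range (N n),
        ((χ n (x + √ν * B ((i : ℝ) * h n).toNNReal ω) : ℝ) : ℂ) *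
          a n i (x + √ν * B ((i : ℝ) * h n).toNNReal ω) =
        a n i (brownianCurve B ν x (i * h n) ω) := fun i hi ↦ by
      rw [hn i (Finset.mem_range.1 hi).le, Complex.ofReal_one, one_mul]; rfl
    rw [Finset.prod_congr rfl e]
    simp only [ha]
    rw [← Complex.exp_sum]
    congr 1
    have hNhc : (N n : ℂ) * (h n : ℂ) = (T : ℂ) := by exact_mod_cast hNh n
    rw [Finset.sum_sub_distrib, Finset.sum_const, Finset.card_range, nsmul_eq_mul,
      ← Finset.mul_sum, ← hNhc, Complex.ofReal_sum]
    congr 1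
    · ring
    · congr 1
      refine Finset.sum_congr rfl fun i _ ↦ ?_
      rw [smul_eq_mul, Complex.ofReal_mul]
  have hlim : Tendsto (fun n ↦ ∫ ω, gridProduct ν x (h n) (χ n) (a n) (N n) (fun q ↦ B q ω) *
        U n (N n) (x + √ν * B ((N n : ℝ) * h n).toNNReal ω) ∂P') atTop
      (𝓝 (∫ ω, Complex.exp (-(ν / 2) * ξ ^ 2 * (T : ℝ) - Complex.I * ξ *
        (∫ s in (0 : ℝ)..T, v (brownianCurve B ν x s ω) (t - s) : ℝ)) *
          u (brownianCurve B ν x T ω) η ∂P')) := by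
    simp only [hUN, hNh]
    refine tendsto_integral_of_dominated_convergence (fun _ ↦ 1 * M) (fun n ↦ ?_)
      (integrable_const _) (fun n ↦ Eventually.of_forall fun ω ↦ ?_)
      (Eventually.of_forall fun ω ↦ (hprod ω).mul_const _)
    · exact (((measurable_gridProduct ν x (h n) (hχm n) (ham n) (N n)).comp hpath).mul
        ((hucont η hη.le).measurable.comp
          (((hBm _).const_mul _).const_add _))).aestronglyMeasurable
    · rw [norm_mul]
      exact mul_le_mul ((norm_gridProduct_le ν x (h n) (hχ0 n) (ha1 n) (N n) _).trans
        (gridSurvival_mem ν x (h n) (hχ0 n) (hχ1 n) (N n) _).2) (hM _ _ hη.le) (norm_nonneg _)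
        zero_le_one
  have hstart (n : ℕ) : ∫ ω, U n 0 (x + √ν * B 0 ω) ∂P' = u x t := by
    have : ∀ᵐ ω ∂P', U n 0 (x + √ν * B 0 ω) = u x t := by
      filter_upwards [hB.eval_zero_ae_eq_zero] with ω hω
      simp [hU, hω]
    rw [integral_congr_ae this]
    simp
  -- The `N n` step errors add up to `T / (n + 1)`, and the killed mass tends to zero.
  have hright : Tendsto (fun n : ℕ ↦ (N n : ℝ) * (1 / ((n : ℝ) + 1) * h n) +
      M * (1 - ∫ ω, gridSurvival ν x (h n) (χ n) (N n) (fun q ↦ B q ω) ∂P')) atTop (𝓝 0) := by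
    have h1 : Tendsto (fun n : ℕ ↦ 1 / ((n : ℝ) + 1) * T) atTop (𝓝 (0 * T)) :=
      tendsto_one_div_add_atTop_nhds_zero_nat.mul_const T
    have h2 := h1.add ((hS.const_sub 1).const_mul M)
    simp only [zero_mul, sub_self, mul_zero, add_zero] at h2
    refine h2.congr fun n ↦ ?_
    congr 1
    rw [mul_left_comm, hNh]
  simp only [hstart] at hbound
  exact tendsto_nhds_unique (tendsto_iff_norm_sub_tendsto_zero.2
    (squeeze_zero (fun _ ↦ norm_nonneg _) hbound hright)) hlim

/-- Feynman-Kac formula for bounded classical solutions. -/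
theorem feynmanKac (hB : IsPreBrownianReal B P') (hBc : ∀ ω, Continuous fun s ↦ B s ω)
    (hBm : ∀ s, Measurable (B s)) {ν ξ : ℝ} (hν : 0 < ν) {v : ℝ → ℝ → ℝ}
    (hv : Continuous fun p : ℝ × ℝ ↦ v p.1 p.2) {g : ℝ → ℂ} {u : ℝ → ℝ → ℂ}
    (hu : IsBoundedClassicalSolution ν ξ v g u) (x : ℝ) {t : ℝ} (ht : 0 ≤ t) :
    u x t = ∫ ω, Complex.exp (-(ν / 2) * ξ ^ 2 * t - Complex.I * ξ *
      (∫ s in (0 : ℝ)..t, v (brownianCurve B ν x s ω) (t - s) : ℝ)) *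
        g (brownianCurve B ν x t ω) ∂P' := by
  have hP := hB.isGaussianProcess.isProbabilityMeasure
  rcases ht.eq_or_lt with rfl | ht0
  · have : ∀ᵐ ω ∂P', Complex.exp (-(ν / 2) * ξ ^ 2 * (0 : ℝ) - Complex.I * ξ *
        (∫ s in (0 : ℝ)..0, v (brownianCurve B ν x s ω) (0 - s) : ℝ)) *
        g (brownianCurve B ν x 0 ω) = u x 0 := by
      filter_upwards [hB.eval_zero_ae_eq_zero] with ω hω
      simp [brownianCurve, hω, hu.initial]
    rw [integral_congr_ae this]
    simp
  obtain ⟨M, hM⟩ := hu.bounded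
  -- The equation holds only for positive times, so the initial time is approached through `η n`,
  -- using continuity of `u` up to time zero; the `+ 2` makes `η n < t` already for `n = 0`.
  set η : ℕ → ℝ := fun n ↦ t * (1 / ((n : ℝ) + 2)) with hηdef
  have hη0 (n : ℕ) : 0 < η n := by positivity
  have hηt (n : ℕ) : η n < t := by
    have h1 : 1 / ((n : ℝ) + 2) < 1 := by
      rw [div_lt_one (by positivity)]
      have : (0 : ℝ) ≤ n := Nat.cast_nonneg n
      linarith
    exact mul_lt_of_lt_one_right ht0 h1
  have hηlim : Tendsto η atTop (𝓝 0) := by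
    have h1 : Tendsto (fun n : ℕ ↦ 1 / (((n + 1 : ℕ) : ℝ) + 1)) atTop (𝓝 0) :=
      tendsto_one_div_add_atTop_nhds_zero_nat.comp (tendsto_add_atTop_nat 1)
    have h2 := h1.const_mul t
    rw [mul_zero] at h2
    refine h2.congr fun n ↦ ?_
    simp only [hηdef]
    push_cast
    ring_nf
  have hTlim : Tendsto (fun n ↦ t - η n) atTop (𝓝 t) := by simpa using hηlim.const_sub t
  have hcurve (ω : Ω') : Continuous fun s ↦ v (brownianCurve B ν x s ω) (t - s) :=
    hv.comp (((isRandomCurve_brownian hBc hBm ν x).continuous ω).prodMk (by fun_prop))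
  have hAm (T : ℝ) : Measurable fun ω ↦
      ∫ s in (0 : ℝ)..T, v (brownianCurve B ν x s ω) (t - s) := by
    have h1 : StronglyMeasurable fun p : Ω' × ℝ ↦ v (brownianCurve B ν x p.2 p.1) (t - p.2) :=
      (hv.measurable.comp
        (isRandomCurve_spaceTime hBc hBm ν x t).measurable_uncurry).stronglyMeasurable
    simp only [intervalIntegral.intervalIntegral_eq_integral_uIoc]
    have h2 : Measurable fun ω ↦
        ∫ s in uIoc 0 T, v (brownianCurve B ν x s ω) (t - s) := h1.integral_prod_right'.measurable
    exact h2.const_mul (if (0 : ℝ) ≤ T then 1 else -1)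
  have hlim : Tendsto (fun n ↦ ∫ ω, Complex.exp (-(ν / 2) * ξ ^ 2 * (t - η n : ℝ) -
      Complex.I * ξ *
      (∫ s in (0 : ℝ)..(t - η n), v (brownianCurve B ν x s ω) (t - s) : ℝ)) *
        u (brownianCurve B ν x (t - η n) ω) (η n) ∂P') atTop
      (𝓝 (∫ ω, Complex.exp (-(ν / 2) * ξ ^ 2 * t - Complex.I * ξ *
      (∫ s in (0 : ℝ)..t, v (brownianCurve B ν x s ω) (t - s) : ℝ)) *
        g (brownianCurve B ν x t ω) ∂P')) := by
    refine tendsto_integral_of_dominated_convergence (fun _ ↦ 1 * M) (fun n ↦ ?_)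
      (integrable_const _) (fun n ↦ Eventually.of_forall fun ω ↦ ?_)
      (Eventually.of_forall fun ω ↦ ?_)
    · have h1 := hAm (t - η n)
      have h2 : Continuous fun y ↦ u y (η n) :=
        hu.continuous.comp_continuous (f := fun z : ℝ ↦ (z, η n)) (by fun_prop)
          fun _ ↦ (hη0 n).le
      have h3 := h2.measurable.comp
        ((isRandomCurve_brownian hBc hBm ν x).measurable (t - η n))
      exact (Measurable.mul (by fun_prop) h3).aestronglyMeasurable
    · rw [norm_mul]
      refine mul_le_mul ?_ (hM _ _ (hη0 n).le) (norm_nonneg _) zero_le_one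
      rw [Complex.norm_exp]
      refine Real.exp_le_one_iff.2 ?_
      set V := ∫ s in (0 : ℝ)..(t - η n), v (brownianCurve B ν x s ω) (t - s)
      have hn : 0 ≤ t - η n := (sub_pos.2 (hηt n)).le
      rw [show (-(ν / 2) * ξ ^ 2 * (t - η n : ℝ) - Complex.I * ξ * V : ℂ) =
        ((-(ν / 2 * ξ ^ 2 * (t - η n)) : ℝ) : ℂ) + ((-(ξ * V) : ℝ) : ℂ) * Complex.I by
          push_cast; ring,
        Complex.add_re, Complex.ofReal_re, Complex.re_ofReal_mul, Complex.I_re, mul_zero, add_zero]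
      exact neg_nonpos.2 (by positivity)
    · refine Tendsto.mul ?_ ?_
      · have h1 : Continuous fun T : ℝ ↦
            ∫ s in (0 : ℝ)..T, v (brownianCurve B ν x s ω) (t - s) :=
          intervalIntegral.continuous_primitive (fun a b ↦ (hcurve ω).intervalIntegrable a b) 0
        have h2 : Continuous fun T : ℝ ↦ Complex.exp (-(ν / 2) * ξ ^ 2 * (T : ℝ) -
          Complex.I * ξ *
          ((∫ s in (0 : ℝ)..T, v (brownianCurve B ν x s ω) (t - s) : ℝ) : ℂ)) := by fun_prop
        exact (h2.tendsto t).comp hTlim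
      · rw [← hu.initial]
        have h1 := hu.continuous (brownianCurve B ν x t ω, 0) (le_refl (0 : ℝ))
        have h2 : Tendsto (fun n ↦ (brownianCurve B ν x (t - η n) ω, η n)) atTop
            (𝓝 (brownianCurve B ν x t ω, 0)) :=
          ((((isRandomCurve_brownian hBc hBm ν x).continuous ω).tendsto t).comp
            hTlim).prodMk_nhds hηlim
        exact h1.tendsto.comp (tendsto_nhdsWithin_iff.2
          ⟨h2, Eventually.of_forall fun n ↦ (hη0 n).le⟩)
  have hconst (n : ℕ) := feynmanKac_of_pos hB hBc hBm hν hv hu x (hη0 n) (hηt n)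
  simp only [← hconst] at hlim
  exact tendsto_nhds_unique tendsto_const_nhds hlim

end FeynmanKacLimit


/-! ### Polchinski equation for covariances with a rate -/

section Rate

variable {E Ω Ω' : Type*} [NormedAddCommGroup E] [NormedSpace ℝ E] [MeasureSpace E]
  [BorelSpace E] [SecondCountableTopology E] [MeasurableSpace Ω] [MeasurableSpace Ω']
  {γ : ℝ → Ω' → E}

/-- The Polchinski equation for covariances obtained by integrating a bounded continuous rate. -/
theorem satisfiesPolchinski_of_rate [SigmaFinite (volume : Measure E)] {P : Measure Ω}
    {P' : Measure Ω'} [IsFiniteMeasure P'] (hγ : IsRandomCurve γ) {t : ℝ} (ht : 0 ≤ t) (ξ : ℝ)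
    (hac : (P'.prod (timeMeasure t)).map (fun p ↦ γ p.2 p.1) ≪ volume)
    (hac₂ : (P'.prod ((timeMeasure t).prod (timeMeasure t))).map
      (fun p ↦ (γ p.2.1 p.1, γ p.2.2 p.1)) ≪ volume)
    {g : Ω' → ℂ} (hg : Measurable g) {M : ℝ} (hgM : ∀ ω, ‖g ω‖ ≤ M)
    {C h : ℝ → E → ℂ} (hh : Continuous (Function.uncurry h)) {β : ℝ → ℝ} (hβ : Continuous β)
    (hhβ : ∀ s z, ‖h s z‖ ≤ β s) (hC : ∀ l z, C l z = ∫ s in (0 : ℝ)..l, h s z)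
    {L : ℝ} (hL : 0 ≤ L) {R : ℝ → E → ℂ} {X : ℝ → E → Ω → ℝ}
    (hX : ∀ l ∈ Icc 0 L, IsGaussianField P (X l) (R l))
    (hR : ∀ l ∈ Icc 0 L, ∀ z, R l z = C l z + C l (-z))
    {T : (E → ℝ) → ℂ} (hT : ∀ w, Continuous w → T w = phaseMean P' γ t ξ g w) :
    (∀ l ∈ Icc 0 L, ∀ w : E → ℝ, Continuous w →
      Integrable (fun ω ↦ T (fun p ↦ w p + X l p ω)) P) ∧
    SatisfiesPolchinski C L (fun l ↦ partialAverage P T (X l)) ∧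
    ∀ w : E → ℝ, Continuous w → partialAverage P T (X 0) w = T w := by
  obtain rfl : C = fun l z ↦ ∫ s in (0 : ℝ)..l, h s z := funext fun l ↦ funext (hC l)
  have hhz (z : E) : Continuous fun s ↦ h s z := hh.comp (by fun_prop : Continuous fun s ↦ (s, z))
  have hhs (s : ℝ) : Continuous (h s) := hh.comp (by fun_prop : Continuous fun z ↦ (s, z))
  refine satisfiesPolchinski_of_curve hγ ht ξ hac hac₂ hg hgM (dC := h)
    (fun l z ↦ ((hhz z).integral_hasStrictDerivAt 0 l).hasDerivAt) (fun l ↦ ?_) hhs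
    (exists_bound_integral_rate hβ hhβ) (fun z ↦ intervalIntegral.integral_same) hL hX hR hT
  exact intervalIntegral.continuous_parametric_intervalIntegral_of_continuous'
    (f := fun z s ↦ h s z) (hh.comp continuous_swap) 0 l

end Rate

/-! ### The passive scalar as a mean phase -/

section Scalar

variable {Ω' : Type*} [MeasurableSpace Ω'] {P' : Measure Ω'} {B B' : ℝ≥0 → Ω' → ℝ}

lemma steadyT_congr (h : ∀ᵐ ω ∂P', ∀ s, B s ω = B' s ω) (ν : ℝ) (θ : ℝ → ℝ → ℂ) (x ξ t : ℝ) :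
    steadyT P' B ν θ x ξ t = steadyT P' B' ν θ x ξ t := by
  refine funext fun w ↦ integral_congr_ae ?_
  filter_upwards [h] with ω hω
  rw [funext hω]

lemma unsteadyT_congr (h : ∀ᵐ ω ∂P', ∀ s, B s ω = B' s ω) (ν : ℝ) (θ : ℝ → ℝ → ℂ)
    (x ξ t : ℝ) : unsteadyT P' B ν θ x ξ t = unsteadyT P' B' ν θ x ξ t := by
  refine funext fun w ↦ integral_congr_ae ?_
  filter_upwards [h] with ω hω
  rw [funext hω]

/-- Contribution of the diffusion across the shear and of the initial datum to the weight. -/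
noncomputable def terminalWeight (B : ℝ≥0 → Ω' → ℝ) (ν : ℝ) (θ : ℝ → ℝ → ℂ) (x ξ t : ℝ)
    (ω : Ω') : ℂ :=
  Complex.exp (-(ν / 2) * ξ ^ 2 * t) * θ (brownianCurve B ν x t ω) ξ

lemma measurable_terminalWeight (hBm : ∀ s, Measurable (B s)) (ν : ℝ) {θ : ℝ → ℝ → ℂ} {ξ : ℝ}
    (hθ : Continuous fun x ↦ θ x ξ) (x t : ℝ) : Measurable (terminalWeight B ν θ x ξ t) :=
  (hθ.measurable.comp (((hBm _).const_mul _).const_add _)).const_mul _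

lemma norm_terminalWeight_le {ν : ℝ} {θ : ℝ → ℝ → ℂ} {ξ M : ℝ} (hM : ∀ x, ‖θ x ξ‖ ≤ M)
    (x t : ℝ) (ω : Ω') :
    ‖terminalWeight B ν θ x ξ t ω‖ ≤ ‖Complex.exp (-(ν / 2) * ξ ^ 2 * t)‖ * M := by
  rw [terminalWeight, norm_mul]
  exact mul_le_mul_of_nonneg_left (hM _) (norm_nonneg _)

lemma unsteadyWeight_eq {t : ℝ} (ht : 0 ≤ t) (ν : ℝ) (θ : ℝ → ℝ → ℂ) (x ξ : ℝ) (w : ℝ × ℝ → ℝ)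
    (ω : Ω') : unsteadyWeight ν θ x ξ t w (fun s ↦ B s ω) =
      Complex.exp (-Complex.I * ξ *
        curveIntegral (fun s ω ↦ (brownianCurve B ν x s ω, t - s)) t w ω) *
        terminalWeight B ν θ x ξ t ω := by
  rw [unsteadyWeight, intervalIntegral.integral_of_le ht, mul_assoc, mul_left_comm]
  rfl

/-- Damping and initial datum do not depend on the field and form the weight; the reversed time `t -
s` becomes a coordinate of the curve. -/
lemma unsteadyT_eq_phaseMean {t : ℝ} (ht : 0 ≤ t) (ν : ℝ) (θ : ℝ → ℝ → ℂ) (x ξ : ℝ)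
    (w : ℝ × ℝ → ℝ) : unsteadyT P' B ν θ x ξ t w =
      phaseMean P' (fun s ω ↦ (brownianCurve B ν x s ω, t - s)) t ξ
        (terminalWeight B ν θ x ξ t) w := by
  simp only [unsteadyT, unsteadyWeight_eq ht, phaseMean]

/-- A steady field is a space-time field constant in time, so the steady formulas are read off from
the unsteady ones. -/
lemma steadyT_eq_unsteadyT (ν : ℝ) (θ : ℝ → ℝ → ℂ) (x ξ t : ℝ) (w : ℝ → ℝ) :
    steadyT P' B ν θ x ξ t w = unsteadyT P' B ν θ x ξ t (fun p ↦ w p.1) := rfl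

lemma steadyT_eq_phaseMean {t : ℝ} (ht : 0 ≤ t) (ν : ℝ) (θ : ℝ → ℝ → ℂ) (x ξ : ℝ)
    (w : ℝ → ℝ) : steadyT P' B ν θ x ξ t w =
      phaseMean P' (brownianCurve B ν x) t ξ (terminalWeight B ν θ x ξ t) w := by
  rw [steadyT_eq_unsteadyT, unsteadyT_eq_phaseMean ht]
  rfl

lemma integrable_unsteadyWeight [IsFiniteMeasure P'] (hBc : ∀ ω, Continuous fun s ↦ B s ω)
    (hBm : ∀ s, Measurable (B s)) (ν : ℝ) {θ : ℝ → ℝ → ℂ} {ξ M t : ℝ}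
    (hθ : Continuous fun x ↦ θ x ξ) (hM : ∀ x, ‖θ x ξ‖ ≤ M) (x : ℝ) (ht : 0 ≤ t)
    {w : ℝ × ℝ → ℝ} (hw : Continuous w) :
    Integrable (fun ω ↦ unsteadyWeight ν θ x ξ t w (fun s ↦ B s ω)) P' := by
  simp only [unsteadyWeight_eq ht]
  refine Integrable.of_bound (C := ‖Complex.exp (-(ν / 2) * ξ ^ 2 * t)‖ * M)
    ((measurable_phase (isRandomCurve_spaceTime hBc hBm ν x t) t ξ hw).mul
      (measurable_terminalWeight hBm ν hθ x t)).aestronglyMeasurable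
    (Eventually.of_forall fun ω ↦ ?_)
  rw [norm_mul, norm_exp_phase, one_mul]
  exact norm_terminalWeight_le hM x t ω

/-- A bounded classical solution of the passive scalar equation is its Feynman-Kac average. -/
lemma IsBoundedClassicalSolution.eq_unsteadyT (hB : IsPreBrownianReal B P')
    (hBc : ∀ ω, Continuous fun s ↦ B s ω) (hBm : ∀ s, Measurable (B s)) {ν ξ : ℝ} (hν : 0 < ν)
    {θ : ℝ → ℝ → ℂ} {w : ℝ × ℝ → ℝ} (hw : Continuous w) {u : ℝ → ℝ → ℂ}
    (hu : IsBoundedClassicalSolution ν ξ (fun x t ↦ w (x, t)) (fun x ↦ θ x ξ) u) (x : ℝ) {t : ℝ}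
    (ht : 0 ≤ t) : u x t = unsteadyT P' B ν θ x ξ t w := by
  rw [feynmanKac hB hBc hBm hν hw hu x ht, unsteadyT]
  refine integral_congr_ae (Eventually.of_forall fun ω ↦ ?_)
  simp only [unsteadyWeight]
  rw [← Complex.exp_add, sub_eq_add_neg, neg_mul Complex.I, neg_mul (Complex.I * (ξ : ℂ))]
  rfl

end Scalar

end ShearFlow

/-! ### The Polchinski equation -/

theorem mainTheorem1
    {Ω Ω' : Type*} [MeasurableSpace Ω] [MeasurableSpace Ω'] (P : Measure Ω) (P' : Measure Ω')
    (B : ℝ≥0 → Ω' → ℝ) (hB : IsBrownianReal B P')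
    (ε ζ δ ν : ℝ) (hδ : 0 < δ) (hδ1 : δ < 1) (hν : 0 < ν)
    (θ : ℝ → ℝ → ℂ) (hθ : ∀ ξ, Continuous (fun x ↦ θ x ξ))
    (hθb : ∀ ξ, ∃ M : ℝ, ∀ x, ‖θ x ξ‖ ≤ M)
    (x ξ t : ℝ) (ht : 0 ≤ t) :
    -- steady case
    (∀ vhi : ℝ → ℝ → Ω → ℝ,
      (∀ l ∈ Icc 0 (-Real.log δ), ShearFlow.IsGaussianField P (vhi l)
        (ShearFlow.covarianceOfSpectrum (ShearFlow.steadyHighSpectrum ε l))) →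
      (∀ l ∈ Icc 0 (-Real.log δ), ∀ w : ℝ → ℝ, Continuous w →
        Integrable
          (fun ω ↦ ShearFlow.steadyT P' B ν θ x ξ t (fun p ↦ w p + vhi l p ω)) P) ∧
      ShearFlow.SatisfiesPolchinski (ShearFlow.steadyC ε) (-Real.log δ)
        (fun l ↦ ShearFlow.partialAverage P (ShearFlow.steadyT P' B ν θ x ξ t) (vhi l)) ∧
      ∀ w : ℝ → ℝ, Continuous w →
        ShearFlow.partialAverage P (ShearFlow.steadyT P' B ν θ x ξ t) (vhi 0) w
          = ShearFlow.steadyT P' B ν θ x ξ t w) ∧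
    (∀ w : ℝ → ℝ, Continuous w →
      Integrable (fun ω ↦ ShearFlow.steadyWeight ν θ x ξ t w (fun s ↦ B s ω)) P' ∧
      ∀ u : ℝ → ℝ → ℂ,
        ShearFlow.IsBoundedClassicalSolution ν ξ (fun x' _ ↦ w x') (fun x' ↦ θ x' ξ) u →
        u x t = ShearFlow.steadyT P' B ν θ x ξ t w) ∧
    -- unsteady case
    (∀ vhi : ℝ → ℝ × ℝ → Ω → ℝ,
      (∀ l ∈ Icc 0 (-Real.log δ), ShearFlow.IsGaussianField P (vhi l)
        (ShearFlow.covarianceOfSpectrum₂ (ShearFlow.unsteadyHighSpectrum ε ζ l))) →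
      (∀ l ∈ Icc 0 (-Real.log δ), ∀ w : ℝ × ℝ → ℝ, Continuous w →
        Integrable
          (fun ω ↦ ShearFlow.unsteadyT P' B ν θ x ξ t (fun p ↦ w p + vhi l p ω)) P) ∧
      ShearFlow.SatisfiesPolchinski (ShearFlow.unsteadyC ε ζ) (-Real.log δ)
        (fun l ↦ ShearFlow.partialAverage P (ShearFlow.unsteadyT P' B ν θ x ξ t) (vhi l)) ∧
      ∀ w : ℝ × ℝ → ℝ, Continuous w →
        ShearFlow.partialAverage P (ShearFlow.unsteadyT P' B ν θ x ξ t) (vhi 0) w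
          = ShearFlow.unsteadyT P' B ν θ x ξ t w) ∧
    (∀ w : ℝ × ℝ → ℝ, Continuous w →
      Integrable (fun ω ↦ ShearFlow.unsteadyWeight ν θ x ξ t w (fun s ↦ B s ω)) P' ∧
      ∀ u : ℝ → ℝ → ℂ,
        ShearFlow.IsBoundedClassicalSolution ν ξ (fun x' t' ↦ w (x', t')) (fun x' ↦ θ x' ξ) u →
        u x t = ShearFlow.unsteadyT P' B ν θ x ξ t w) := by
  -- Brownian paths are continuous only almost surely; the modification is continuous for every
  -- sample, as `IsRandomCurve` demands, and leaves all expectations unchanged.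
  obtain ⟨B', hBc, hBm, hBB'⟩ := ShearFlow.exists_continuous_modification
    hB.toIsPreBrownianReal.aemeasurable hB.cont
  have hB' : IsPreBrownianReal B' P' := hB.toIsPreBrownianReal.congr fun s ↦ by
    filter_upwards [hBB'] with ω hω using hω s
  have hP' := hB'.isGaussianProcess.isProbabilityMeasure
  obtain ⟨M, hM⟩ := hθb ξ
  have hL : 0 ≤ -Real.log δ := neg_nonneg.2 (Real.log_nonpos hδ.le hδ1.le)
  have hg := ShearFlow.measurable_terminalWeight hBm ν (hθ ξ) x t
  have hgM := ShearFlow.norm_terminalWeight_le (B := B') (ν := ν) hM x t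
  rw [ShearFlow.steadyT_congr hBB', ShearFlow.unsteadyT_congr hBB']
  have hint (w : ℝ × ℝ → ℝ) (hw : Continuous w) :
      Integrable (fun ω ↦ ShearFlow.unsteadyWeight ν θ x ξ t w (fun s ↦ B s ω)) P' := by
    refine (ShearFlow.integrable_unsteadyWeight hBc hBm ν (hθ ξ) hM x ht hw).congr ?_
    filter_upwards [hBB'] with ω hω
    rw [funext hω]
  refine ⟨fun vhi hX ↦ ?_, fun w hw ↦ ⟨?_, fun u hu ↦ ?_⟩, fun vhi hX ↦ ?_,
    fun w hw ↦ ⟨hint w hw, fun u hu ↦ hu.eq_unsteadyT hB' hBc hBm hν hw x ht⟩⟩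
  · exact ShearFlow.satisfiesPolchinski_of_rate (h := ShearFlow.steadyRate ε)
      (ShearFlow.isRandomCurve_brownian hBc hBm ν x) ht ξ
      (ShearFlow.map_steady hB' hBc hBm hν x t) (ShearFlow.map_steady₂ hB' hBc hBm hν x t)
      hg hgM (continuous_fst.steadyRate ε continuous_snd)
      ((ShearFlow.continuous_exp_rpow (1 - ε)).mul (by fun_prop))
      (fun s z ↦ (ShearFlow.norm_steadyRate ε s z).le) (ShearFlow.steadyC_eq ε) hL hX
      (fun l hl ↦ ShearFlow.covarianceOfSpectrum_steady ε hl.1)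
      (fun w _ ↦ ShearFlow.steadyT_eq_phaseMean ht ν θ x ξ w)
  · exact hint (fun p ↦ w p.1) (hw.comp continuous_fst)
  · exact hu.eq_unsteadyT (w := fun p ↦ w p.1) hB' hBc hBm hν (hw.comp continuous_fst) x ht
  · exact ShearFlow.satisfiesPolchinski_of_rate
      (ShearFlow.isRandomCurve_spaceTime hBc hBm ν x t) ht ξ
      (ShearFlow.map_unsteady hB' hBc hBm hν x t) (ShearFlow.map_unsteady₂ hB' hBc hBm hν x t)
      hg hgM (ShearFlow.continuous_unsteadyRate ε ζ)
      (((ShearFlow.continuous_exp_rpow (1 - ε)).mul (by fun_prop)).mul continuous_const)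
      (ShearFlow.norm_unsteadyRate_le ε ζ) (ShearFlow.unsteadyC_eq ε ζ) hL hX
      (fun l hl ↦ ShearFlow.covarianceOfSpectrum₂_unsteady ε ζ hl.1)
      (fun w _ ↦ ShearFlow.unsteadyT_eq_phaseMean ht ν θ x ξ w)
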